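/- **Conventions.** Composition is written in diagrammatic order. $\mathsf{cartCat}$ is the category whose objects are the categories with chosen finite products (a chosen terminal object $1$ and chosen binary products) and whose arrows are the functors that preserve the chosen finite products (objects and projections) exactly. In such a category, a commutative monoid is an object $A$ with maps $+:A\times A\to A$, $0:1\to A$ satisfying the usual laws; maps into $A$ are added by $h+k=\langle h,k\rangle +$, and a formula in variables denotes the corresponding map given by evaluation on generalized elements. **The functor Faà.** For $\mathbb X$ in $\mathsf{cartCat}$ the category $\text{Faà}(\mathbb X)$ is as follows. * Objects are pairs $((A,+,0),X)$ with $(A,+,0)$ a commutative monoid in $\mathbb X$ and $X$ an object of $\mathbb X$. * An arrow $f:((A,+,0),X)\to((B,+,0),Y)$ is a sequence $f=(f_*,f_1,f_2,\dots)$ with $f_*:X\to Y$ and, for $n\ge1$, $f_n:A^n\times X\to B$ additive (preserving $+$ and $0$) in each of its first $n$ variables and symmetric in these variables. * The identity is $(1,\pi_0,0,0,\dots)$, and composition is given by $(fg)_*=f_*g_*$ and Faà di Bruno's formula $$(fg)_n(a_1,\dots,a_n,x)=\sum_{\{B_1,\dots,B_k\}} g_k\bigl(f_{|B_1|}(a_{B_1},x),\dots,f_{|B_k|}(a_{B_k},x),f_*(x)\bigr),$$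 where the sum is over all partitions of $\{1,\dots,n\}$ into nonempty blocks and $a_{B}$ is the tuple of the $a_i$ with $i\in B$. * The chosen product of $((A,+,0),X)$ and $((B,+,0),Y)$ is $((A\times B,+,0),X\times Y)$, with componentwise monoid structure and projections $(\pi_0,\pi_0\pi_0,0,\dots)$ and $(\pi_1,\pi_0\pi_1,0,\dots)$; the chosen terminal object is $((1,!,!),1)$. An arrow $F:\mathbb X\to\mathbb Y$ of $\mathsf{cartCat}$ is sent to the functor $((A,+,0),X)\mapsto((FA,F(+),F(0)),FX)$, $(f_*,f_1,\dots)\mapsto(F(f_*),F(f_1),\dots)$. This makes Faà an endofunctor of $\mathsf{cartCat}$. **Theorem (Faà has the structure of a comonad).** There are natural transformations $\varepsilon:\text{Faà}\Rightarrow 1$ and $\delta:\text{Faà}\Rightarrow\text{Faà}\circ\text{Faà}$ that make $\text{Faà}$ a comonad on $\mathsf{cartCat}$, such that, for every $\mathbb X$ in $\mathsf{cartCat}$: * the counit $\varepsilon_{\mathbb X}:\text{Faà}(\mathbb X)\to\mathbb X$ sends $((A,+,0),X)$ to $X$ and $(f_*,f_1,f_2,\dots)$ to $f_*$; * the comultiplication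 $\delta_{\mathbb X}:\text{Faà}(\mathbb X)\to\text{Faà}(\text{Faà}(\mathbb X))$ sends $((A,+,0),X)$ to $$\bigl(\bigl(((A,+,0),A),\ (+,\pi_0+,0,0,\dots),\ (0,\pi_0 0,0,0,\dots)\bigr),\ ((A,+,0),X)\bigr);$$ * $\delta_{\mathbb X}$ sends an arrow $f=(f_*,f_1,f_2,\dots):((A,+,0),X)\to((B,+,0),Y)$ to the arrow $(\delta(f)_*,\delta(f)_1,\delta(f)_2,\dots)$ with $\delta(f)_*=f$ and, for $r\ge1$, with $\delta(f)_r:((A,+,0),A)^r\times((A,+,0),X)\to((B,+,0),B)$ given by the formal derivatives of $f_r$ as a map on $A^r\times X$: $(\delta(f)_r)_*=f_r$ and, for $s\ge1$, $$(\delta(f)_r)_s\bigl((\alpha^1_1,\dots,\alpha^1_r,\beta^1),\dots,(\alpha^s_1,\dots,\alpha^s_r,\beta^s),(a_1,\dots,a_r,x)\bigr)=\sum_{\varphi} f_{r+s-|\operatorname{dom}\varphi|}\Bigl(\bigl(\alpha_i^{\varphi(i)}\bigr)_{i\in\operatorname{dom}\varphi},\ (a_i)_{i\notin\operatorname{dom}\varphi},\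 (\beta^j)_{j\notin\operatorname{im}\varphi},\ x\Bigr),$$ where the sum is over all injective partial functions $\varphi$ from $\{1,\dots,r\}$ to $\{1,\dots,s\}$, and all $\alpha_i^j,a_i,\beta^j$ are in $A$ and $x$ is in $X$. -/

import Mathlib

namespace FaaDiBruno

section Partitions
open Finset

/-- Expansion of a symmetric multiadditive function in all its arguments. -/
theorem map_sum_of_additive {B C : Type*} [AddCommMonoid B] [AddCommMonoid C] (H : Multiset B → C)
    (hadd : ∀ a b m, H ((a + b) ::ₘ m) = H (a ::ₘ m) + H (b ::ₘ m))
    (hzero : ∀ m, H (0 ::ₘ m) = 0)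
    {κ : Type*} [Fintype κ] {σ : κ → Type*} [∀ k, Fintype (σ k)]
    [Fintype (∀ k, σ k)] (c : ∀ k, σ k → B) :
    H (univ.val.map fun k => ∑ j, c k j)
      = ∑ p : (∀ k, σ k), H (univ.val.map fun k => c k (p k)) := by
  classical
  have key : ∀ (inst : DecidableEq κ) (m : κ → B) (i : κ), ∃ m' : Multiset B, ∀ x,
      (univ : Finset κ).val.map (Function.update m i x) = x ::ₘ m' := by
    intro inst m i
    refine ⟨(univ.erase i).val.map m, fun x => ?_⟩
    have h1 : (univ : Finset κ).val = i ::ₘ (univ.erase i).val := by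
      rw [Finset.erase_val, Multiset.cons_erase (Finset.mem_univ i)]
    rw [h1, Multiset.map_cons, Function.update_self]
    congr 1
    apply Multiset.map_congr rfl
    intro k hk
    rw [Function.update_of_ne]
    rintro rfl
    exact absurd hk (Finset.notMem_erase k univ)
  have hsmul : ∀ (n : ℕ) x m, H ((n • x) ::ₘ m) = n • H (x ::ₘ m) := by
    intro n x m
    induction n with
    | zero => simp [hzero]
    | succ n ih => rw [succ_nsmul, succ_nsmul, hadd, ih]
  let M : MultilinearMap ℕ (fun _ : κ => B) C :=
    { toFun := fun m => H (univ.val.map m)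
      map_update_add' := by
        intro inst m i x y
        obtain ⟨m', hm⟩ := key inst m i
        rw [hm, hm, hm, hadd]
      map_update_smul' := by
        intro inst m i n x
        obtain ⟨m', hm⟩ := key inst m i
        rw [hm, hm, hsmul] }
  have hM : ∀ m : κ → B, M m = H (univ.val.map m) := fun _ => rfl
  have := M.map_sum c
  simp only [hM] at this
  rw [this]
  exact Finset.sum_congr (by ext; simp) fun _ _ => rfl

variable {ι : Type*} [DecidableEq ι]

/-- A partition of the set of blocks of `Q` determines `Q`. -/
theorem sigma_partition_ext {s : Finset ι} (x y : Σ Q : Finpartition s, Finpartition Q.parts)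
    (h : x.2.parts = y.2.parts) : x = y := by
  obtain ⟨Q, R⟩ := x
  obtain ⟨Q', R'⟩ := y
  have hQ : Q = Q' := by
    ext1
    rw [← R.sup_parts, ← R'.sup_parts]
    exact congrArg (fun t => t.sup id) h
  subst hQ
  congr
  ext1
  exact h

/-- The partition of the set of all blocks of the partitions `Q B`, by the partitions `Q B`. -/
def bindBlocks {s : Finset ι} (P : Finpartition s) (Q : ∀ B : P.parts, Finpartition B.1) :
    Finpartition (P.bind fun B hB => Q ⟨B, hB⟩).parts :=
  Finpartition.ofExistsUnique (univ.image fun B => (Q B).parts)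
    (by
      intro p hp b hb
      obtain ⟨B, -, rfl⟩ := Finset.mem_image.1 hp
      rw [Finpartition.mem_bind]
      exact ⟨B.1, B.2, hb⟩)
    (by
      intro b hb
      rw [Finpartition.mem_bind] at hb
      obtain ⟨B, hB, hb⟩ := hb
      refine ⟨(Q ⟨B, hB⟩).parts, ⟨Finset.mem_image_of_mem _ (Finset.mem_univ _), hb⟩, ?_⟩
      rintro p ⟨hp, hbp⟩
      obtain ⟨⟨B', hB'⟩, -, rfl⟩ := Finset.mem_image.1 hp
      obtain ⟨i, hi⟩ := (Q ⟨B, hB⟩).nonempty_of_mem_parts hb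
      have h1 : i ∈ B := (Q ⟨B, hB⟩).subset hb hi
      have h2 : i ∈ B' := (Q ⟨B', hB'⟩).subset hbp hi
      have := P.eq_of_mem_parts hB hB' h1 h2
      subst this
      rfl)
    (by
      intro h
      obtain ⟨B, -, hB⟩ := Finset.mem_image.1 h
      have := (Q B).parts_eq_empty_iff.1 hB
      exact P.ne_bot B.2 this)

theorem sum_partition_partition {M : Type*} [AddCommMonoid M]
    (F : Finset (Finset (Finset ι)) → M) (s : Finset ι) :
    ∑ P : Finpartition s, ∑ Q : (∀ B : P.parts, Finpartition B.1),
        F (univ.image fun B => (Q B).parts)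
      = ∑ Q : Finpartition s, ∑ R : Finpartition Q.parts, F R.parts := by
  rw [← Fintype.sum_sigma' (fun (P : Finpartition s) (Q : ∀ B : P.parts, Finpartition B.1) =>
    F (univ.image fun B => (Q B).parts)),
    ← Fintype.sum_sigma' (fun (Q : Finpartition s) (R : Finpartition Q.parts) => F R.parts)]
  refine Fintype.sum_bijective (fun x => ⟨_, bindBlocks x.1 x.2⟩) ⟨?_, ?_⟩ _ _ (fun _ => rfl)
  · rintro ⟨P, Q⟩ ⟨P', Q'⟩ h
    have h' : (univ.image fun B => (Q B).parts) = univ.image fun B => (Q' B).parts :=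
      congrArg (fun z : Σ Q : Finpartition s, Finpartition Q.parts => z.2.parts) h
    have hsup : ∀ (P : Finpartition s) (Q : ∀ B : P.parts, Finpartition B.1),
        P.parts = (univ.image fun B => (Q B).parts).image fun t => t.sup id := by
      intro P Q
      ext B
      simp only [Finset.mem_image, Finset.mem_univ, true_and, exists_exists_eq_and,
        Finpartition.sup_parts]
      exact ⟨fun hB => ⟨⟨B, hB⟩, rfl⟩, fun ⟨B', hB'⟩ => hB' ▸ B'.2⟩
    have hP : P = P' := by
      ext1
      rw [hsup P Q, hsup P' Q', h']
    subst hP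
    congr
    funext B
    have hB : (Q B).parts ∈ univ.image fun B => (Q' B).parts :=
      h' ▸ Finset.mem_image_of_mem _ (Finset.mem_univ _)
    obtain ⟨B', -, hB'⟩ := Finset.mem_image.1 hB
    have : B' = B := by
      ext1
      rw [← (Q B).sup_parts, ← (Q' B').sup_parts, hB']
    subst this
    ext1
    exact hB'.symm
  · rintro ⟨Q, R⟩
    have hmem : ∀ (S : Finset (Finset ι)) (i : ι), i ∈ S.sup id ↔ ∃ b ∈ S, i ∈ b := by
      intro S i
      simp [Finset.mem_sup]
    have huniq : ∀ S ∈ R.parts, ∀ S' ∈ R.parts, ∀ i, i ∈ S.sup id → i ∈ S'.sup id → S = S' := by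
      intro S hS S' hS' i hi hi'
      obtain ⟨b, hb, hib⟩ := (hmem _ _).1 hi
      obtain ⟨b', hb', hib'⟩ := (hmem _ _).1 hi'
      have := Q.eq_of_mem_parts (R.subset hS hb) (R.subset hS' hb') hib hib'
      subst this
      exact R.eq_of_mem_parts hS hS' hb hb'
    have hne : ∀ S ∈ R.parts, ∃ i, i ∈ S.sup id := by
      intro S hS
      obtain ⟨b, hb⟩ := R.nonempty_of_mem_parts hS
      obtain ⟨i, hi⟩ := Q.nonempty_of_mem_parts (R.subset hS hb)
      exact ⟨i, (hmem _ _).2 ⟨b, hb, hi⟩⟩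
    let P : Finpartition s := Finpartition.ofExistsUnique (R.parts.image fun S => S.sup id)
      (by
        intro B hB i hi
        obtain ⟨S, hS, rfl⟩ := Finset.mem_image.1 hB
        obtain ⟨b, hb, hib⟩ := (hmem _ _).1 hi
        exact Q.subset (R.subset hS hb) hib)
      (by
        intro i hi
        obtain ⟨b, hb, hib⟩ := Q.exists_mem hi
        obtain ⟨S, hS, hbS⟩ := R.exists_mem hb
        have hiS := (hmem _ _).2 ⟨b, hbS, hib⟩
        refine ⟨S.sup id, ⟨Finset.mem_image_of_mem _ hS, hiS⟩, ?_⟩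
        rintro B ⟨hB, hiB⟩
        obtain ⟨S', hS', rfl⟩ := Finset.mem_image.1 hB
        rw [huniq S hS S' hS' i hiS hiB])
      (by
        intro h
        obtain ⟨S, hS, hS0⟩ := Finset.mem_image.1 h
        obtain ⟨i, hi⟩ := hne S hS
        rw [hS0] at hi
        simp at hi)
    have hch : ∀ B : P.parts, ∃ S ∈ R.parts, S.sup id = B.1 := fun B =>
      Finset.mem_image.1 B.2
    choose S hS hSB using hch
    refine ⟨⟨P, fun B => Q.ofSubset (R.subset (hS B)) (hSB B)⟩, ?_⟩
    apply sigma_partition_ext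
    change (univ.image fun B => S B) = R.parts
    ext T
    simp only [Finset.mem_image, Finset.mem_univ, true_and]
    constructor
    · rintro ⟨B, rfl⟩
      exact hS B
    · intro hT
      refine ⟨⟨T.sup id, Finset.mem_image_of_mem _ hT⟩, ?_⟩
      obtain ⟨i, hi⟩ := hne T hT
      exact huniq _ (hS _) _ hT i (by rw [hSB]; exact hi) hi

variable {A B C D : Type*}

/-- The sum over all partitions of the finite set `s` of the terms `G {F a|B : B a block}`. -/
def partSum [AddCommMonoid C] (G : Multiset B → C) (F : Multiset A → B)
    (s : Finset ι) (a : ι → A) : C :=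
  ∑ P : Finpartition s, G (P.parts.val.map fun b => F (b.val.map a))

theorem partSum_congr [AddCommMonoid C] (G : Multiset B → C) (F : Multiset A → B)
    (s : Finset ι) (a a' : ι → A) (h : ∀ i ∈ s, a i = a' i) :
    partSum G F s a = partSum G F s a' := by
  refine Finset.sum_congr rfl fun P _ => congrArg G ?_
  refine Multiset.map_congr rfl fun b hb => congrArg F ?_
  exact Multiset.map_congr rfl fun i hi => h i (P.subset hb hi)

/-- Transport of a partition along an embedding. -/
def mapPartition {κ : Type*} [DecidableEq κ] (e : κ ↪ ι) {s : Finset κ} (P : Finpartition s) :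
    Finpartition (s.map e) :=
  Finpartition.ofExistsUnique (P.parts.map (Finset.mapEmbedding e).toEmbedding)
    (by
      intro p hp
      obtain ⟨b, hb, rfl⟩ := Finset.mem_map.1 hp
      exact Finset.map_subset_map.2 (P.subset hb))
    (by
      intro i hi
      obtain ⟨k, hk, rfl⟩ := Finset.mem_map.1 hi
      obtain ⟨b, hb, hkb⟩ := P.exists_mem hk
      refine ⟨b.map e, ⟨Finset.mem_map_of_mem _ hb, Finset.mem_map_of_mem _ hkb⟩, ?_⟩
      rintro p ⟨hp, hkp⟩
      obtain ⟨b', hb', rfl⟩ := Finset.mem_map.1 hp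
      have hkb' : k ∈ b' := by
        obtain ⟨k', hk', h⟩ := Finset.mem_map.1 hkp
        exact e.injective h ▸ hk'
      rw [P.eq_of_mem_parts hb hb' hkb hkb']
      rfl)
    (by
      intro h
      obtain ⟨b, hb, hb0⟩ := Finset.mem_map.1 h
      exact P.ne_bot hb (Finset.map_eq_empty.1 hb0))

theorem partSum_map [AddCommMonoid C] (G : Multiset B → C) (F : Multiset A → B)
    {κ : Type*} [DecidableEq κ] (e : κ ↪ ι) (s : Finset κ) (a : ι → A) :
    partSum G F (s.map e) a = partSum G F s (a ∘ e) := by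
  symm
  refine Fintype.sum_bijective (mapPartition e) ⟨?_, ?_⟩ _ _ ?_
  · intro P P' h
    ext1
    exact Finset.map_injective _ (congrArg Finpartition.parts h)
  · intro Q
    have hpre : ∀ b ∈ Q.parts, (b.preimage e e.injective.injOn).map e = b := by
      intro b hb
      ext i
      simp only [Finset.mem_map, Finset.mem_preimage]
      constructor
      · rintro ⟨k, hk, rfl⟩
        exact hk
      · intro hi
        obtain ⟨k, -, rfl⟩ := Finset.mem_map.1 (Q.subset hb hi)
        exact ⟨k, hi, rfl⟩
    refine ⟨Finpartition.ofExistsUnique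
      (Q.parts.image fun b => b.preimage e e.injective.injOn) ?_ ?_ ?_, ?_⟩
    · intro p hp k hk
      obtain ⟨b, hb, rfl⟩ := Finset.mem_image.1 hp
      have := Q.subset hb (Finset.mem_preimage.1 hk)
      obtain ⟨k', hk', h⟩ := Finset.mem_map.1 this
      exact e.injective h ▸ hk'
    · intro k hk
      obtain ⟨b, hb, hkb⟩ := Q.exists_mem (Finset.mem_map_of_mem e hk)
      refine ⟨_, ⟨Finset.mem_image_of_mem _ hb, Finset.mem_preimage.2 hkb⟩, ?_⟩
      rintro p ⟨hp, hkp⟩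
      obtain ⟨b', hb', rfl⟩ := Finset.mem_image.1 hp
      have h := Q.eq_of_mem_parts hb hb' hkb (Finset.mem_preimage.1 hkp)
      subst h
      rfl
    · intro h
      obtain ⟨b, hb, hb0⟩ := Finset.mem_image.1 h
      have := hpre b hb
      rw [hb0, Finset.map_empty] at this
      exact Q.ne_bot hb this.symm
    · ext b
      simp only [mapPartition, Finpartition.ofExistsUnique_parts, Finset.mem_map,
        Finset.mem_image, exists_exists_and_eq_and]
      constructor
      · rintro ⟨b', hb', h⟩
        have h' : (b'.preimage e e.injective.injOn).map e = b := h
        rw [hpre b' hb'] at h'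
        exact h' ▸ hb'
      · intro hb
        exact ⟨b, hb, hpre b hb⟩
  · intro P
    refine congrArg G ?_
    simp only [mapPartition, Finpartition.ofExistsUnique_parts, Finset.map_val, Multiset.map_map]
    refine Multiset.map_congr rfl fun b _ => congrArg F ?_
    simp

theorem exists_equiv_of_perm {l l' : List A} (h : l.Perm l') :
    ∃ e : Fin l.length ≃ Fin l'.length, ∀ i, l'.get (e i) = l.get i := by
  induction h with
  | nil => exact ⟨Equiv.refl _, fun _ => rfl⟩
  | @cons x l l' h ih =>
    obtain ⟨e, he⟩ := ih
    refine ⟨(finSuccEquiv _).trans ((Equiv.optionCongr e).trans (finSuccEquiv _).symm), ?_⟩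
    intro i
    refine Fin.cases ?_ (fun j => ?_) i
    · simp
    · simpa using he j
  | swap x y l =>
    refine ⟨Equiv.swap ⟨0, by simp⟩ ⟨1, by simp⟩, ?_⟩
    rintro ⟨i, hi⟩
    match i, hi with
    | 0, hi => simp
    | 1, hi => simp
    | n + 2, hi =>
      rw [Equiv.swap_apply_of_ne_of_ne] <;> simp
  | trans h h' ih ih' =>
    obtain ⟨e, he⟩ := ih
    obtain ⟨e', he'⟩ := ih'
    exact ⟨e.trans e', fun i => by rw [Equiv.trans_apply, he', he]⟩

theorem partSum_perm [AddCommMonoid C] (G : Multiset B → C) (F : Multiset A → B)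
    {l l' : List A} (h : l.Perm l') :
    partSum G F univ l.get = partSum G F univ l'.get := by
  obtain ⟨e, he⟩ := exists_equiv_of_perm h
  have : (univ : Finset (Fin l'.length)) = univ.map e.toEmbedding := by simp
  rw [this, partSum_map]
  exact partSum_congr _ _ _ _ _ fun i _ => (he i).symm

/-- Each summand depends on the variable `i` through one entry of one block. -/
theorem exists_term_eq (G : Multiset B → C) (F : Multiset A → B) {s : Finset ι}
    (P : Finpartition s) {i : ι} (hi : i ∈ s) (a : ι → A) :
    ∃ (m : Multiset A) (M : Multiset B), ∀ x,
      G (P.parts.val.map fun b => F (b.val.map (Function.update a i x))) = G (F (x ::ₘ m) ::ₘ M) := by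
  obtain ⟨b, hb, hib⟩ := P.exists_mem hi
  refine ⟨(b.erase i).val.map a, (P.parts.erase b).val.map fun b => F (b.val.map a), fun x => ?_⟩
  congr 1
  have h1 : P.parts.val = b ::ₘ (P.parts.erase b).val := by
    rw [Finset.erase_val, Multiset.cons_erase hb]
  have h2 : b.val = i ::ₘ (b.erase i).val := by
    rw [Finset.erase_val, Multiset.cons_erase hib]
  rw [h1, Multiset.map_cons]
  congr 1
  · rw [h2, Multiset.map_cons, Function.update_self]
    congr 2
    refine Multiset.map_congr rfl fun j hj => Function.update_of_ne ?_ _ _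
    rintro rfl
    exact absurd hj (Finset.notMem_erase j b)
  · refine Multiset.map_congr rfl fun b' hb' => congrArg F ?_
    refine Multiset.map_congr rfl fun j hj => Function.update_of_ne ?_ _ _
    rintro rfl
    have hb'' : b' ∈ P.parts.erase b := hb'
    rw [Finset.mem_erase] at hb''
    exact hb''.1 (P.eq_of_mem_parts hb''.2 hb hj hib)

theorem partSum_update_add [AddCommMonoid A] [AddCommMonoid B] [AddCommMonoid C]
    (G : Multiset B → C) (F : Multiset A → B)
    (hG : ∀ a b m, G ((a + b) ::ₘ m) = G (a ::ₘ m) + G (b ::ₘ m))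
    (hF : ∀ a b m, F ((a + b) ::ₘ m) = F (a ::ₘ m) + F (b ::ₘ m))
    {s : Finset ι} {i : ι} (hi : i ∈ s) (a : ι → A) (x y : A) :
    partSum G F s (Function.update a i (x + y))
      = partSum G F s (Function.update a i x) + partSum G F s (Function.update a i y) := by
  unfold partSum
  rw [← Finset.sum_add_distrib]
  refine Finset.sum_congr rfl fun P _ => ?_
  obtain ⟨m, M, h⟩ := exists_term_eq G F P hi a
  rw [h, h, h, hF, hG]

theorem partSum_update_zero [AddCommMonoid A] [AddCommMonoid B] [AddCommMonoid C]
    (G : Multiset B → C) (F : Multiset A → B)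
    (hG : ∀ m, G (0 ::ₘ m) = 0) (hF : ∀ m, F (0 ::ₘ m) = 0)
    {s : Finset ι} {i : ι} (hi : i ∈ s) (a : ι → A) :
    partSum G F s (Function.update a i 0) = 0 := by
  refine Finset.sum_eq_zero fun P _ => ?_
  obtain ⟨m, M, h⟩ := exists_term_eq G F P hi a
  rw [h, hF, hG]

/-- The sum over all partitions, as a function of a multiset of arguments. -/
def partComp [AddCommMonoid C] (G : Multiset B → C) (F : Multiset A → B) (m : Multiset A) : C :=
  Quotient.liftOn m (fun l => partSum G F univ l.get) fun _ _ h => partSum_perm G F h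

theorem partComp_eq [AddCommMonoid C] (G : Multiset B → C) (F : Multiset A → B)
    (s : Finset ι) (a : ι → A) :
    partComp G F (s.val.map a) = partSum G F s a := by
  have hs : s.val.map a = ((s.toList.map a : List A) : Multiset A) := by
    rw [← Multiset.map_coe, Finset.coe_toList]
  rw [hs]
  change partSum G F univ (s.toList.map a).get = _
  let e : Fin (s.toList.map a).length ↪ ι :=
    ⟨fun i => s.toList.get (i.cast (by simp)), by
      intro i j h
      have := (List.nodup_iff_injective_get.1 s.nodup_toList) h
      exact Fin.cast_injective _ this⟩
  have hse : s = univ.map e := by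
    ext i
    simp only [Finset.mem_map, Finset.mem_univ, true_and]
    rw [← Finset.mem_toList, List.mem_iff_get]
    constructor
    · rintro ⟨n, hn⟩
      exact ⟨n.cast (by simp), hn⟩
    · rintro ⟨n, hn⟩
      exact ⟨_, hn⟩
  conv_rhs => rw [hse, partSum_map]
  refine partSum_congr _ _ _ _ _ fun i _ => ?_
  simp [e]

theorem partComp_cons_add [AddCommMonoid A] [AddCommMonoid B] [AddCommMonoid C]
    (G : Multiset B → C) (F : Multiset A → B)
    (hG : ∀ a b m, G ((a + b) ::ₘ m) = G (a ::ₘ m) + G (b ::ₘ m))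
    (hF : ∀ a b m, F ((a + b) ::ₘ m) = F (a ::ₘ m) + F (b ::ₘ m)) (x y : A) (m : Multiset A) :
    partComp G F ((x + y) ::ₘ m) = partComp G F (x ::ₘ m) + partComp G F (y ::ₘ m) := by
  induction m using Quotient.inductionOn with
  | h l =>
    have key : ∀ z, partComp G F (z ::ₘ (l : Multiset A))
        = partSum G F univ (Function.update (0 :: l).get 0 z) := by
      intro z
      change partSum G F univ (z :: l).get = _
      refine partSum_congr _ _ _ _ _ fun i _ => ?_
      refine Fin.cases ?_ (fun j => ?_) i <;> simp
    exact (key _).trans ((partSum_update_add G F hG hF (Finset.mem_univ _) _ x y).trans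
      (congrArg₂ _ (key _).symm (key _).symm))

theorem partComp_cons_zero [AddCommMonoid A] [AddCommMonoid B] [AddCommMonoid C]
    (G : Multiset B → C) (F : Multiset A → B)
    (hG : ∀ m, G (0 ::ₘ m) = 0) (hF : ∀ m, F (0 ::ₘ m) = 0) (m : Multiset A) :
    partComp G F (0 ::ₘ m) = 0 := by
  induction m using Quotient.inductionOn with
  | h l =>
    have key : ∀ z, partComp G F (z ::ₘ (l : Multiset A))
        = partSum G F univ (Function.update (0 :: l).get 0 z) := by
      intro z
      change partSum G F univ (z :: l).get = _
      refine partSum_congr _ _ _ _ _ fun i _ => ?_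
      refine Fin.cases ?_ (fun j => ?_) i <;> simp
    exact (key _).trans (partSum_update_zero G F hG hF (Finset.mem_univ _) _)

theorem partComp_assoc [AddCommMonoid C] [AddCommMonoid D]
    (H : Multiset C → D) (G : Multiset B → C) (F : Multiset A → B)
    (hadd : ∀ a b m, H ((a + b) ::ₘ m) = H (a ::ₘ m) + H (b ::ₘ m))
    (hzero : ∀ m, H (0 ::ₘ m) = 0) (m : Multiset A) :
    partComp H (partComp G F) m = partComp (partComp H G) F m := by
  induction m using Quotient.inductionOn with
  | h l =>
    change partSum H (partComp G F) univ l.get = partSum (partComp H G) F univ l.get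
    generalize l.get = a
    generalize (univ : Finset (Fin l.length)) = s
    have hR : ∀ Q : Finpartition s,
        partComp H G (Q.parts.val.map fun b => F (b.val.map a))
          = ∑ R : Finpartition Q.parts,
              H (R.parts.val.map fun S => G (S.val.map fun b => F (b.val.map a))) := by
      intro Q
      rw [partComp_eq]
      rfl
    have hL : ∀ P : Finpartition s,
        H (P.parts.val.map fun b => partComp G F (b.val.map a))
          = ∑ Q : (∀ B : P.parts, Finpartition B.1), H ((univ.image fun B => (Q B).parts).val.map
              fun S => G (S.val.map fun b => F (b.val.map a))) := by
      intro P
      have h1 : (P.parts.val.map fun b => partComp G F (b.val.map a))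
          = (univ : Finset P.parts).val.map fun B => ∑ Q : Finpartition B.1,
              G (Q.parts.val.map fun b => F (b.val.map a)) := by
        have : P.parts.val = (univ : Finset P.parts).val.map Subtype.val :=
          (Multiset.attach_map_val _).symm
        conv_lhs => rw [this, Multiset.map_map]
        refine Multiset.map_congr rfl fun B _ => ?_
        exact partComp_eq _ _ _ _
      rw [h1, map_sum_of_additive H hadd hzero]
      refine Finset.sum_congr rfl fun Q _ => congrArg H ?_
      rw [Finset.image_val_of_injOn, Multiset.map_map]
      · rfl
      · intro B _ B' _ h
        ext1
        rw [← (Q B).sup_parts, ← (Q B').sup_parts]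
        exact congrArg (fun t => t.sup id) h
    unfold partSum
    simp only [hL, hR]
    exact sum_partition_partition
      (fun T => H (T.val.map fun S => G (S.val.map fun b => F (b.val.map a)))) s

/-- If `F` is concentrated in degree one, only the partition into singletons contributes. -/
theorem partComp_linear_right [AddCommMonoid B] [AddCommMonoid C]
    (G : Multiset B → C) (F : Multiset A → B) (k : A → B)
    (hG : ∀ m, G (0 ::ₘ m) = 0) (hF : ∀ m, Multiset.card m ≠ 1 → F m = 0)
    (hk : ∀ a, F {a} = k a) (m : Multiset A) :
    partComp G F m = G (m.map k) := by
  induction m using Quotient.inductionOn with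
  | h l =>
    change partSum G F univ l.get = _
    unfold partSum
    rw [Finset.sum_eq_single (⊥ : Finpartition (univ : Finset (Fin l.length)))]
    · congr 1
      rw [Finpartition.parts_bot, Finset.map_val, Multiset.map_map]
      have h2 : (Quotient.mk _ l : Multiset A) = (univ : Finset (Fin l.length)).val.map l.get := by
        simp only [Fin.univ_val_map, List.ofFn_get]
        rfl
      rw [h2, Multiset.map_map]
      refine Multiset.map_congr rfl fun i _ => ?_
      exact hk _
    · intro P _ hP
      have : ∃ b ∈ P.parts, b.card ≠ 1 := by
        by_contra hcon
        push Not at hcon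
        apply hP
        ext b
        rw [Finpartition.mem_bot_iff]
        constructor
        · intro hb
          obtain ⟨i, rfl⟩ := Finset.card_eq_one.1 (hcon b hb)
          exact ⟨i, Finset.mem_univ _, rfl⟩
        · rintro ⟨i, hi, rfl⟩
          obtain ⟨b, hb, hib⟩ := P.exists_mem hi
          obtain ⟨j, rfl⟩ := Finset.card_eq_one.1 (hcon b hb)
          rw [Finset.mem_singleton] at hib
          exact hib ▸ hb
      obtain ⟨b, hb, hb1⟩ := this
      have h1 : P.parts.val = b ::ₘ (P.parts.erase b).val := by
        rw [Finset.erase_val, Multiset.cons_erase hb]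
      rw [h1, Multiset.map_cons, hF, hG]
      rw [Multiset.card_map]
      exact hb1
    · simp

/-- If `G` is concentrated in degree one, only the one-block partition contributes. -/
theorem partComp_linear_left [AddCommMonoid B] [AddCommMonoid C]
    (G : Multiset B → C) (F : Multiset A → B) (k : B → C)
    (hG : ∀ m, Multiset.card m ≠ 1 → G m = 0) (hk : ∀ b, G {b} = k b)
    (h0 : k (F 0) = 0) (m : Multiset A) :
    partComp G F m = k (F m) := by
  induction m using Quotient.inductionOn with
  | h l =>
    change partSum G F univ l.get = _
    unfold partSum
    have h2 : (Quotient.mk _ l : Multiset A) = (univ : Finset (Fin l.length)).val.map l.get := by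
      simp only [Fin.univ_val_map, List.ofFn_get]
      rfl
    rw [h2]
    generalize l.get = a
    by_cases hs : (univ : Finset (Fin l.length)) = ∅
    · refine (Finset.sum_eq_zero fun P _ => ?_).trans ?_
      · apply hG
        rw [Multiset.card_map]
        have := P.parts_eq_empty_iff.2 hs
        rw [this]
        simp
      · rw [hs]
        exact h0.symm
    · rw [Finset.sum_eq_single (Finpartition.indiscrete hs)]
      · rw [← hk]
        rfl
      · intro P _ hP
        apply hG
        rw [Multiset.card_map]
        intro hc
        apply hP
        obtain ⟨b, hb⟩ := Finset.card_eq_one.1 hc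
        have h3 := P.sup_parts
        rw [hb, Finset.sup_singleton] at h3
        ext1
        rw [hb, Finpartition.indiscrete_parts, ← h3]
        rfl
      · simp

end Partitions

open CategoryTheory MonoidalCategory CartesianMonoidalCategory

universe v u

section Construction

variable {C : Type u} [Category.{v} C] [CartesianMonoidalCategory C]

variable (C) in
/-- A commutative monoid `(X, +, 0)` in a category with chosen finite products. -/
structure CMon where
  X : C
  [mon : AddMonObj X]
  comm : lift (snd X X) (fst X X) ≫ AddMonObj.add = (AddMonObj.add : X ⊗ X ⟶ X)

attribute [instance] CMon.mon

namespace CMon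

/-- The addition `A × A ⟶ A`. -/
def add (A : CMon C) : A.X ⊗ A.X ⟶ A.X := AddMonObj.add

/-- The zero `1 ⟶ A`. -/
def zero (A : CMon C) : 𝟙_ C ⟶ A.X := AddMonObj.zero

/-- The pointwise addition on generalized elements: `f + g = ⟨f, g⟩ +` and `0 = ! 0`. -/
instance homAddCommMonoid (T : C) (A : CMon C) : AddCommMonoid (T ⟶ A.X) :=
  { Hom.addMonoid with
    add_comm := fun f g => by
      change lift f g ≫ AddMonObj.add = lift g f ≫ AddMonObj.add
      conv_lhs => rw [← A.comm]
      rw [← Category.assoc]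
      congr 1
      ext <;> simp }

theorem add_def {T : C} {A : CMon C} (f g : T ⟶ A.X) : f + g = lift f g ≫ A.add := rfl

theorem zero_def {T : C} {A : CMon C} : (0 : T ⟶ A.X) = toUnit T ≫ A.zero := rfl

theorem comp_add {S T : C} {A : CMon C} (t : S ⟶ T) (f g : T ⟶ A.X) :
    t ≫ (f + g) = t ≫ f + t ≫ g := by
  rw [add_def, add_def, ← Category.assoc]
  congr 1
  ext <;> simp

theorem comp_zero {S T : C} {A : CMon C} (t : S ⟶ T) : t ≫ (0 : T ⟶ A.X) = 0 := by
  rw [zero_def, zero_def, ← Category.assoc]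
  congr 1
  exact toUnit_unique _ _

theorem comp_sum {S T : C} {A : CMon C} (t : S ⟶ T) {ι : Type*} (s : Finset ι) (f : ι → (T ⟶ A.X)) :
    t ≫ ∑ i ∈ s, f i = ∑ i ∈ s, t ≫ f i := by
  classical
  induction s using Finset.induction_on with
  | empty => exact comp_zero t
  | insert i s hi ih => rw [Finset.sum_insert hi, Finset.sum_insert hi, comp_add, ih]

/-- Constructor from the commutative monoid laws on generalized elements. -/
def ofLaws (X : C) (add : X ⊗ X ⟶ X) (zero : 𝟙_ C ⟶ X)
    (zero_add : ∀ (T : C) (f : T ⟶ X), lift (toUnit T ≫ zero) f ≫ add = f)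
    (add_comm : ∀ (T : C) (f g : T ⟶ X), lift f g ≫ add = lift g f ≫ add)
    (add_assoc : ∀ (T : C) (f g h : T ⟶ X),
      lift (lift f g ≫ add) h ≫ add = lift f (lift g h ≫ add) ≫ add) : CMon C where
  X := X
  mon :=
    { add := add
      zero := zero
      zero_add := by
        have := zero_add _ (snd (𝟙_ C) X)
        rw [leftUnitor_hom, ← this]
        congr 1
        ext <;> simp
        rw [toUnit_unique (fst (𝟙_ C) X) (toUnit _)]
      add_zero := by
        have := zero_add _ (fst X (𝟙_ C))
        rw [add_comm] at this
        rw [rightUnitor_hom, ← this]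
        congr 1
        ext <;> simp
        rw [toUnit_unique (snd X (𝟙_ C)) (toUnit _)]
      add_assoc := by
        have := add_assoc _ (fst (X ⊗ X) X ≫ fst X X) (fst (X ⊗ X) X ≫ snd X X) (snd (X ⊗ X) X)
        have e1 : add ▷ X = lift (lift (fst (X ⊗ X) X ≫ fst X X)
            (fst (X ⊗ X) X ≫ snd X X) ≫ add) (snd (X ⊗ X) X) := by
          ext <;> simp
        have e2 : (α_ X X X).hom ≫ X ◁ add = lift (fst (X ⊗ X) X ≫ fst X X)
            (lift (fst (X ⊗ X) X ≫ snd X X) (snd (X ⊗ X) X) ≫ add) := by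
          ext <;> simp
          rw [← Category.assoc]
          congr 1
          ext <;> simp
        rw [← Category.assoc (α_ X X X).hom, e2, e1]
        exact this }
  comm := by
    have := add_comm _ (snd X X) (fst X X)
    rw [lift_fst_snd, Category.id_comp] at this
    exact this

theorem ext' {A B : CMon C} (h : A.X = B.X)
    (hadd : A.add ≫ eqToHom h
      = lift (fst A.X A.X ≫ eqToHom h) (snd A.X A.X ≫ eqToHom h) ≫ B.add)
    (hzero : A.zero ≫ eqToHom h = B.zero) : A = B := by
  obtain ⟨X, hA⟩ := A
  obtain ⟨Y, hB⟩ := B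
  change X = Y at h
  subst h
  simp only [eqToHom_refl, Category.comp_id, lift_fst_snd, Category.id_comp] at hadd hzero
  rename_i m n
  have : m = n := by
    cases m
    cases n
    congr
  subst this
  rfl

/-- A map between commutative monoids is additive when it preserves `+` and `0`. -/
structure IsAdditive {A B : CMon C} (k : A.X ⟶ B.X) : Prop where
  map_add : ∀ {T : C} (f g : T ⟶ A.X), (f + g) ≫ k = f ≫ k + g ≫ k
  map_zero : ∀ T : C, (0 : T ⟶ A.X) ≫ k = 0

/-- The product `(A × B, ex (+ × +), 0 × 0)` of two commutative monoids. -/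
def prod (A B : CMon C) : CMon C :=
  ofLaws (A.X ⊗ B.X)
    (lift
      (fst (A.X ⊗ B.X) (A.X ⊗ B.X) ≫ fst A.X B.X + snd (A.X ⊗ B.X) (A.X ⊗ B.X) ≫ fst A.X B.X)
      (fst (A.X ⊗ B.X) (A.X ⊗ B.X) ≫ snd A.X B.X + snd (A.X ⊗ B.X) (A.X ⊗ B.X) ≫ snd A.X B.X))
    (lift A.zero B.zero)
    (by
      intro T f
      ext
      · simp only [Category.assoc, lift_fst, comp_add, lift_fst_assoc, lift_snd_assoc]
        rw [← zero_def, _root_.zero_add]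
      · simp only [Category.assoc, lift_snd, comp_add, lift_fst_assoc, lift_snd_assoc]
        rw [← zero_def, _root_.zero_add])
    (by
      intro T f g
      ext
      · simp only [Category.assoc, lift_fst, comp_add, lift_fst_assoc, lift_snd_assoc]
        rw [_root_.add_comm]
      · simp only [Category.assoc, lift_snd, comp_add, lift_fst_assoc, lift_snd_assoc]
        rw [_root_.add_comm])
    (by
      intro T f g h
      ext
      · simp only [Category.assoc, lift_fst, comp_add, lift_fst_assoc, lift_snd_assoc]
        rw [_root_.add_assoc]
      · simp only [Category.assoc, lift_snd, comp_add, lift_fst_assoc, lift_snd_assoc]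
        rw [_root_.add_assoc])

variable (C) in
/-- The commutative monoid structure on the terminal object. -/
def unit : CMon C :=
  ofLaws (𝟙_ C) (toUnit _) (𝟙 _) (fun _ _ => toUnit_unique _ _) (fun _ _ _ => toUnit_unique _ _)
    (fun _ _ _ _ => toUnit_unique _ _)

theorem isAdditive_id (A : CMon C) : IsAdditive (A := A) (B := A) (𝟙 A.X) :=
  ⟨by simp, by simp⟩

/-- The first projection of the product monoid. -/
def prodFst (A B : CMon C) : (A.prod B).X ⟶ A.X := fst A.X B.X

/-- The second projection of the product monoid. -/
def prodSnd (A B : CMon C) : (A.prod B).X ⟶ B.X := snd A.X B.X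

/-- The pairing `⟨f, g⟩`, as a generalized element of the product monoid. -/
def pair {T : C} {A B : CMon C} (f : T ⟶ A.X) (g : T ⟶ B.X) : T ⟶ (A.prod B).X := lift f g

theorem pair_fst {T : C} {A B : CMon C} (f : T ⟶ A.X) (g : T ⟶ B.X) :
    pair f g ≫ prodFst A B = f := lift_fst f g

theorem pair_snd {T : C} {A B : CMon C} (f : T ⟶ A.X) (g : T ⟶ B.X) :
    pair f g ≫ prodSnd A B = g := lift_snd f g

theorem prod_hom_ext {T : C} {A B : CMon C} {f g : T ⟶ (A.prod B).X}
    (h : f ≫ prodFst A B = g ≫ prodFst A B) (h' : f ≫ prodSnd A B = g ≫ prodSnd A B) : f = g :=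
  CartesianMonoidalCategory.hom_ext _ _ h h'

theorem comp_pair {S T : C} {A B : CMon C} (t : S ⟶ T) (f : T ⟶ A.X) (g : T ⟶ B.X) :
    t ≫ pair f g = pair (t ≫ f) (t ≫ g) := comp_lift _ _ _

theorem isAdditive_fst (A B : CMon C) : IsAdditive (prodFst A B) := by
  refine ⟨fun {T} f g => ?_, fun T => ?_⟩
  · have : ∀ f g : T ⟶ A.X ⊗ B.X, (lift f g ≫ lift
      (fst (A.X ⊗ B.X) (A.X ⊗ B.X) ≫ fst A.X B.X + snd (A.X ⊗ B.X) (A.X ⊗ B.X) ≫ fst A.X B.X)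
      (fst (A.X ⊗ B.X) (A.X ⊗ B.X) ≫ snd A.X B.X + snd (A.X ⊗ B.X) (A.X ⊗ B.X) ≫ snd A.X B.X))
        ≫ fst A.X B.X = f ≫ fst A.X B.X + g ≫ fst A.X B.X := by
      intro f g
      simp only [Category.assoc, lift_fst, comp_add, lift_fst_assoc, lift_snd_assoc]
    exact this f g
  · exact (Category.assoc (toUnit T) (lift A.zero B.zero) (fst _ _)).trans
      (congrArg (toUnit T ≫ ·) (lift_fst A.zero B.zero))

theorem isAdditive_snd (A B : CMon C) : IsAdditive (prodSnd A B) := by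
  refine ⟨fun {T} f g => ?_, fun T => ?_⟩
  · have : ∀ f g : T ⟶ A.X ⊗ B.X, (lift f g ≫ lift
      (fst (A.X ⊗ B.X) (A.X ⊗ B.X) ≫ fst A.X B.X + snd (A.X ⊗ B.X) (A.X ⊗ B.X) ≫ fst A.X B.X)
      (fst (A.X ⊗ B.X) (A.X ⊗ B.X) ≫ snd A.X B.X + snd (A.X ⊗ B.X) (A.X ⊗ B.X) ≫ snd A.X B.X))
        ≫ snd A.X B.X = f ≫ snd A.X B.X + g ≫ snd A.X B.X := by
      intro f g
      simp only [Category.assoc, lift_snd, comp_add, lift_fst_assoc, lift_snd_assoc]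
    exact this f g
  · exact (Category.assoc (toUnit T) (lift A.zero B.zero) (snd _ _)).trans
      (congrArg (toUnit T ≫ ·) (lift_snd A.zero B.zero))

theorem pair_add {T : C} {A B : CMon C} (f f' : T ⟶ A.X) (g g' : T ⟶ B.X) :
    pair (f + f') (g + g') = pair f g + pair f' g' := by
  apply prod_hom_ext
  · rw [(isAdditive_fst A B).map_add, pair_fst, pair_fst, pair_fst]
  · rw [(isAdditive_snd A B).map_add, pair_snd, pair_snd, pair_snd]

theorem pair_zero {T : C} {A B : CMon C} : pair (0 : T ⟶ A.X) (0 : T ⟶ B.X) = 0 := by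
  apply prod_hom_ext
  · rw [(isAdditive_fst A B).map_zero, pair_fst]
  · rw [(isAdditive_snd A B).map_zero, pair_snd]

/-- The addition of `A`, as a map out of the product monoid. -/
def addMap (A : CMon C) : (A.prod A).X ⟶ A.X := A.add

/-- The zero of `A`, as a map out of the terminal monoid. -/
def zeroMap (A : CMon C) : (unit C).X ⟶ A.X := A.zero

theorem comp_addMap {A : CMon C} {T : C} (h : T ⟶ (A.prod A).X) :
    h ≫ A.addMap = h ≫ prodFst A A + h ≫ prodSnd A A := by
  have : ∀ h : T ⟶ A.X ⊗ A.X, h ≫ A.add = h ≫ fst _ _ + h ≫ snd _ _ := by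
    intro h
    rw [add_def, ← comp_lift, lift_fst_snd, Category.comp_id]
  exact this h

theorem comp_zeroMap {A : CMon C} {T : C} (h : T ⟶ (unit C).X) : h ≫ A.zeroMap = 0 :=
  congrArg (· ≫ A.zero) (toUnit_unique h (toUnit T))

/-- Addition is additive: a consequence of commutativity. -/
theorem isAdditive_add (A : CMon C) : IsAdditive A.addMap := by
  refine ⟨fun {T} f g => ?_, fun T => ?_⟩
  · rw [comp_addMap, comp_addMap, comp_addMap, (isAdditive_fst A A).map_add,
      (isAdditive_snd A A).map_add]
    exact add_add_add_comm _ _ _ _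
  · rw [comp_addMap, (isAdditive_fst A A).map_zero, (isAdditive_snd A A).map_zero,
      _root_.add_zero]

theorem isAdditive_zero (A : CMon C) : IsAdditive A.zeroMap := by
  refine ⟨fun {T} f g => ?_, fun T => ?_⟩
  · rw [comp_zeroMap, comp_zeroMap, comp_zeroMap, _root_.add_zero]
  · exact comp_zeroMap _

end CMon

/-- The product `A × (A × ⋯ × (A × X))` with `n` factors `A`. -/
def powObj (A : C) : ℕ → C → C
  | 0, X => X
  | n + 1, X => A ⊗ powObj A n X

/-- The projection `π_i` onto the `i`-th factor `A`. -/
def powProj (A X : C) : (n : ℕ) → Fin n → (powObj A n X ⟶ A)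
  | 0 => Fin.elim0
  | n + 1 => Fin.cases (fst A (powObj A n X)) fun i => snd A (powObj A n X) ≫ powProj A X n i

/-- The projection `π_n` onto the last factor `X`. -/
def powBase (A X : C) : (n : ℕ) → (powObj A n X ⟶ X)
  | 0 => 𝟙 X
  | n + 1 => snd A (powObj A n X) ≫ powBase A X n

/-- The tupling `⟨a_0, …, a_{n-1}, x⟩`. -/
def powLift {T A X : C} : (n : ℕ) → (Fin n → (T ⟶ A)) → (T ⟶ X) → (T ⟶ powObj A n X)
  | 0, _, x => x
  | n + 1, a, x => lift (a 0) (powLift n (fun i => a i.succ) x)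

@[simp] theorem powLift_proj {T A X : C} (n : ℕ) (a : Fin n → (T ⟶ A)) (x : T ⟶ X) (i : Fin n) :
    powLift n a x ≫ powProj A X n i = a i := by
  induction n with
  | zero => exact i.elim0
  | succ n ih =>
    refine Fin.cases ?_ (fun j => ?_) i
    · exact lift_fst _ _
    · change lift _ _ ≫ snd _ _ ≫ _ = _
      rw [lift_snd_assoc, ih]

@[simp] theorem powLift_base {T A X : C} (n : ℕ) (a : Fin n → (T ⟶ A)) (x : T ⟶ X) :
    powLift n a x ≫ powBase A X n = x := by
  induction n with
  | zero => exact Category.comp_id _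
  | succ n ih =>
    change lift _ _ ≫ snd _ _ ≫ _ = _
    rw [lift_snd_assoc, ih]

theorem powObj_hom_ext {T A X : C} (n : ℕ) {f g : T ⟶ powObj A n X}
    (h : ∀ i, f ≫ powProj A X n i = g ≫ powProj A X n i)
    (h' : f ≫ powBase A X n = g ≫ powBase A X n) : f = g := by
  induction n with
  | zero =>
    exact (Category.comp_id (X := T) (Y := X) f).symm.trans
      (h'.trans (Category.comp_id (X := T) (Y := X) g))
  | succ n ih =>
    apply CartesianMonoidalCategory.hom_ext
    · exact h 0
    · apply ih
      · intro i
        exact (Category.assoc _ _ _).trans ((h i.succ).trans (Category.assoc _ _ _).symm)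
      · exact (Category.assoc _ _ _).trans (h'.trans (Category.assoc _ _ _).symm)

theorem comp_powLift {S T A X : C} (n : ℕ) (t : S ⟶ T) (a : Fin n → (T ⟶ A)) (x : T ⟶ X) :
    t ≫ powLift n a x = powLift n (fun i => t ≫ a i) (t ≫ x) := by
  apply powObj_hom_ext <;> simp

theorem powLift_self {T A X : C} (n : ℕ) (t : T ⟶ powObj A n X) :
    powLift n (fun i => t ≫ powProj A X n i) (t ≫ powBase A X n) = t := by
  apply powObj_hom_ext <;> simp

variable (C) in
/-- An object `((A, +, 0), X)`: a commutative monoid together with an object. -/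
structure FaaObj where
  vec : CMon C
  pt : C

/-- Evaluation of a family of maps `d n : A^{n+1} × X ⟶ B` on a list of generalized elements of
`A` and a generalized element of `X`. A map is attached to nonempty lists only; the value at the
empty list is never relevant and is set to `0`. -/
def evalList {A X : C} {B : CMon C} (d : ∀ n, powObj A (n + 1) X ⟶ B.X) {T : C} (x : T ⟶ X) :
    List (T ⟶ A) → (T ⟶ B.X)
  | [] => 0
  | a :: l => powLift (l.length + 1) (a :: l).get x ≫ d l.length

/-- A morphism `(f_*, f_1, f_2, …) : ((A, +, 0), X) ⟶ ((B, +, 0), Y)`. The map `der n` is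
`f_{n+1} : A^{n+1} × X ⟶ B`; it is additive and symmetric in its first `n + 1` variables. -/
structure FaaHom (P Q : FaaObj C) where
  star : P.pt ⟶ Q.pt
  der : ∀ n : ℕ, powObj P.vec.X (n + 1) P.pt ⟶ Q.vec.X
  symm : ∀ (n : ℕ) {T : C} (a : Fin (n + 1) → (T ⟶ P.vec.X)) (x : T ⟶ P.pt)
    (σ : Equiv.Perm (Fin (n + 1))),
    powLift (n + 1) (a ∘ σ) x ≫ der n = powLift (n + 1) a x ≫ der n
  add : ∀ (n : ℕ) {T : C} (a : Fin (n + 1) → (T ⟶ P.vec.X)) (x : T ⟶ P.pt)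
    (i : Fin (n + 1)) (b c : T ⟶ P.vec.X),
    powLift (n + 1) (Function.update a i (b + c)) x ≫ der n
      = powLift (n + 1) (Function.update a i b) x ≫ der n
        + powLift (n + 1) (Function.update a i c) x ≫ der n
  zero : ∀ (n : ℕ) {T : C} (a : Fin (n + 1) → (T ⟶ P.vec.X)) (x : T ⟶ P.pt)
    (i : Fin (n + 1)),
    powLift (n + 1) (Function.update a i 0) x ≫ der n = 0

namespace FaaHom

variable {P Q R S : FaaObj C}

theorem evalList_perm (f : FaaHom P Q) {T : C} (x : T ⟶ P.pt) {l l' : List (T ⟶ P.vec.X)}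
    (h : l.Perm l') : evalList f.der x l = evalList f.der x l' := by
  match l, l', h with
  | [], [], _ => rfl
  | [], b :: l', h => exact absurd h (by simp)
  | a :: l, [], h => exact absurd h (by simp)
  | a :: l, b :: l', h =>
    obtain ⟨e, he⟩ := exists_equiv_of_perm h
    have key : ∀ (n : ℕ) (hn : n = l.length) (a' : Fin (n + 1) → (T ⟶ P.vec.X))
        (e : Fin (l.length + 1) ≃ Fin (n + 1)) (_ : ∀ i, a' (e i) = (a :: l).get i),
        powLift (l.length + 1) (a :: l).get x ≫ f.der l.length
          = powLift (n + 1) a' x ≫ f.der n := by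
      intro n hn a' e he
      subst hn
      rw [← f.symm _ a' x e]
      congr 2
      funext i
      exact (he i).symm
    exact key l'.length (by simpa using h.length_eq.symm) (b :: l').get e he

/-- The value of `f_n` on the multiset `m` of `n ≥ 1` generalized elements of `A`, at the
generalized element `x` of `X`; it is well defined because `f_n` is symmetric. -/
def eval (f : FaaHom P Q) {T : C} (x : T ⟶ P.pt) (m : Multiset (T ⟶ P.vec.X)) : T ⟶ Q.vec.X :=
  Quotient.liftOn m (evalList f.der x) fun _ _ h => f.evalList_perm x h

theorem eval_nil (f : FaaHom P Q) {T : C} (x : T ⟶ P.pt) : f.eval x 0 = 0 := rfl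

theorem eval_ofFn (f : FaaHom P Q) {T : C} (x : T ⟶ P.pt) (n : ℕ)
    (a : Fin (n + 1) → (T ⟶ P.vec.X)) :
    f.eval x (Finset.univ.val.map a) = powLift (n + 1) a x ≫ f.der n := by
  rw [Fin.univ_val_map]
  change evalList f.der x (List.ofFn a) = _
  rw [List.ofFn_succ]
  have key : ∀ (k : ℕ) (hk : k = n) (a' : Fin (k + 1) → (T ⟶ P.vec.X))
      (_ : ∀ i, a' i = a (i.cast (by rw [hk]))),
      powLift (k + 1) a' x ≫ f.der k = powLift (n + 1) a x ≫ f.der n := by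
    intro k hk a' h
    subst hk
    congr 2
    funext i
    exact h i
  refine key _ (by simp) _ fun i => ?_
  rw [List.get_eq_getElem]
  simp only [← List.ofFn_succ]
  rw [List.getElem_ofFn]
  rfl

theorem der_eq (f : FaaHom P Q) (n : ℕ) :
    f.der n = f.eval (powBase P.vec.X P.pt (n + 1))
      (Finset.univ.val.map (powProj P.vec.X P.pt (n + 1))) := by
  rw [eval_ofFn]
  have := powLift_self (n + 1) (𝟙 (powObj P.vec.X (n + 1) P.pt))
  simp only [Category.id_comp] at this
  rw [this, Category.id_comp]

theorem ext_eval {f g : FaaHom P Q} (h : f.star = g.star)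
    (h' : ∀ (T : C) (x : T ⟶ P.pt) (m : Multiset (T ⟶ P.vec.X)), f.eval x m = g.eval x m) :
    f = g := by
  have : f.der = g.der := by
    funext n
    rw [der_eq, der_eq, h']
  cases f
  cases g
  congr

theorem exists_fn_of_multiset {A : Type*} (m : Multiset A) :
    m = 0 ∨ ∃ (n : ℕ) (a : Fin (n + 1) → A), m = Finset.univ.val.map a := by
  induction m using Quotient.inductionOn with
  | h l =>
    match l with
    | [] => exact Or.inl rfl
    | a :: l =>
      refine Or.inr ⟨l.length, (a :: l).get, ?_⟩
      rw [Fin.univ_val_map]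
      rw [List.ofFn_get]
      rfl

theorem comp_eval (f : FaaHom P Q) {T T' : C} (t : T' ⟶ T) (x : T ⟶ P.pt)
    (m : Multiset (T ⟶ P.vec.X)) : t ≫ f.eval x m = f.eval (t ≫ x) (m.map (t ≫ ·)) := by
  rcases exists_fn_of_multiset m with rfl | ⟨n, a, rfl⟩
  · exact CMon.comp_zero t
  · rw [Multiset.map_map, eval_ofFn, eval_ofFn, ← Category.assoc, comp_powLift]
    rfl

theorem eval_add (f : FaaHom P Q) {T : C} (x : T ⟶ P.pt) (a b : T ⟶ P.vec.X)
    (m : Multiset (T ⟶ P.vec.X)) :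
    f.eval x ((a + b) ::ₘ m) = f.eval x (a ::ₘ m) + f.eval x (b ::ₘ m) := by
  induction m using Quotient.inductionOn with
  | h l =>
    have key : ∀ z, f.eval x (z ::ₘ (l : Multiset (T ⟶ P.vec.X)))
        = powLift (l.length + 1) (Function.update (0 :: l).get 0 z) x ≫ f.der l.length := by
      intro z
      change powLift (l.length + 1) (z :: l).get x ≫ f.der l.length = _
      congr 2
      funext i
      refine Fin.cases ?_ (fun j => ?_) i <;> simp
    exact (key _).trans ((f.add _ _ x 0 a b).trans (congrArg₂ _ (key _).symm (key _).symm))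

theorem eval_zero (f : FaaHom P Q) {T : C} (x : T ⟶ P.pt) (m : Multiset (T ⟶ P.vec.X)) :
    f.eval x (0 ::ₘ m) = 0 := by
  induction m using Quotient.inductionOn with
  | h l =>
    have key : ∀ z, f.eval x (z ::ₘ (l : Multiset (T ⟶ P.vec.X)))
        = powLift (l.length + 1) (Function.update (0 :: l).get 0 z) x ≫ f.der l.length := by
      intro z
      change powLift (l.length + 1) (z :: l).get x ≫ f.der l.length = _
      congr 2
      funext i
      refine Fin.cases ?_ (fun j => ?_) i <;> simp
    exact (key _).trans (f.zero _ _ x 0)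

/-- A morphism `(h, π_0 k, 0, 0, …)` with `k` additive. -/
def lin (h : P.pt ⟶ Q.pt) (k : P.vec.X ⟶ Q.vec.X)
    (hk : CMon.IsAdditive (A := P.vec) (B := Q.vec) k) : FaaHom P Q where
  star := h
  der n := match n with
    | 0 => powProj P.vec.X P.pt 1 0 ≫ k
    | _ + 1 => 0
  symm n T a x σ := by
    match n with
    | 0 => rw [show σ = Equiv.refl (Fin 1) from Subsingleton.elim (α := Equiv.Perm (Fin 1)) _ _]; rfl
    | n + 1 => rw [CMon.comp_zero, CMon.comp_zero]
  add n T a x i b c := by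
    match n with
    | 0 =>
      rw [show i = 0 from Subsingleton.elim (α := Fin 1) _ _]
      have : ∀ z, powLift (0 + 1) (Function.update a 0 z) x ≫ powProj P.vec.X P.pt 1 0 ≫ k
          = z ≫ k := by
        intro z
        rw [← Category.assoc, powLift_proj, Function.update_self]
      exact (this _).trans ((hk.map_add b c).trans (congrArg₂ _ (this _).symm (this _).symm))
    | n + 1 => simp only [CMon.comp_zero, _root_.add_zero]
  zero n T a x i := by
    match n with
    | 0 =>
      rw [show i = 0 from Subsingleton.elim (α := Fin 1) _ _]
      have : ∀ z, powLift (0 + 1) (Function.update a 0 z) x ≫ powProj P.vec.X P.pt 1 0 ≫ k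
          = z ≫ k := by
        intro z
        rw [← Category.assoc, powLift_proj, Function.update_self]
      exact (this _).trans (hk.map_zero T)
    | n + 1 => simp only [CMon.comp_zero]

@[simp] theorem lin_star (h : P.pt ⟶ Q.pt) (k : P.vec.X ⟶ Q.vec.X) (hk) :
    (lin h k hk).star = h := rfl

theorem lin_eval_singleton (h : P.pt ⟶ Q.pt) (k : P.vec.X ⟶ Q.vec.X) (hk)
    {T : C} (x : T ⟶ P.pt) (a : T ⟶ P.vec.X) : (lin h k hk).eval x {a} = a ≫ k := by
  change powLift 1 _ x ≫ powProj P.vec.X P.pt 1 0 ≫ k = _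
  rw [← Category.assoc, powLift_proj]
  rfl

theorem lin_eval_of_card (h : P.pt ⟶ Q.pt) (k : P.vec.X ⟶ Q.vec.X) (hk)
    {T : C} (x : T ⟶ P.pt) (m : Multiset (T ⟶ P.vec.X)) (hm : Multiset.card m ≠ 1) :
    (lin h k hk).eval x m = 0 := by
  rcases exists_fn_of_multiset m with rfl | ⟨n, a, rfl⟩
  · rfl
  · match n with
    | 0 => simp at hm
    | n + 1 =>
      rw [eval_ofFn]
      exact CMon.comp_zero _

/-- The identity `(1, π_0, 0, 0, …)`. -/
def id (P : FaaObj C) : FaaHom P P := lin (𝟙 _) (𝟙 _) (CMon.isAdditive_id _)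

theorem comp_partSum (f : FaaHom P Q) (g : FaaHom Q R) {T T' : C} (t : T' ⟶ T) (x : T ⟶ P.pt)
    (y : T ⟶ Q.pt) {ι : Type*} [DecidableEq ι] (s : Finset ι) (a : ι → (T ⟶ P.vec.X)) :
    t ≫ partSum (g.eval y) (f.eval x) s a
      = partSum (g.eval (t ≫ y)) (f.eval (t ≫ x)) s fun i => t ≫ a i := by
  unfold partSum
  rw [CMon.comp_sum]
  refine Finset.sum_congr rfl fun π _ => ?_
  rw [comp_eval, Multiset.map_map]
  congr 1
  refine Multiset.map_congr rfl fun b _ => ?_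
  rw [Function.comp_apply, comp_eval, Multiset.map_map]
  rfl

theorem powLift_partSum (f : FaaHom P Q) (g : FaaHom Q R) {T : C} (n : ℕ)
    (a : Fin n → (T ⟶ P.vec.X)) (x : T ⟶ P.pt) :
    powLift n a x ≫ partSum (g.eval (powBase P.vec.X P.pt n ≫ f.star))
        (f.eval (powBase P.vec.X P.pt n)) Finset.univ (powProj P.vec.X P.pt n)
      = partSum (g.eval (x ≫ f.star)) (f.eval x) Finset.univ a := by
  rw [comp_partSum, ← Category.assoc, powLift_base]
  simp only [powLift_proj]

/-- The composite of `f` and `g`, given by Faà di Bruno's formula: `(f g)_* = f_* g_*`, and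
`(f g)_n` is the sum over all partitions `{B_1, …, B_k}` of the `n` variables of
`⟨f_{|B_1|}(a|B_1, x), …, f_{|B_k|}(a|B_k, x), f_*(x)⟩ g_k`. -/
def comp (f : FaaHom P Q) (g : FaaHom Q R) : FaaHom P R where
  star := f.star ≫ g.star
  der n := partSum (g.eval (powBase P.vec.X P.pt (n + 1) ≫ f.star))
    (f.eval (powBase P.vec.X P.pt (n + 1))) Finset.univ (powProj P.vec.X P.pt (n + 1))
  symm n T a x σ := by
    rw [powLift_partSum, powLift_partSum]
    have := partSum_map (g.eval (x ≫ f.star)) (f.eval x) σ.toEmbedding Finset.univ a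
    rw [Finset.map_univ_equiv] at this
    exact this.symm
  add n T a x i b c := by
    rw [powLift_partSum, powLift_partSum, powLift_partSum]
    exact partSum_update_add _ _ (g.eval_add _) (f.eval_add _) (Finset.mem_univ i) a b c
  zero n T a x i := by
    rw [powLift_partSum]
    exact partSum_update_zero _ _ (g.eval_zero _) (f.eval_zero _) (Finset.mem_univ i) a

theorem eval_comp (f : FaaHom P Q) (g : FaaHom Q R) {T : C} (x : T ⟶ P.pt)
    (m : Multiset (T ⟶ P.vec.X)) :
    (comp f g).eval x m = partComp (g.eval (x ≫ f.star)) (f.eval x) m := by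
  rcases exists_fn_of_multiset m with rfl | ⟨n, a, rfl⟩
  · change 0 = partSum (g.eval (x ≫ f.star)) (f.eval x) Finset.univ List.nil.get
    symm
    refine Finset.sum_eq_zero fun π _ => ?_
    have : π.parts = ∅ := π.parts_eq_empty_iff.2 rfl
    rw [this]
    rfl
  · rw [eval_ofFn, partComp_eq]
    exact powLift_partSum f g _ _ _

theorem eval_comp_lin (f : FaaHom P Q) (h : Q.pt ⟶ R.pt) (k : Q.vec.X ⟶ R.vec.X) (hk)
    {T : C} (x : T ⟶ P.pt) (m : Multiset (T ⟶ P.vec.X)) :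
    (comp f (lin h k hk)).eval x m = f.eval x m ≫ k := by
  rw [eval_comp]
  exact partComp_linear_left _ _ (· ≫ k) (lin_eval_of_card h k hk _)
    (lin_eval_singleton h k hk _) (by rw [eval_nil]; exact hk.map_zero _) m

theorem eval_lin_comp (h : P.pt ⟶ Q.pt) (k : P.vec.X ⟶ Q.vec.X) (hk) (g : FaaHom Q R)
    {T : C} (x : T ⟶ P.pt) (m : Multiset (T ⟶ P.vec.X)) :
    (comp (lin h k hk) g).eval x m = g.eval (x ≫ h) (m.map (· ≫ k)) := by
  rw [eval_comp]
  exact partComp_linear_right _ _ (· ≫ k) (g.eval_zero _) (lin_eval_of_card h k hk _)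
    (lin_eval_singleton h k hk _) m

end FaaHom

/-- The category `Faà(C)`. -/
instance : Category.{v} (FaaObj C) where
  Hom := FaaHom
  id := FaaHom.id
  comp := FaaHom.comp
  id_comp {P Q} f := by
    refine FaaHom.ext_eval (Category.id_comp _) fun T x m => ?_
    refine (FaaHom.eval_lin_comp _ _ _ f x m).trans ?_
    simp
  comp_id {P Q} f := by
    refine FaaHom.ext_eval (Category.comp_id _) fun T x m => ?_
    refine (FaaHom.eval_comp_lin f _ _ _ x m).trans ?_
    simp
  assoc {P Q R S} f g h := by
    refine FaaHom.ext_eval (Category.assoc _ _ _) fun T x m => ?_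
    rw [FaaHom.eval_comp, FaaHom.eval_comp]
    have h1 : (FaaHom.comp f g).eval x = partComp (g.eval (x ≫ f.star)) (f.eval x) :=
      funext (FaaHom.eval_comp f g x)
    have h2 : (FaaHom.comp g h).eval (x ≫ f.star)
        = partComp (h.eval ((x ≫ f.star) ≫ g.star)) (g.eval (x ≫ f.star)) :=
      funext (FaaHom.eval_comp g h _)
    rw [h1, h2, Category.assoc]
    exact partComp_assoc _ _ _ (h.eval_add _) (h.eval_zero _) m

namespace FaaObj

variable {P Q R : FaaObj C}

theorem hom_ext {f g : P ⟶ Q} (h : FaaHom.star f = FaaHom.star g)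
    (h' : ∀ (T : C) (x : T ⟶ P.pt) (m : Multiset (T ⟶ P.vec.X)),
      FaaHom.eval f x m = FaaHom.eval g x m) : f = g :=
  FaaHom.ext_eval h h'

/-- A morphism `(h, π_0 k, 0, 0, …)` of `Faà(C)`, with `k` additive. -/
def lin (h : P.pt ⟶ Q.pt) (k : P.vec.X ⟶ Q.vec.X)
    (hk : CMon.IsAdditive (A := P.vec) (B := Q.vec) k) : P ⟶ Q := FaaHom.lin h k hk

theorem comp_star (f : P ⟶ Q) (g : Q ⟶ R) :
    FaaHom.star (f ≫ g) = FaaHom.star f ≫ FaaHom.star g := rfl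

theorem eval_comp_lin (f : P ⟶ Q) (h : Q.pt ⟶ R.pt) (k : Q.vec.X ⟶ R.vec.X) (hk)
    {T : C} (x : T ⟶ P.pt) (m : Multiset (T ⟶ P.vec.X)) :
    FaaHom.eval (f ≫ lin h k hk) x m = FaaHom.eval f x m ≫ k :=
  FaaHom.eval_comp_lin f h k hk x m

theorem eval_lin_comp (h : P.pt ⟶ Q.pt) (k : P.vec.X ⟶ Q.vec.X) (hk) (g : Q ⟶ R)
    {T : C} (x : T ⟶ P.pt) (m : Multiset (T ⟶ P.vec.X)) :
    FaaHom.eval (lin h k hk ≫ g) x m = FaaHom.eval g (x ≫ h) (m.map (· ≫ k)) :=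
  FaaHom.eval_lin_comp h k hk g x m

/-- The product `((A × B, ex (+ × +), 0 × 0), X × Y)`. -/
@[reducible] def prod (P Q : FaaObj C) : FaaObj C := ⟨P.vec.prod Q.vec, P.pt ⊗ Q.pt⟩

variable (C) in
/-- The terminal object `((1, !, !), 1)`. -/
@[reducible] def unit : FaaObj C := ⟨CMon.unit C, 𝟙_ C⟩

/-- The projection `(π_X, π_0 π_A, 0, 0, …)`. -/
def prodFst (P Q : FaaObj C) : P.prod Q ⟶ P :=
  lin (fst P.pt Q.pt) (CMon.prodFst P.vec Q.vec) (CMon.isAdditive_fst _ _)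

/-- The projection `(π_Y, π_0 π_B, 0, 0, …)`. -/
def prodSnd (P Q : FaaObj C) : P.prod Q ⟶ Q :=
  lin (snd P.pt Q.pt) (CMon.prodSnd P.vec Q.vec) (CMon.isAdditive_snd _ _)

/-- The pairing of two morphisms, computed componentwise. -/
def prodLift (f : P ⟶ Q) (g : P ⟶ R) : P ⟶ Q.prod R :=
  { star := lift (FaaHom.star f) (FaaHom.star g)
    der := fun n => CMon.pair (FaaHom.der f n) (FaaHom.der g n)
    symm := by
      intro n T a x σ
      rw [CMon.comp_pair, CMon.comp_pair, FaaHom.symm f, FaaHom.symm g]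
    add := by
      intro n T a x i b c
      rw [CMon.comp_pair, CMon.comp_pair, CMon.comp_pair, FaaHom.add f, FaaHom.add g]
      exact CMon.pair_add _ _ _ _
    zero := by
      intro n T a x i
      rw [CMon.comp_pair, FaaHom.zero f, FaaHom.zero g]
      exact CMon.pair_zero }

theorem eval_prodLift (f : P ⟶ Q) (g : P ⟶ R) {T : C} (x : T ⟶ P.pt)
    (m : Multiset (T ⟶ P.vec.X)) :
    FaaHom.eval (prodLift f g) x m = CMon.pair (FaaHom.eval f x m) (FaaHom.eval g x m) := by
  rcases FaaHom.exists_fn_of_multiset m with rfl | ⟨n, a, rfl⟩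
  · exact CMon.pair_zero.symm
  · rw [FaaHom.eval_ofFn, FaaHom.eval_ofFn, FaaHom.eval_ofFn, ← CMon.comp_pair]
    rfl

theorem prodLift_fst (f : P ⟶ Q) (g : P ⟶ R) : prodLift f g ≫ prodFst Q R = f := by
  refine hom_ext (lift_fst (FaaHom.star f) (FaaHom.star g)) fun T x m => ?_
  refine (eval_comp_lin _ _ _ _ x m).trans ?_
  rw [eval_prodLift]
  exact lift_fst _ _

theorem prodLift_snd (f : P ⟶ Q) (g : P ⟶ R) : prodLift f g ≫ prodSnd Q R = g := by
  refine hom_ext (lift_snd (FaaHom.star f) (FaaHom.star g)) fun T x m => ?_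
  refine (eval_comp_lin _ _ _ _ x m).trans ?_
  rw [eval_prodLift]
  exact lift_snd _ _

theorem prod_hom_ext {f g : P ⟶ Q.prod R} (h : f ≫ prodFst Q R = g ≫ prodFst Q R)
    (h' : f ≫ prodSnd Q R = g ≫ prodSnd Q R) : f = g := by
  refine hom_ext ?_ fun T x m => ?_
  · apply CartesianMonoidalCategory.hom_ext
    · exact congrArg FaaHom.star h
    · exact congrArg FaaHom.star h'
  · apply CMon.prod_hom_ext
    · have := congrArg (fun k : P ⟶ Q => FaaHom.eval k x m) h
      exact (eval_comp_lin f _ _ _ x m).symm.trans (this.trans (eval_comp_lin g _ _ _ x m))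
    · have := congrArg (fun k : P ⟶ R => FaaHom.eval k x m) h'
      exact (eval_comp_lin f _ _ _ x m).symm.trans (this.trans (eval_comp_lin g _ _ _ x m))

/-- The map to the terminal object. -/
def toUnit' (P : FaaObj C) : P ⟶ unit C :=
  lin (toUnit _) (toUnit _) ⟨fun _ _ => toUnit_unique _ _, fun _ => toUnit_unique _ _⟩

theorem toUnit'_unique (f : P ⟶ unit C) : f = toUnit' P :=
  hom_ext (toUnit_unique _ _) fun _ _ _ => toUnit_unique _ _

/-- The chosen finite products of `Faà(C)`. -/
@[reducible] def cartesian : CartesianMonoidalCategory (FaaObj C) :=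
  CartesianMonoidalCategory.ofChosenFiniteProducts
    ⟨_, Limits.IsTerminal.ofUniqueHom toUnit' fun _ f => toUnit'_unique f⟩
    (fun P Q => ⟨Limits.BinaryFan.mk (prodFst P Q) (prodSnd P Q),
      Limits.BinaryFan.isLimitMk (fun s => prodLift s.fst s.snd)
        (fun _ => prodLift_fst _ _) (fun _ => prodLift_snd _ _)
        (fun _ _ h h' => prod_hom_ext (h.trans (prodLift_fst _ _).symm)
          (h'.trans (prodLift_snd _ _).symm))⟩)

instance : CartesianMonoidalCategory (FaaObj C) := cartesian

theorem lift_eq (f : P ⟶ Q) (g : P ⟶ R) : lift f g = prodLift f g := by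
  apply CartesianMonoidalCategory.hom_ext
  · rw [lift_fst]; exact (prodLift_fst f g).symm
  · rw [lift_snd]; exact (prodLift_snd f g).symm

end FaaObj
end Construction

section Functoriality

variable {C : Type*} [Category* C] [CartesianMonoidalCategory C]
variable {D : Type*} [Category* D] [CartesianMonoidalCategory D]
variable {E : Type*} [Category* E] [CartesianMonoidalCategory E]

theorem CMon.eq_of_isAdditive {A B : CMon C} (h : A.X = B.X)
    (hk : CMon.IsAdditive (A := A) (B := B) (eqToHom h)) : A = B := by
  refine CMon.ext' h ?_ ?_
  · have := hk.map_add (fst A.X A.X) (snd A.X A.X)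
    rw [CMon.add_def, CMon.add_def, lift_fst_snd, Category.id_comp] at this
    exact this
  · have := hk.map_zero (𝟙_ C)
    rw [CMon.zero_def, CMon.zero_def, toUnit_unit, Category.id_comp, Category.id_comp] at this
    exact this

variable (C D) in
/-- A functor that preserves the chosen finite products exactly. -/
@[ext] structure CartFunctor where
  functor : C ⥤ D
  obj_unit : functor.obj (𝟙_ C) = 𝟙_ D
  obj_prod : ∀ A B : C, functor.obj (A ⊗ B) = functor.obj A ⊗ functor.obj B
  map_fst : ∀ A B : C, functor.map (fst A B) = eqToHom (obj_prod A B) ≫ fst _ _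
  map_snd : ∀ A B : C, functor.map (snd A B) = eqToHom (obj_prod A B) ≫ snd _ _

namespace CartFunctor

/-- The identity functor. -/
@[simps] def id : CartFunctor C C where
  functor := 𝟭 C
  obj_unit := rfl
  obj_prod _ _ := rfl
  map_fst _ _ := by simp
  map_snd _ _ := by simp

/-- The composite of two functors. -/
@[simps] def comp (F : CartFunctor C D) (G : CartFunctor D E) : CartFunctor C E where
  functor := F.functor ⋙ G.functor
  obj_unit := by simp [F.obj_unit, G.obj_unit]
  obj_prod A B := by simp [F.obj_prod, G.obj_prod]
  map_fst A B := by simp [F.map_fst, G.map_fst, eqToHom_map]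
  map_snd A B := by simp [F.map_snd, G.map_snd, eqToHom_map]

variable (F : CartFunctor C D)

theorem cast_map_fst (A B : C) :
    eqToHom (F.obj_prod A B).symm ≫ F.functor.map (fst A B) = fst _ _ := by
  simp [F.map_fst]

theorem cast_map_snd (A B : C) :
    eqToHom (F.obj_prod A B).symm ≫ F.functor.map (snd A B) = snd _ _ := by
  simp [F.map_snd]

theorem lift_cast {T : D} {S A B : C} (t : T ⟶ F.functor.obj S) (f : S ⟶ A) (g : S ⟶ B) :
    lift (t ≫ F.functor.map f) (t ≫ F.functor.map g) ≫ eqToHom (F.obj_prod A B).symm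
      = t ≫ F.functor.map (lift f g) := by
  have : lift (t ≫ F.functor.map f) (t ≫ F.functor.map g)
      = (t ≫ F.functor.map (lift f g)) ≫ eqToHom (F.obj_prod A B) := by
    apply CartesianMonoidalCategory.hom_ext
    · rw [Category.assoc, Category.assoc, ← F.map_fst, ← F.functor.map_comp, lift_fst, lift_fst]
    · rw [Category.assoc, Category.assoc, ← F.map_snd, ← F.functor.map_comp, lift_snd, lift_snd]
  rw [this]
  simp

/-- The addition `F +` on `F A`. -/
def mapAdd (A : CMon C) :
    F.functor.obj A.X ⊗ F.functor.obj A.X ⟶ F.functor.obj A.X :=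
  eqToHom (F.obj_prod A.X A.X).symm ≫ F.functor.map A.add

/-- The zero `F 0` of `F A`. -/
def mapZero (A : CMon C) : 𝟙_ D ⟶ F.functor.obj A.X :=
  eqToHom F.obj_unit.symm ≫ F.functor.map A.zero

theorem lift_mapAdd (A : CMon C) {T : D} {S : C} (t : T ⟶ F.functor.obj S) (f g : S ⟶ A.X) :
    lift (t ≫ F.functor.map f) (t ≫ F.functor.map g) ≫ F.mapAdd A
      = t ≫ F.functor.map (f + g) := by
  rw [mapAdd, ← Category.assoc, lift_cast, Category.assoc, ← F.functor.map_comp]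
  rfl

theorem toUnit_mapZero (A : CMon C) {T : D} {S : C} (t : T ⟶ F.functor.obj S) :
    toUnit T ≫ F.mapZero A = t ≫ F.functor.map (0 : S ⟶ A.X) := by
  rw [mapZero, CMon.zero_def, F.functor.map_comp, ← Category.assoc, ← Category.assoc]
  congr 1
  have : ∀ f g : T ⟶ F.functor.obj (𝟙_ C), f = g := by
    rw [F.obj_unit]
    exact fun f g => toUnit_unique f g
  exact this _ _

/-- The commutative monoid `(F A, F +, F 0)`. -/
def mapCMon (A : CMon C) : CMon D :=
  CMon.ofLaws (F.functor.obj A.X) (F.mapAdd A) (F.mapZero A)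
    (by
      intro T f
      have h0 := F.toUnit_mapZero A f (S := A.X)
      have h1 : f = f ≫ F.functor.map (𝟙 A.X) := by simp
      have h2 := F.lift_mapAdd A f 0 (𝟙 A.X)
      rw [← h0, ← h1, zero_add, ← h1] at h2
      exact h2)
    (by
      intro T f g
      have h := F.lift_mapAdd A (lift f g ≫ eqToHom (F.obj_prod A.X A.X).symm)
        (fst _ _) (snd _ _)
      have h' := F.lift_mapAdd A (lift f g ≫ eqToHom (F.obj_prod A.X A.X).symm)
        (snd _ _) (fst _ _)
      rw [add_comm, ← h] at h'
      simp only [Category.assoc, cast_map_fst, cast_map_snd, lift_fst, lift_snd] at h'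
      exact h'.symm)
    (by
      intro T f g h
      let s : T ⟶ F.functor.obj (A.X ⊗ A.X) := lift g h ≫ eqToHom (F.obj_prod A.X A.X).symm
      let t : T ⟶ F.functor.obj (A.X ⊗ (A.X ⊗ A.X)) :=
        lift f s ≫ eqToHom (F.obj_prod A.X (A.X ⊗ A.X)).symm
      have ht : t ≫ F.functor.map (snd _ _) = s := by
        rw [Category.assoc, cast_map_snd, lift_snd]
      have e1 : t ≫ F.functor.map (fst _ _) = f := by
        rw [Category.assoc, cast_map_fst, lift_fst]
      have e2 : t ≫ F.functor.map (snd _ _ ≫ fst _ _) = g := by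
        rw [F.functor.map_comp, ← Category.assoc, ht, Category.assoc, cast_map_fst, lift_fst]
      have e3 : t ≫ F.functor.map (snd _ _ ≫ snd _ _) = h := by
        rw [F.functor.map_comp, ← Category.assoc, ht, Category.assoc, cast_map_snd, lift_snd]
      rw [← e1, ← e2, ← e3]
      simp only [lift_mapAdd]
      rw [add_assoc])

/-- The generalized element `t ≫ F f` of `F A`. -/
def elt {A : CMon C} {T : D} {S : C} (t : T ⟶ F.functor.obj S) (f : S ⟶ A.X) :
    T ⟶ (F.mapCMon A).X := t ≫ F.functor.map f

theorem elt_add {A : CMon C} {T : D} {S : C} (t : T ⟶ F.functor.obj S) (f g : S ⟶ A.X) :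
    F.elt t (f + g) = F.elt t f + F.elt t g :=
  (F.lift_mapAdd A t f g).symm

theorem elt_zero {A : CMon C} {T : D} {S : C} (t : T ⟶ F.functor.obj S) :
    F.elt t (0 : S ⟶ A.X) = 0 :=
  (F.toUnit_mapZero A t).symm

theorem elt_sum {A : CMon C} {T : D} {S : C} (t : T ⟶ F.functor.obj S)
    {ι : Type*} (s : Finset ι) (f : ι → (S ⟶ A.X)) :
    F.elt t (∑ i ∈ s, f i) = ∑ i ∈ s, F.elt t (f i) := by
  classical
  induction s using Finset.induction_on with
  | empty => exact F.elt_zero t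
  | insert i s hi ih => rw [Finset.sum_insert hi, Finset.sum_insert hi, elt_add, ih]

/-- The image of a map between the underlying objects of two monoids. -/
def mapHom {A B : CMon C} (k : A.X ⟶ B.X) : (F.mapCMon A).X ⟶ (F.mapCMon B).X := F.functor.map k

theorem elt_comp {A B : CMon C} (k : A.X ⟶ B.X) {T : D} {S : C} (t : T ⟶ F.functor.obj S)
    (f : S ⟶ A.X) : F.elt t f ≫ F.mapHom k = F.elt t (f ≫ k) := by
  change (t ≫ F.functor.map f) ≫ F.functor.map k = t ≫ F.functor.map (f ≫ k)
  rw [Category.assoc, ← F.functor.map_comp]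

theorem exists_pair {A : CMon C} {T : D} (f g : T ⟶ (F.mapCMon A).X) :
    ∃ (S : C) (t : T ⟶ F.functor.obj S) (f' g' : S ⟶ A.X), F.elt t f' = f ∧ F.elt t g' = g := by
  have key : ∀ f g : T ⟶ F.functor.obj A.X, ∃ (S : C) (t : T ⟶ F.functor.obj S) (f' g' : S ⟶ A.X),
      t ≫ F.functor.map f' = f ∧ t ≫ F.functor.map g' = g := by
    intro f g
    refine ⟨A.X ⊗ A.X, lift f g ≫ eqToHom (F.obj_prod A.X A.X).symm, fst _ _, snd _ _, ?_, ?_⟩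
    · rw [Category.assoc, cast_map_fst, lift_fst]
    · rw [Category.assoc, cast_map_snd, lift_snd]
  exact key f g

theorem isAdditive_mapHom {A B : CMon C} {k : A.X ⟶ B.X} (hk : CMon.IsAdditive k) :
    CMon.IsAdditive (F.mapHom k) := by
  refine ⟨fun {T} f g => ?_, fun T => ?_⟩
  · obtain ⟨S, t, f', g', rfl, rfl⟩ := F.exists_pair f g
    rw [← elt_add, elt_comp, elt_comp, elt_comp, hk.map_add, elt_add]
  · have t : T ⟶ F.functor.obj (𝟙_ C) := toUnit T ≫ eqToHom F.obj_unit.symm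
    rw [← F.elt_zero t, elt_comp, hk.map_zero, elt_zero]

/-- The object `((F A, F +, F 0), F X)`. -/
@[reducible] def mapObj (P : FaaObj C) : FaaObj D := ⟨F.mapCMon P.vec, F.functor.obj P.pt⟩

theorem obj_powObj (A X : C) (n : ℕ) :
    F.functor.obj (powObj A n X) = powObj (F.functor.obj A) n (F.functor.obj X) := by
  induction n with
  | zero => rfl
  | succ n ih => exact (F.obj_prod _ _).trans (congrArg (F.functor.obj A ⊗ ·) ih)

theorem cast_fst {A W : C} {Z : D} (h : F.functor.obj W = Z)
    (h' : F.functor.obj (A ⊗ W) = F.functor.obj A ⊗ Z) :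
    eqToHom h' ≫ fst _ Z = F.functor.map (fst A W) := by
  subst h
  exact (F.map_fst A W).symm

theorem cast_snd {A W : C} {Z : D} (h : F.functor.obj W = Z)
    (h' : F.functor.obj (A ⊗ W) = F.functor.obj A ⊗ Z) :
    eqToHom h' ≫ snd _ Z = F.functor.map (snd A W) ≫ eqToHom h := by
  subst h
  rw [eqToHom_refl, Category.comp_id]
  exact (F.map_snd A W).symm

theorem cast_powProj (A X : C) (n : ℕ) (i : Fin n) :
    eqToHom (F.obj_powObj A X n) ≫ powProj _ _ n i = F.functor.map (powProj A X n i) := by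
  induction n with
  | zero => exact i.elim0
  | succ n ih =>
    refine Fin.cases ?_ (fun j => ?_) i
    · exact F.cast_fst (F.obj_powObj A X n) _
    · refine (Category.assoc _ _ _).symm.trans ?_
      refine (congrArg (· ≫ powProj _ _ n j) (F.cast_snd (F.obj_powObj A X n) _)).trans ?_
      refine (Category.assoc _ _ _).trans ?_
      rw [ih]
      exact (F.functor.map_comp _ _).symm

theorem cast_powBase (A X : C) (n : ℕ) :
    eqToHom (F.obj_powObj A X n) ≫ powBase _ _ n = F.functor.map (powBase A X n) := by
  induction n with
  | zero =>
    refine (Category.id_comp _).trans ?_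
    exact (F.functor.map_id X).symm
  | succ n ih =>
    refine (Category.assoc _ _ _).symm.trans ?_
    refine (congrArg (· ≫ powBase _ _ n) (F.cast_snd (F.obj_powObj A X n) _)).trans ?_
    refine (Category.assoc _ _ _).trans ?_
    rw [ih]
    exact (F.functor.map_comp _ _).symm

theorem powLift_cast {T : D} {S A X : C} (n : ℕ) (t : T ⟶ F.functor.obj S)
    (a : Fin n → (S ⟶ A)) (x : S ⟶ X) :
    powLift n (fun i => t ≫ F.functor.map (a i)) (t ≫ F.functor.map x)
        ≫ eqToHom (F.obj_powObj A X n).symm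
      = t ≫ F.functor.map (powLift n a x) := by
  have : powLift n (fun i => t ≫ F.functor.map (a i)) (t ≫ F.functor.map x)
      = (t ≫ F.functor.map (powLift n a x)) ≫ eqToHom (F.obj_powObj A X n) := by
    apply powObj_hom_ext
    · intro i
      rw [powLift_proj, Category.assoc, Category.assoc, cast_powProj, ← F.functor.map_comp,
        powLift_proj]
    · rw [powLift_base, Category.assoc, Category.assoc, cast_powBase, ← F.functor.map_comp,
        powLift_base]
  rw [this]
  simp

/-- Every tuple of generalized elements comes from a tuple in the image of `F`. -/
theorem exists_tuple {T : D} {A X : C} (n : ℕ) (a : Fin n → (T ⟶ F.functor.obj A))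
    (x : T ⟶ F.functor.obj X) :
    ∃ (S : C) (t : T ⟶ F.functor.obj S) (a' : Fin n → (S ⟶ A)) (x' : S ⟶ X),
      (a = fun i => t ≫ F.functor.map (a' i)) ∧ x = t ≫ F.functor.map x' := by
  refine ⟨powObj A n X, powLift n a x ≫ eqToHom (F.obj_powObj A X n).symm, powProj A X n,
    powBase A X n, ?_, ?_⟩
  · funext i
    rw [← cast_powProj]
    simp
  · rw [← cast_powBase]
    simp

variable {P Q R : FaaObj C}

/-- The component `F(f_{n+1})`, viewed as a map `(F A)^{n+1} × F X ⟶ F B`. -/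
def mapDer (f : P ⟶ Q) (n : ℕ) :
    powObj (F.functor.obj P.vec.X) (n + 1) (F.functor.obj P.pt) ⟶ F.functor.obj Q.vec.X :=
  eqToHom (F.obj_powObj P.vec.X P.pt (n + 1)).symm ≫ F.functor.map (FaaHom.der f n)

theorem powLift_mapDer (f : P ⟶ Q) (n : ℕ) {T : D} {S : C} (t : T ⟶ F.functor.obj S)
    (a : Fin (n + 1) → (S ⟶ P.vec.X)) (x : S ⟶ P.pt) :
    powLift (n + 1) (fun i => t ≫ F.functor.map (a i)) (t ≫ F.functor.map x) ≫ F.mapDer f n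
      = t ≫ F.functor.map (powLift (n + 1) a x ≫ FaaHom.der f n) := by
  rw [mapDer, ← Category.assoc, powLift_cast, Category.assoc, ← F.functor.map_comp]

/-- The morphism `(F(f_*), F(f_1), F(f_2), …)`. -/
def mapFaaHom (f : P ⟶ Q) : F.mapObj P ⟶ F.mapObj Q :=
  { star := F.functor.map (FaaHom.star f)
    der := F.mapDer f
    symm := by
      intro n T a x σ
      obtain ⟨S, t, a', x', rfl, rfl⟩ := F.exists_tuple (A := P.vec.X) (X := P.pt) (n + 1) a x
      refine (F.powLift_mapDer f n t (a' ∘ σ) x').trans ?_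
      refine Eq.trans ?_ (F.powLift_mapDer f n t a' x').symm
      rw [FaaHom.symm f]
    add := by
      intro n T a x i b c
      obtain ⟨S, t, a', x', ha, rfl⟩ := F.exists_tuple (A := P.vec.X) (X := P.pt) (n + 3)
        (Fin.cons b (Fin.cons c a)) x
      have hb : b = t ≫ F.functor.map (a' 0) := congrFun ha 0
      have hc : c = t ≫ F.functor.map (a' 1) := congrFun ha 1
      have hat : a = fun i => t ≫ F.functor.map (a' i.succ.succ) :=
        funext fun i => congrFun ha i.succ.succ
      subst hb hc hat
      have key : ∀ z : S ⟶ P.vec.X, powLift (n + 1) (Function.update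
            (fun i => t ≫ F.functor.map (a' (Fin.succ (Fin.succ i)))) i (t ≫ F.functor.map z))
            (t ≫ F.functor.map x') ≫ F.mapDer f n
          = t ≫ F.functor.map (powLift (n + 1)
              (Function.update (fun i => a' (Fin.succ (Fin.succ i))) i z) x'
            ≫ FaaHom.der f n) := by
        intro z
        rw [← powLift_mapDer]
        congr 2
        funext j
        by_cases hj : j = i
        · subst hj
          simp
        · simp [Function.update_of_ne hj]
      have h := key (a' 0 + a' 1)
      rw [FaaHom.add f] at h
      have e := F.elt_add t (a' 0) (a' 1)
      have h' := (congrArg (fun z => powLift (n + 1) (Function.update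
        (fun i => t ≫ F.functor.map (a' (Fin.succ (Fin.succ i)))) i z)
        (t ≫ F.functor.map x') ≫ F.mapDer f n) e).symm.trans h
      refine h'.trans ((F.elt_add t _ _).trans ?_)
      exact (congrArg₂ (fun (a b : T ⟶ (F.mapCMon Q.vec).X) => a + b) (key (a' 0))
        (key (a' 1))).symm
    zero := by
      intro n T a x i
      obtain ⟨S, t, a', x', rfl, rfl⟩ := F.exists_tuple (A := P.vec.X) (X := P.pt) (n + 1) a x
      have key : ∀ z : S ⟶ P.vec.X, powLift (n + 1) (Function.update
            (fun i => t ≫ F.functor.map (a' i)) i (t ≫ F.functor.map z))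
            (t ≫ F.functor.map x') ≫ F.mapDer f n
          = t ≫ F.functor.map (powLift (n + 1) (Function.update a' i z) x' ≫ FaaHom.der f n) := by
        intro z
        rw [← powLift_mapDer]
        congr 2
        funext j
        by_cases hj : j = i
        · subst hj
          simp
        · simp [Function.update_of_ne hj]
      have h := key 0
      rw [FaaHom.zero f] at h
      have e := F.elt_zero (A := P.vec) t
      have h' := (congrArg (fun z => powLift (n + 1) (Function.update
        (fun i => t ≫ F.functor.map (a' i)) i z)
        (t ≫ F.functor.map x') ≫ F.mapDer f n) e).symm.trans h
      exact h'.trans (F.elt_zero t) }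

theorem eval_map (f : P ⟶ Q) {T : D} {S : C} (t : T ⟶ F.functor.obj S) (x : S ⟶ P.pt)
    (m : Multiset (S ⟶ P.vec.X)) :
    FaaHom.eval (F.mapFaaHom f) (t ≫ F.functor.map x) (m.map (F.elt t))
      = F.elt t (FaaHom.eval f x m) := by
  rcases FaaHom.exists_fn_of_multiset m with rfl | ⟨n, a, rfl⟩
  · exact (F.elt_zero t).symm
  · rw [Multiset.map_map, FaaHom.eval_ofFn, FaaHom.eval_ofFn]
    exact F.powLift_mapDer f n t a x

theorem exists_multiset {T : D} {A : CMon C} {X : C} (x : T ⟶ F.functor.obj X)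
    (m : Multiset (T ⟶ (F.mapCMon A).X)) :
    ∃ (S : C) (t : T ⟶ F.functor.obj S) (x' : S ⟶ X) (m' : Multiset (S ⟶ A.X)),
      x = t ≫ F.functor.map x' ∧ m = m'.map (F.elt t) := by
  rcases FaaHom.exists_fn_of_multiset m with rfl | ⟨n, a, rfl⟩
  · exact ⟨X, x, 𝟙 X, 0, by simp, rfl⟩
  · obtain ⟨S, t, a', x', h, h'⟩ := F.exists_tuple (A := A.X) (X := X) (n + 1) a x
    refine ⟨S, t, x', Finset.univ.val.map a', h', ?_⟩
    rw [Multiset.map_map]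
    exact Multiset.map_congr rfl fun i _ => congrFun h i

theorem map_lin (h : P.pt ⟶ Q.pt) (k : P.vec.X ⟶ Q.vec.X) (hk) :
    F.mapFaaHom (FaaObj.lin (P := P) (Q := Q) h k hk)
      = FaaObj.lin (P := F.mapObj P) (Q := F.mapObj Q) (F.functor.map h) (F.mapHom k)
        (F.isAdditive_mapHom hk) := by
  refine FaaObj.hom_ext rfl fun T x m => ?_
  obtain ⟨S, t, x', m', rfl, rfl⟩ := F.exists_multiset (A := P.vec) (X := P.pt) x m
  refine (F.eval_map _ t x' m').trans ?_
  by_cases hm : Multiset.card m' = 1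
  · obtain ⟨a, rfl⟩ := Multiset.card_eq_one.1 hm
    refine (congrArg (F.elt t) (FaaHom.lin_eval_singleton h k hk x' a)).trans ?_
    refine Eq.trans ?_ (FaaHom.lin_eval_singleton (P := F.mapObj P) (Q := F.mapObj Q)
      (F.functor.map h) (F.mapHom k) (F.isAdditive_mapHom hk) _ (F.elt t a)).symm
    change t ≫ F.functor.map (a ≫ k) = (t ≫ F.functor.map a) ≫ F.functor.map k
    simp
  · refine (congrArg (F.elt t) (FaaHom.lin_eval_of_card h k hk x' m' hm)).trans ?_
    refine Eq.trans ?_ (FaaHom.lin_eval_of_card (P := F.mapObj P) (Q := F.mapObj Q)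
      (F.functor.map h) (F.mapHom k) (F.isAdditive_mapHom hk) _ _ ?_).symm
    · exact F.elt_zero t
    · rwa [Multiset.card_map]

theorem map_comp' (f : P ⟶ Q) (g : Q ⟶ R) :
    F.mapFaaHom (f ≫ g) = F.mapFaaHom f ≫ F.mapFaaHom g := by
  refine FaaObj.hom_ext (F.functor.map_comp _ _) fun T x m => ?_
  obtain ⟨S, t, x', m', rfl, rfl⟩ := F.exists_multiset (A := P.vec) (X := P.pt) x m
  refine (F.eval_map _ t x' m').trans ?_
  refine Eq.trans ?_ (FaaHom.eval_comp (F.mapFaaHom f) (F.mapFaaHom g) _ _).symm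
  refine (congrArg (F.elt t) (FaaHom.eval_comp f g x' m')).trans ?_
  induction m' using Quotient.inductionOn with
  | h l =>
    have hl : (Quotient.mk _ l : Multiset (S ⟶ P.vec.X))
        = (Finset.univ : Finset (Fin l.length)).val.map l.get := by
      simp only [Fin.univ_val_map, List.ofFn_get]
      rfl
    rw [hl, Multiset.map_map, partComp_eq, partComp_eq]
    refine (F.elt_sum t _ _).trans ?_
    refine Finset.sum_congr rfl fun π _ => ?_
    have hx : (t ≫ F.functor.map x') ≫ FaaHom.star (F.mapFaaHom f)
        = t ≫ F.functor.map (x' ≫ FaaHom.star f) := by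
      change (t ≫ F.functor.map x') ≫ F.functor.map (FaaHom.star f) = _
      simp
    rw [hx]
    have := F.eval_map g t (x' ≫ FaaHom.star f)
      (π.parts.val.map fun b => FaaHom.eval f x' (b.val.map l.get))
    refine this.symm.trans ?_
    rw [Multiset.map_map]
    congr 1
    refine Multiset.map_congr rfl fun b _ => ?_
    have := F.eval_map f t x' (b.val.map l.get)
    rw [Multiset.map_map] at this
    exact this.symm

end CartFunctor

theorem FaaObj.ext_vec {P Q : FaaObj C} (h : P.vec = Q.vec) (h' : P.pt = Q.pt) : P = Q := by
  cases P
  cases Q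
  cases h
  cases h'
  rfl

theorem FaaObj.lin_congr {P Q : FaaObj C} {h h' : P.pt ⟶ Q.pt} {k k' : P.vec.X ⟶ Q.vec.X}
    (e : h = h') (e' : k = k') (hk) (hk') :
    FaaObj.lin (P := P) (Q := Q) h k hk = FaaObj.lin h' k' hk' := by
  subst e
  subst e'
  rfl

theorem FaaObj.eq_cast {P P' Q Q' : FaaObj C} (H : P = P') (K : Q = Q') (f : P ⟶ Q) (g : P' ⟶ Q')
    (hX : P.vec.X = P'.vec.X) (hpt : P.pt = P'.pt) (kX : Q'.vec.X = Q.vec.X) (kpt : Q'.pt = Q.pt)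
    (hs : FaaHom.star f = eqToHom hpt ≫ FaaHom.star g ≫ eqToHom kpt)
    (he : ∀ (T : C) (x : T ⟶ P.pt) (m : Multiset (T ⟶ P.vec.X)), FaaHom.eval f x m
      = FaaHom.eval g (x ≫ eqToHom hpt) (m.map (· ≫ eqToHom hX)) ≫ eqToHom kX) :
    f = eqToHom H ≫ g ≫ eqToHom K.symm := by
  subst H
  subst K
  simp only [eqToHom_refl, Category.comp_id, Category.id_comp, Multiset.map_id'] at hs he ⊢
  exact FaaObj.hom_ext hs he

theorem FaaObj.lin_comp_lin {P Q R : FaaObj C} (h : P.pt ⟶ Q.pt) (k : P.vec.X ⟶ Q.vec.X) (hk)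
    (h' : Q.pt ⟶ R.pt) (k' : Q.vec.X ⟶ R.vec.X) (hk') (hkk) :
    FaaObj.lin (P := P) (Q := Q) h k hk ≫ FaaObj.lin (P := Q) (Q := R) h' k' hk'
      = FaaObj.lin (P := P) (Q := R) (h ≫ h') (k ≫ k') hkk := by
  refine FaaObj.hom_ext rfl fun T x m => ?_
  refine (FaaObj.eval_comp_lin _ _ _ _ x m).trans ?_
  by_cases hm : Multiset.card m = 1
  · obtain ⟨a, rfl⟩ := Multiset.card_eq_one.1 hm
    refine (congrArg (· ≫ k') (FaaHom.lin_eval_singleton h k hk x a)).trans ?_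
    refine Eq.trans ?_ (FaaHom.lin_eval_singleton (h ≫ h') (k ≫ k') hkk x a).symm
    exact Category.assoc _ _ _
  · refine (congrArg (· ≫ k') (FaaHom.lin_eval_of_card h k hk x m hm)).trans ?_
    refine Eq.trans ?_ (FaaHom.lin_eval_of_card (h ≫ h') (k ≫ k') hkk x m hm).symm
    exact hk'.map_zero T

theorem FaaObj.isAdditive_eqToHom {P Q : FaaObj C} (h : P = Q) (h' : P.vec.X = Q.vec.X) :
    CMon.IsAdditive (A := P.vec) (B := Q.vec) (eqToHom h') := by
  subst h
  exact CMon.isAdditive_id _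

theorem FaaObj.eqToHom_eq {P Q : FaaObj C} (h : P = Q) (h' : P.vec.X = Q.vec.X)
    (h'' : P.pt = Q.pt) :
    eqToHom h = FaaObj.lin (P := P) (Q := Q) (eqToHom h'') (eqToHom h')
      (FaaObj.isAdditive_eqToHom h h') := by
  subst h
  rfl

namespace CartFunctor

variable (F : CartFunctor C D)

theorem mapCMon_prod (A B : CMon C) : F.mapCMon (A.prod B) = (F.mapCMon A).prod (F.mapCMon B) := by
  have hX : (F.mapCMon (A.prod B)).X = ((F.mapCMon A).prod (F.mapCMon B)).X := F.obj_prod A.X B.X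
  refine CMon.eq_of_isAdditive hX ⟨fun {T} f g => ?_, fun T => ?_⟩
  all_goals
    have h1 : ∀ f : T ⟶ (F.mapCMon (A.prod B)).X,
        (f ≫ eqToHom hX) ≫ CMon.prodFst _ _ = f ≫ F.mapHom (CMon.prodFst A B) := fun f =>
      (Category.assoc _ _ _).trans (congrArg (f ≫ ·) (F.map_fst A.X B.X).symm)
    have h2 : ∀ f : T ⟶ (F.mapCMon (A.prod B)).X,
        (f ≫ eqToHom hX) ≫ CMon.prodSnd _ _ = f ≫ F.mapHom (CMon.prodSnd A B) := fun f =>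
      (Category.assoc _ _ _).trans (congrArg (f ≫ ·) (F.map_snd A.X B.X).symm)
  · apply CMon.prod_hom_ext
    · rw [h1, (F.isAdditive_mapHom (CMon.isAdditive_fst A B)).map_add,
        (CMon.isAdditive_fst _ _).map_add, h1, h1]
    · rw [h2, (F.isAdditive_mapHom (CMon.isAdditive_snd A B)).map_add,
        (CMon.isAdditive_snd _ _).map_add, h2, h2]
  · apply CMon.prod_hom_ext
    · rw [h1, (F.isAdditive_mapHom (CMon.isAdditive_fst A B)).map_zero,
        (CMon.isAdditive_fst _ _).map_zero]
    · rw [h2, (F.isAdditive_mapHom (CMon.isAdditive_snd A B)).map_zero,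
        (CMon.isAdditive_snd _ _).map_zero]

theorem mapCMon_unit : F.mapCMon (CMon.unit C) = CMon.unit D :=
  CMon.eq_of_isAdditive (B := CMon.unit D) F.obj_unit
    ⟨fun _ _ => toUnit_unique _ _, fun _ => toUnit_unique _ _⟩

/-- The functor `Faà(F) : Faà(C) ⥤ Faà(D)`. -/
def faa : CartFunctor (FaaObj C) (FaaObj D) where
  functor :=
    { obj := F.mapObj
      map := F.mapFaaHom
      map_id := fun P => by
        refine (F.map_lin (P := P) (Q := P) (𝟙 _) (𝟙 _) (CMon.isAdditive_id _)).trans ?_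
        have h1 : F.functor.map (𝟙 P.pt) = 𝟙 _ := F.functor.map_id _
        have h2 : F.mapHom (𝟙 P.vec.X) = 𝟙 _ := F.functor.map_id _
        exact FaaObj.lin_congr (P := F.mapObj P) (Q := F.mapObj P) h1 h2 _
          (CMon.isAdditive_id (F.mapCMon P.vec))
      map_comp := F.map_comp' }
  obj_unit := FaaObj.ext_vec F.mapCMon_unit F.obj_unit
  obj_prod P Q := FaaObj.ext_vec (F.mapCMon_prod P.vec Q.vec) (F.obj_prod P.pt Q.pt)
  map_fst P Q := by
    refine (F.map_lin (P := P.prod Q) (Q := P) _ _ (CMon.isAdditive_fst _ _)).trans ?_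
    have hX : (F.mapObj (P.prod Q)).vec.X = ((F.mapObj P).prod (F.mapObj Q)).vec.X :=
      F.obj_prod _ _
    have e := FaaObj.eqToHom_eq (P := F.mapObj (P.prod Q)) (Q := (F.mapObj P).prod (F.mapObj Q))
      (FaaObj.ext_vec (F.mapCMon_prod P.vec Q.vec) (F.obj_prod P.pt Q.pt)) hX (F.obj_prod _ _)
    have e' : F.mapHom (CMon.prodFst P.vec Q.vec) = eqToHom hX ≫ CMon.prodFst _ _ :=
      F.map_fst _ _
    refine Eq.trans ?_ (congrArg (· ≫ FaaObj.prodFst (F.mapObj P) (F.mapObj Q)) e).symm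
    refine Eq.trans ?_ (FaaObj.lin_comp_lin _ _ _ _ _ _
      (e' ▸ F.isAdditive_mapHom (CMon.isAdditive_fst P.vec Q.vec))).symm
    congr 1
    exact F.map_fst _ _
  map_snd P Q := by
    refine (F.map_lin (P := P.prod Q) (Q := Q) _ _ (CMon.isAdditive_snd _ _)).trans ?_
    have hX : (F.mapObj (P.prod Q)).vec.X = ((F.mapObj P).prod (F.mapObj Q)).vec.X :=
      F.obj_prod _ _
    have e := FaaObj.eqToHom_eq (P := F.mapObj (P.prod Q)) (Q := (F.mapObj P).prod (F.mapObj Q))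
      (FaaObj.ext_vec (F.mapCMon_prod P.vec Q.vec) (F.obj_prod P.pt Q.pt)) hX (F.obj_prod _ _)
    have e' : F.mapHom (CMon.prodSnd P.vec Q.vec) = eqToHom hX ≫ CMon.prodSnd _ _ :=
      F.map_snd _ _
    refine Eq.trans ?_ (congrArg (· ≫ FaaObj.prodSnd (F.mapObj P) (F.mapObj Q)) e).symm
    refine Eq.trans ?_ (FaaObj.lin_comp_lin _ _ _ _ _ _
      (e' ▸ F.isAdditive_mapHom (CMon.isAdditive_snd P.vec Q.vec))).symm
    congr 1
    exact F.map_snd _ _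

theorem mapObj_id (P : FaaObj C) : (CartFunctor.id : CartFunctor C C).mapObj P = P := by
  refine FaaObj.ext_vec ?_ rfl
  let I : CartFunctor C C := CartFunctor.id
  have e : ∀ (T : C) (f : T ⟶ P.vec.X), I.elt (A := P.vec) (𝟙 T) f = f :=
    fun T f => Category.id_comp f
  have hc : ∀ (T : C) (f : T ⟶ P.vec.X), f ≫ 𝟙 _ = f := fun T f => Category.comp_id f
  have hadd : ∀ (T : C) (f g : T ⟶ (I.mapCMon P.vec).X) (f' g' : T ⟶ P.vec.X), f = f' → g = g' →
      f + g = (f' + g' : T ⟶ P.vec.X) := by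
    intro T f g f' g' hf hg
    refine (congrArg₂ (fun a b : T ⟶ (I.mapCMon P.vec).X => a + b)
      (hf.trans (e T f').symm) (hg.trans (e T g').symm)).trans ?_
    exact (I.elt_add (A := P.vec) (𝟙 T) f' g').symm.trans (e T _)
  refine CMon.eq_of_isAdditive rfl ⟨fun {T} f g => ?_, fun T => ?_⟩
  · refine (Category.comp_id _).trans ?_
    exact hadd T f g _ _ (hc T f).symm (hc T g).symm
  · refine (Category.comp_id _).trans ?_
    exact (I.elt_zero (A := P.vec) (𝟙 T)).symm.trans (e T 0)

theorem faa_id : (CartFunctor.id : CartFunctor C C).faa = CartFunctor.id := by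
  apply CartFunctor.ext
  refine CategoryTheory.Functor.ext mapObj_id fun P Q f => ?_
  refine FaaObj.eq_cast (mapObj_id P) (mapObj_id Q) _ _ rfl rfl rfl rfl ?_ fun T x m => ?_
  · exact ((Category.id_comp _).trans (Category.comp_id _)).symm
  · let I : CartFunctor C C := CartFunctor.id
    have key : ∀ (x : T ⟶ P.pt) (m : Multiset (T ⟶ P.vec.X)),
        FaaHom.eval (I.mapFaaHom f) x m = FaaHom.eval f x m := by
      intro x m
      have h := I.eval_map f (𝟙 T) x m
      have e1 : 𝟙 T ≫ I.functor.map x = x := Category.id_comp x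
      have e2 : m.map (I.elt (A := P.vec) (𝟙 T)) = m :=
        (Multiset.map_congr rfl fun z _ => Category.id_comp z).trans (Multiset.map_id m)
      exact (congrArg₂ (FaaHom.eval (I.mapFaaHom f)) e1 e2).symm.trans
        (h.trans (Category.id_comp _))
    refine (key x m).trans (Eq.trans ?_ (Category.comp_id _).symm)
    have e1 : (show T ⟶ P.pt from x) ≫ 𝟙 _ = x := Category.comp_id _
    have e2 : (show Multiset (T ⟶ P.vec.X) from m).map (fun z => z ≫ 𝟙 _) = m :=
      (Multiset.map_congr rfl fun z _ => Category.comp_id z).trans (Multiset.map_id _)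
    exact (congrArg₂ (FaaHom.eval f) e1 e2).symm

theorem elt_comp_functor (F : CartFunctor C D) (G : CartFunctor D E) {A : CMon C} {T : E} {S : C}
    (t : T ⟶ G.functor.obj (F.functor.obj S)) (f : S ⟶ A.X) :
    (F.comp G).elt (A := A) t f = G.elt (A := F.mapCMon A) t (F.elt (𝟙 _) f) := by
  have e : F.elt (A := A) (𝟙 _) f = F.functor.map f := Category.id_comp _
  rw [e]
  rfl

theorem mapObj_comp (F : CartFunctor C D) (G : CartFunctor D E) (P : FaaObj C) :
    (F.comp G).mapObj P = G.mapObj (F.mapObj P) := by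
  refine FaaObj.ext_vec ?_ rfl
  refine CMon.eq_of_isAdditive rfl ⟨fun {T} f g => ?_, fun T => ?_⟩
  · refine (Category.comp_id _).trans ?_
    obtain ⟨S, t, f', g', rfl, rfl⟩ := (F.comp G).exists_pair f g
    refine ((F.comp G).elt_add (A := P.vec) t f' g').symm.trans ?_
    refine (elt_comp_functor F G t (f' + g')).trans ?_
    refine (congrArg (G.elt t) (F.elt_add _ f' g')).trans ((G.elt_add t _ _).trans ?_)
    exact congrArg₂ (fun a b : T ⟶ (G.mapCMon (F.mapCMon P.vec)).X => a + b)
      ((elt_comp_functor F G t f').symm.trans (Category.comp_id _).symm)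
      ((elt_comp_functor F G t g').symm.trans (Category.comp_id _).symm)
  · refine (Category.comp_id _).trans ?_
    have t : T ⟶ (F.comp G).functor.obj (𝟙_ C) := toUnit T ≫ eqToHom (F.comp G).obj_unit.symm
    refine ((F.comp G).elt_zero (A := P.vec) t).symm.trans ?_
    refine (elt_comp_functor F G (A := P.vec) t 0).trans ?_
    exact (congrArg (G.elt t) (F.elt_zero _)).trans (G.elt_zero t)

theorem faa_comp (F : CartFunctor C D) (G : CartFunctor D E) :
    (F.comp G).faa = F.faa.comp G.faa := by
  apply CartFunctor.ext
  refine CategoryTheory.Functor.ext (mapObj_comp F G) fun P Q f => ?_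
  refine FaaObj.eq_cast (mapObj_comp F G P) (mapObj_comp F G Q) _ _ rfl rfl rfl rfl ?_
    fun T x m => ?_
  · exact ((Category.id_comp _).trans (Category.comp_id _)).symm
  · obtain ⟨S, t, x', m', rfl, rfl⟩ := (F.comp G).exists_multiset (A := P.vec) (X := P.pt) x m
    refine ((F.comp G).eval_map f t x' m').trans ?_
    refine Eq.trans ?_ (Category.comp_id _).symm
    have h := G.eval_map (F.mapFaaHom f) t (F.functor.map x') (m'.map (F.elt (𝟙 _)))
    have h' := F.eval_map f (𝟙 _) x' m'
    rw [Category.id_comp] at h'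
    rw [h', Multiset.map_map] at h
    refine (elt_comp_functor F G t _).trans (h.symm.trans ?_)
    have e1 : (t ≫ (F.comp G).functor.map x') ≫ eqToHom rfl = t ≫ G.functor.map (F.functor.map x') :=
      Category.comp_id _
    have e2 : (m'.map ((F.comp G).elt (A := P.vec) t)).map (fun z => z ≫ eqToHom rfl)
        = m'.map (G.elt (A := F.mapCMon P.vec) t ∘ F.elt (𝟙 _)) := by
      rw [Multiset.map_map]
      refine Multiset.map_congr rfl fun z _ => ?_
      exact (Category.comp_id _).trans (elt_comp_functor F G t z)
    exact (congrArg₂ (FaaHom.eval (G.mapFaaHom (F.mapFaaHom f))) e1 e2).symm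

end CartFunctor
end Functoriality

section Comonad

/-- An object of `cartCat`: a category with chosen finite products. -/
structure CartCat where
  carrier : Type (max u v)
  [category : Category.{v} carrier]
  [cartesian : CartesianMonoidalCategory carrier]

attribute [instance] CartCat.category CartCat.cartesian

/-- The category `cartCat`: its arrows are the functors that preserve the chosen finite products
exactly. -/
instance : Category CartCat.{v, u} where
  Hom X Y := CartFunctor X.carrier Y.carrier
  id _ := CartFunctor.id
  comp := CartFunctor.comp

/-- The endofunctor `Faà` on `cartCat`. -/
def Faa : CartCat.{v, u} ⥤ CartCat.{v, u} where
  obj X := ⟨FaaObj X.carrier⟩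
  map F := CartFunctor.faa F
  map_id _ := CartFunctor.faa_id
  map_comp F G := CartFunctor.faa_comp F G

/-- The functor `Faà(X) ⥤ X` with `((A, +, 0), X) ↦ X` and `(f_*, f_1, …) ↦ f_*`. -/
def faaCounit (X : CartCat.{v, u}) : Faa.obj X ⟶ X :=
  { functor :=
      { obj := fun P : FaaObj X.carrier => P.pt
        map := fun f => FaaHom.star f }
    obj_unit := rfl
    obj_prod := fun _ _ => rfl
    map_fst := fun _ _ => (Category.id_comp _).symm
    map_snd := fun _ _ => (Category.id_comp _).symm }

section Comultiplication

variable {C : Type u} [Category.{v} C] [CartesianMonoidalCategory C]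

/-- The object `((A, +, 0), A)` of `Faà(C)`. -/
@[reducible] def linObj (A : CMon C) : FaaObj C := ⟨A, A.X⟩

/-- The addition `(+, π_0 +, 0, …)` on `((A, +, 0), A)`. -/
def linAdd (A : CMon C) : linObj A ⊗ linObj A ⟶ linObj A :=
  FaaObj.lin (P := (linObj A).prod (linObj A)) A.add A.addMap A.isAdditive_add

/-- The zero `(0, π_0 0, 0, …)` of `((A, +, 0), A)`. -/
def linZero (A : CMon C) : 𝟙_ (FaaObj C) ⟶ linObj A :=
  FaaObj.lin (P := FaaObj.unit C) A.zero A.zeroMap A.isAdditive_zero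

theorem star_lift_linAdd (A : CMon C) {T : FaaObj C} (f g : T ⟶ linObj A) :
    FaaHom.star (lift f g ≫ linAdd A)
      = (FaaHom.star f + FaaHom.star g : T.pt ⟶ A.X) := by
  rw [FaaObj.lift_eq]
  rfl

theorem eval_lift_linAdd (A : CMon C) {T : FaaObj C} (f g : T ⟶ linObj A) {S : C} (x : S ⟶ T.pt)
    (m : Multiset (S ⟶ T.vec.X)) :
    FaaHom.eval (lift f g ≫ linAdd A) x m
      = (FaaHom.eval f x m + FaaHom.eval g x m : S ⟶ A.X) := by
  have key : ∀ u : T ⟶ (linObj A).prod (linObj A), FaaHom.eval (P := T) (Q := linObj A)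
      (u ≫ FaaObj.lin (P := (linObj A).prod (linObj A)) (Q := linObj A) A.add A.addMap
        A.isAdditive_add) x m
        = (FaaHom.eval u x m ≫ CMon.prodFst A A + FaaHom.eval u x m ≫ CMon.prodSnd A A :
            S ⟶ A.X) := by
    intro u
    rw [FaaObj.eval_comp_lin]
    exact CMon.comp_addMap _
  rw [FaaObj.lift_eq]
  refine (key (FaaObj.prodLift f g)).trans ?_
  rw [FaaObj.eval_prodLift, CMon.pair_fst, CMon.pair_snd]

theorem star_linZero (A : CMon C) (T : FaaObj C) :
    FaaHom.star (toUnit T ≫ linZero A) = (0 : T.pt ⟶ A.X) :=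
  congrArg (· ≫ A.zero) (toUnit_unique (FaaHom.star (toUnit T)) (toUnit T.pt))

theorem eval_linZero (A : CMon C) {T : FaaObj C} {S : C} (x : S ⟶ T.pt)
    (m : Multiset (S ⟶ T.vec.X)) :
    FaaHom.eval (toUnit T ≫ linZero A) x m = (0 : S ⟶ A.X) := by
  have key : ∀ u : T ⟶ FaaObj.unit C, FaaHom.eval (P := T) (Q := linObj A)
      (u ≫ FaaObj.lin (P := FaaObj.unit C) (Q := linObj A) A.zero A.zeroMap A.isAdditive_zero) x m
        = (0 : S ⟶ A.X) := by
    intro u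
    rw [FaaObj.eval_comp_lin]
    exact CMon.comp_zeroMap _
  exact key (toUnit T)

/-- The commutative monoid `(((A, +, 0), A), (+, π_0 +, 0, …), (0, π_0 0, 0, …))` of `Faà(C)`. -/
def linMon (A : CMon C) : CMon (FaaObj C) :=
  CMon.ofLaws (linObj A) (linAdd A) (linZero A)
    (fun T f => FaaObj.hom_ext
      (by rw [star_lift_linAdd, star_linZero, zero_add])
      (fun S x m => by rw [eval_lift_linAdd, eval_linZero, zero_add]))
    (fun T f g => FaaObj.hom_ext
      (by rw [star_lift_linAdd, star_lift_linAdd, add_comm])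
      (fun S x m => by rw [eval_lift_linAdd, eval_lift_linAdd, add_comm]))
    (fun T f g h => FaaObj.hom_ext
      (by simp only [star_lift_linAdd, add_assoc])
      (fun S x m => by simp only [eval_lift_linAdd, add_assoc]))

/-- The value `((((A, +, 0), A), (+, π_0 +, 0, …), (0, π_0 0, 0, …)), ((A, +, 0), X))` of the
comultiplication at `((A, +, 0), X)`. -/
def comultObj (P : FaaObj C) : FaaObj (FaaObj C) := ⟨linMon P.vec, P⟩

/-- The object `((A, +, 0), A)^r × ((A, +, 0), X)` of `Faà(C)`. -/
def powLin (P : FaaObj C) (r : ℕ) : FaaObj C := powObj (linObj P.vec) r P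

/-- The map `(a_1, …, a_r, x) ↦ f_r(a_1, …, a_r, x)` on `A^r × X`. -/
def multiDer {P Q : FaaObj C} (f : P ⟶ Q) (r : ℕ) : (powLin P r).pt ⟶ Q.vec.X :=
  FaaHom.eval f (FaaHom.star (powBase (linObj P.vec) P r))
    (Finset.univ.val.map fun i => FaaHom.star (powProj (linObj P.vec) P r i))

/-- The `s`-th derivative of `(a_1, …, a_r, x) ↦ f_r(a_1, …, a_r, x)` at the generalized element
`b = (a_1, …, a_r, x)`, in the directions `d j = (α_1^j, …, α_r^j, β^j)` for `j = 1, …, s`: the sum,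
over all partial injections `φ` from `{1, …, r}` to `{1, …, s}`, of the value of `f` at the
arguments `α_i^{φ(i)}` for `i` in the domain of `φ`, `a_i` for the other `i`, and `β^j` for `j` not
in the image of `φ`. The components `α_i^j` and `β^j` are the first derivatives, in the direction
`d j`, of the projections of `((A, +, 0), A)^r × ((A, +, 0), X)`. -/
def iterDer {P Q : FaaObj C} (f : P ⟶ Q) (r s : ℕ) {T : C} (b : T ⟶ (powLin P r).pt)
    (d : Fin s → (T ⟶ (powLin P r).vec.X)) : T ⟶ Q.vec.X :=
  let a : Fin r → (T ⟶ P.vec.X) := fun i => b ≫ FaaHom.star (powProj (linObj P.vec) P r i)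
  let x : T ⟶ P.pt := b ≫ FaaHom.star (powBase (linObj P.vec) P r)
  let α : Fin r → Fin s → (T ⟶ P.vec.X) := fun i j =>
    FaaHom.eval (powProj (linObj P.vec) P r i) b {d j}
  let β : Fin s → (T ⟶ P.vec.X) := fun j => FaaHom.eval (powBase (linObj P.vec) P r) b {d j}
  ∑ φ : Fin r → Option (Fin s) with ∀ i i' j, φ i = some j → φ i' = some j → i = i',
    FaaHom.eval f x
      ((Finset.univ.val.map fun i => (φ i).elim (a i) (α i))
        + (Finset.univ.filter fun j => ∀ i, φ i ≠ some j).val.map β)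

/-- `g` is the value of the comultiplication at the arrow `f`: `g_* = f`, `(g_r)_* = f_r`, and
`(g_r)_s` is the `s`-th derivative of `f_r` as a map on `A^r × X`, for `r, s ≥ 1`. -/
structure IsComultMap {P Q : FaaObj C} (f : P ⟶ Q) (g : comultObj P ⟶ comultObj Q) : Prop where
  star : FaaHom.star g = f
  der_star : ∀ r, FaaHom.star (FaaHom.der g r) = multiDer f (r + 1)
  der_der : ∀ r s, FaaHom.der (FaaHom.der g r) s
    = iterDer f (r + 1) (s + 1)
        (powBase (powLin P (r + 1)).vec.X (powLin P (r + 1)).pt (s + 1))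
        (powProj (powLin P (r + 1)).vec.X (powLin P (r + 1)).pt (s + 1))

end Comultiplication

/-- The functor `D : Faà(X) ⥤ Faà(Faà(X))` is the comultiplication, on objects and on arrows. -/
structure IsComult {X : CartCat.{v, u}} (D : Faa.obj X ⟶ Faa.obj (Faa.obj X)) : Prop where
  obj : ∀ P : FaaObj X.carrier, D.functor.obj P = comultObj P
  map : ∀ {P Q : FaaObj X.carrier} (f : P ⟶ Q),
    IsComultMap f (eqToHom (obj P).symm ≫ D.functor.map f ≫ eqToHom (obj Q))

end Comonad
end FaaDiBruno

open CategoryTheory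

universe v u

/-!
The comonad laws for `Faà` are identities between sums over partitions. They are all reduced to one
chain rule for multisets.

A morphism `f = (f_*, f_1, f_2, …)` is handled through its values on generalized elements: at a
point `x`, the maps `f_n` together form a symmetric multiadditive function `G` on multisets. For
such a `G`, factors `k_1, …, k_r` and a further function `K`, all depending on a multiset of
directions, `leibniz G {k_1, …, k_r} K m` is the iterated derivative in the directions `m` of the
expression `G (k_1, …, k_r)` at a moving point, where `k_i p` and `K p` stand for the derivatives of
the `i`-th factor and of the point in the directions `p`. It is the sum over all distributions of
`m` into `r + 1` parts, one for each factor, and over all partitions of the last part, whose blocks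
give the additional arguments of `G` obtained by differentiating the point. With no factors this is
composition over partitions, that is, Faà di Bruno's formula.

Since a morphism into `((A, +, 0), A)` takes all its values in `A`, its component `_*` can be
treated as the value on no directions (`full`). The morphism `f_r (u_1, …, u_r, z)` of `Faà(C)` is
then defined by Leibniz' rule applied to `f` (`derEval`), and the comultiplication sends `f` to the
family of these morphisms (`comultMap`). For the projections of `((A, +, 0), A)^r × ((A, +, 0), X)`
each factor has degree at most one and `K` is linear, so that the distributions and partitions
which contribute are the partial injections of the explicit formula
(`leibniz_eq_sum_partialInjection`).

The recursion `partComp_cons`, which singles out the block of one element, gives the product rule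
`partComp_antiSum` for composition over partitions, and from it the product rule `leibniz_antiSum`.
The product rule implies `leibniz_partComp`, which is the functoriality of the comultiplication,
and `leibniz_leibniz`, the chain rule for iterated derivatives. The latter gives both the naturality
of `derEval` in its arguments and, applied to morphisms whose values are themselves morphisms of
`Faà(C)`, coassociativity. The equalities between functors hold strictly: objects agree because the
identity is additive for both monoid structures, and morphisms agree on generalized elements.
-/

namespace FaaDiBruno
open MonoidalCategory CartesianMonoidalCategory

/-! ### Distributions of a multiset into two parts -/

section AntiSum

variable {A B C D M : Type*}

/-- The sum of `F p q` over all the ways of distributing the multiset `m` into two parts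
`m = p + q`, where the elements of `m` are distinguished from each other. -/
def antiSum [AddCommMonoid M] (m : Multiset A) (F : Multiset A → Multiset A → M) : M :=
  (m.antidiagonal.map fun p => F p.1 p.2).sum

variable [AddCommMonoid M]

theorem antiSum_zero (F : Multiset A → Multiset A → M) : antiSum 0 F = F 0 0 := by
  simp [antiSum]

theorem antiSum_cons (a : A) (m : Multiset A) (F : Multiset A → Multiset A → M) :
    antiSum (a ::ₘ m) F
      = antiSum m (fun p q => F p (a ::ₘ q)) + antiSum m (fun p q => F (a ::ₘ p) q) := by
  simp [antiSum, Multiset.antidiagonal_cons]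

theorem antiSum_congr {m : Multiset A} {F F' : Multiset A → Multiset A → M}
    (h : ∀ p q, p + q = m → F p q = F' p q) : antiSum m F = antiSum m F' :=
  congrArg Multiset.sum (Multiset.map_congr rfl fun x hx =>
    h x.1 x.2 (Multiset.mem_antidiagonal.1 hx))

theorem antiSum_add (m : Multiset A) (F F' : Multiset A → Multiset A → M) :
    antiSum m (fun p q => F p q + F' p q) = antiSum m F + antiSum m F' :=
  Multiset.sum_map_add

theorem antiSum_const_zero (m : Multiset A) : antiSum m (fun _ _ => (0 : M)) = 0 := by
  simp [antiSum]

theorem map_antiSum {N : Type*} [AddCommMonoid N] (φ : M →+ N) (m : Multiset A)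
    (F : Multiset A → Multiset A → M) :
    φ (antiSum m F) = antiSum m fun p q => φ (F p q) := by
  rw [antiSum, map_multiset_sum, Multiset.map_map]
  rfl

theorem antiSum_swap (m : Multiset A) (m' : Multiset B)
    (F : Multiset A → Multiset A → Multiset B → Multiset B → M) :
    antiSum m (fun p q => antiSum m' fun p' q' => F p q p' q')
      = antiSum m' fun p' q' => antiSum m fun p q => F p q p' q' :=
  Multiset.sum_map_sum_map _ _

theorem antiSum_map (e : A → B) (m : Multiset A) (F : Multiset B → Multiset B → M) :
    antiSum (m.map e) F = antiSum m fun p q => F (p.map e) (q.map e) := by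
  induction m using Multiset.induction_on generalizing F with
  | empty => simp [antiSum_zero]
  | cons a m ih => simp only [Multiset.map_cons, antiSum_cons, ih]

theorem antiSum_comm (m : Multiset A) (F : Multiset A → Multiset A → M) :
    antiSum m F = antiSum m fun p q => F q p := by
  induction m using Multiset.induction_on generalizing F with
  | empty => simp [antiSum_zero]
  | cons a m ih =>
    rw [antiSum_cons, antiSum_cons, add_comm]
    exact congrArg₂ _ (ih _) (ih _)

/-- Both sides sum over all distributions of `m` into three parts. -/
theorem antiSum_assoc (m : Multiset A) (F : Multiset A → Multiset A → Multiset A → M) :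
    antiSum m (fun p q => antiSum p fun p₁ p₂ => F p₁ p₂ q)
      = antiSum m fun p q => antiSum q fun q₁ q₂ => F p q₁ q₂ := by
  induction m using Multiset.induction_on generalizing F with
  | empty => simp [antiSum_zero]
  | cons a m ih =>
    simp only [antiSum_cons, antiSum_add, ih]
    abel

theorem antiSum_left_comm (m : Multiset A) (F : Multiset A → Multiset A → Multiset A → M) :
    antiSum m (fun p q => antiSum q fun q₁ q₂ => F p q₁ q₂)
      = antiSum m fun p q => antiSum q fun q₁ q₂ => F q₁ p q₂ := by
  rw [← antiSum_assoc, ← antiSum_assoc m fun p₁ p₂ q => F p₂ p₁ q]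
  exact antiSum_congr fun p q _ => antiSum_comm p _

/-- If `F p q` vanishes unless `q` is empty, only the distribution `m = m + 0` contributes. -/
theorem antiSum_eq_left {m : Multiset A} {F : Multiset A → Multiset A → M}
    (h : ∀ p q, q ≠ 0 → F p q = 0) : antiSum m F = F m 0 := by
  induction m using Multiset.induction_on generalizing F with
  | empty => exact antiSum_zero F
  | cons a m ih =>
    rw [antiSum_cons, ih fun p q hq => h _ _ hq]
    have : antiSum m (fun p q => F p (a ::ₘ q)) = antiSum m fun _ _ => (0 : M) :=
      antiSum_congr fun p q _ => h _ _ (Multiset.cons_ne_zero)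
    rw [this, antiSum_const_zero, zero_add]

open Finset in
theorem sum_powerset_eq_antiSum {ι : Type*} [DecidableEq ι] (s : Finset ι) (a : ι → A)
    (F : Multiset A → Multiset A → M) :
    ∑ t ∈ s.powerset, F (t.val.map a) ((s \ t).val.map a) = antiSum (s.val.map a) F := by
  induction s using Finset.induction_on generalizing F with
  | empty => simp [antiSum_zero]
  | insert i s hi ih =>
    rw [Finset.sum_powerset_insert hi, Finset.insert_val_of_notMem hi, Multiset.map_cons,
      antiSum_cons, ← ih, ← ih]
    refine congrArg₂ _ (Finset.sum_congr rfl fun t ht => ?_) (Finset.sum_congr rfl fun t ht => ?_)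
    · have hit : i ∉ t := fun h => hi (Finset.mem_powerset.1 ht h)
      rw [Finset.insert_sdiff_of_notMem _ hit, Finset.insert_val_of_notMem (by simp [hi]),
        Multiset.map_cons]
    · have hit : i ∉ t := fun h => hi (Finset.mem_powerset.1 ht h)
      rw [Finset.insert_val_of_notMem hit, Multiset.map_cons, Finset.insert_sdiff_insert,
        Finset.sdiff_insert_of_notMem hi]

end AntiSum

/-! ### Recursion for sums over partitions -/

section Recursion

variable {A B C D : Type*}

open Finset in
/-- A partition of `s ∪ {i}` is given by the block `t ∪ {i}` that contains `i`, and a partition of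
the complement of `t`. -/
theorem partSum_insert {ι : Type*} [DecidableEq ι] [AddCommMonoid C] (G : Multiset B → C)
    (F : Multiset A → B) {s : Finset ι} {i : ι} (hi : i ∉ s) (a : ι → A) :
    partSum G F (insert i s) a = ∑ t ∈ s.powerset,
      partSum (fun M => G (F (a i ::ₘ t.val.map a) ::ₘ M)) F (s \ t) a := by
  unfold partSum
  rw [Finset.sum_sigma']
  symm
  -- the partition of `s \ t`, extended by the block `t ∪ {i}`
  have hne : ∀ t : Finset ι, insert i t ≠ ⊥ := fun t => Finset.insert_ne_empty i t
  have hdis : ∀ t : Finset ι, Disjoint (s \ t) (insert i t) := by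
    intro t
    rw [Finset.disjoint_insert_right]
    exact ⟨fun h => hi (Finset.mem_sdiff.1 h).1, Finset.sdiff_disjoint⟩
  have hsup : ∀ t ∈ s.powerset, (s \ t) ⊔ insert i t = insert i s := by
    intro t ht
    rw [Finset.mem_powerset] at ht
    ext j
    simp only [Finset.sup_eq_union, Finset.mem_union, Finset.mem_sdiff, Finset.mem_insert]
    have := @ht j
    tauto
  refine Finset.sum_bij (fun x hx => x.2.extend (hne x.1) (hdis x.1)
    (hsup x.1 (Finset.mem_sigma.1 hx).1)) (fun _ _ => Finset.mem_univ _) ?_ ?_ ?_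
  · rintro ⟨t, P⟩ hx ⟨t', P'⟩ hx' h
    have hp : insert (insert i t) P.parts = insert (insert i t') P'.parts :=
      congrArg Finpartition.parts h
    have ht : t ⊆ s := Finset.mem_powerset.1 (Finset.mem_sigma.1 hx).1
    have ht' : t' ⊆ s := Finset.mem_powerset.1 (Finset.mem_sigma.1 hx').1
    have hnot : ∀ (u u' : Finset ι) (R : Finpartition (s \ u)), insert i u' ∉ R.parts := by
      intro u u' R hR
      exact hi (Finset.mem_sdiff.1 (R.subset hR (Finset.mem_insert_self i u'))).1
    have h1 : insert i t = insert i t' := by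
      have : insert i t ∈ insert (insert i t') P'.parts := hp ▸ Finset.mem_insert_self _ _
      exact (Finset.mem_insert.1 this).resolve_right (hnot t' t P')
    have htt : t = t' := by
      rw [← Finset.erase_insert (fun h => hi (ht h)), h1,
        Finset.erase_insert (fun h => hi (ht' h))]
    subst htt
    congr
    ext1
    rw [← Finset.erase_insert (hnot t t P), hp, Finset.erase_insert (hnot t t P')]
  · intro P _
    have hb := P.part_mem.2 (Finset.mem_insert_self i s)
    have hib : i ∈ P.part i := P.mem_part (Finset.mem_insert_self i s)
    generalize P.part i = b at hb hib
    have hsub : b.erase i ⊆ s := by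
      intro j hj
      have := P.subset hb (Finset.mem_of_mem_erase hj)
      exact (Finset.mem_insert.1 this).resolve_left (Finset.ne_of_mem_erase hj)
    refine ⟨⟨b.erase i, P.ofSubset (parts := P.parts.erase b) (Finset.erase_subset _ _) ?_⟩,
      ?_, ?_⟩
    · ext j
      simp only [Finset.mem_sup, Finset.mem_erase, id, Finset.mem_sdiff, not_and]
      constructor
      · rintro ⟨c, ⟨hcb, hc⟩, hjc⟩
        have hjb : j ∉ b := fun hjb => hcb (P.eq_of_mem_parts hc hb hjc hjb)
        refine ⟨(Finset.mem_insert.1 (P.subset hc hjc)).resolve_left ?_, fun _ => hjb⟩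
        rintro rfl
        exact hjb hib
      · rintro ⟨hjs, hj⟩
        obtain ⟨c, hc, hjc⟩ := P.exists_mem (Finset.mem_insert_of_mem hjs)
        refine ⟨c, ⟨?_, hc⟩, hjc⟩
        rintro rfl
        exact hj (fun h => hi (h ▸ hjs)) hjc
    · exact Finset.mem_sigma.2 ⟨Finset.mem_powerset.2 hsub, Finset.mem_univ _⟩
    · ext1
      change insert (insert i (b.erase i)) (P.parts.erase b) = P.parts
      rw [Finset.insert_erase hib, Finset.insert_erase hb]
  · rintro ⟨t, P⟩ hx
    have ht : t ⊆ s := Finset.mem_powerset.1 (Finset.mem_sigma.1 hx).1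
    have hnot : insert i t ∉ P.parts := by
      intro hR
      exact hi (Finset.mem_sdiff.1 (P.subset hR (Finset.mem_insert_self i t))).1
    refine congrArg G ?_
    change _ = (insert (insert i t) P.parts).val.map _
    rw [Finset.insert_val_of_notMem hnot, Multiset.map_cons,
      Finset.insert_val_of_notMem (fun h => hi (ht h)), Multiset.map_cons]

variable [AddCommMonoid C]

theorem partComp_zero (G : Multiset B → C) (F : Multiset A → B) : partComp G F 0 = G 0 := by
  refine (partComp_eq G F (⊥ : Finset (Fin 0)) (fun i => i.elim0)).trans ?_
  exact Fintype.sum_unique _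

/-- The sum over all partitions, by recursion: the block that contains `a` is `{a} ∪ p`. -/
theorem partComp_cons (G : Multiset B → C) (F : Multiset A → B) (a : A) (m : Multiset A) :
    partComp G F (a ::ₘ m)
      = antiSum m fun p q => partComp (fun M => G (F (a ::ₘ p) ::ₘ M)) F q := by
  classical
  induction m using Quotient.inductionOn with
  | h l =>
    -- label the elements of `m` by `1, …, l.length`, which leaves the label `0` for `a`
    let s : Finset (Fin (l.length + 1)) := Finset.univ.map (Fin.succEmb _)
    have hl : (Quotient.mk _ l : Multiset A) = s.val.map (a :: l).get := by
      rw [Finset.map_val, Multiset.map_map]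
      have : ((a :: l).get ∘ (Fin.succEmb l.length)) = l.get := by
        funext i
        simp
      rw [this, Fin.univ_val_map, List.ofFn_get]
      rfl
    have h0 : (0 : Fin (l.length + 1)) ∉ s := by simp [s]
    have hc : a ::ₘ s.val.map (a :: l).get = (insert 0 s).val.map (a :: l).get := by
      rw [Finset.insert_val_of_notMem h0, Multiset.map_cons]
      rfl
    rw [hl, hc, partComp_eq, partSum_insert G F h0, ← sum_powerset_eq_antiSum]
    refine Finset.sum_congr rfl fun t _ => ?_
    rw [partComp_eq]
    rfl

end Recursion

/-! ### Composition over partitions -/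

section PartComp

variable {A B C D E : Type*}

/-- A symmetric function of finitely many variables is multiadditive when it is additive in each
of its variables. -/
structure MultiAdditive [AddCommMonoid B] [AddCommMonoid C] (G : Multiset B → C) : Prop where
  add : ∀ a b m, G ((a + b) ::ₘ m) = G (a ::ₘ m) + G (b ::ₘ m)
  zero : ∀ m, G (0 ::ₘ m) = 0

theorem MultiAdditive.cons [AddCommMonoid B] [AddCommMonoid C] {G : Multiset B → C}
    (h : MultiAdditive G) (b : B) : MultiAdditive fun M => G (b ::ₘ M) where
  add x y m := by
    rw [Multiset.cons_swap, h.add, Multiset.cons_swap x, Multiset.cons_swap y]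
  zero m := by rw [Multiset.cons_swap, h.zero]

/-- A multiadditive function, as an additive function of its first variable. -/
@[simps] def MultiAdditive.argHom [AddCommMonoid B] [AddCommMonoid C] {G : Multiset B → C}
    (h : MultiAdditive G) : B →+ (Multiset B → C) where
  toFun b M := G (b ::ₘ M)
  map_zero' := funext fun M => h.zero M
  map_add' a b := funext fun M => h.add a b M

variable [AddCommMonoid C]

theorem partComp_coe (G : Multiset B → C) (F : Multiset A → B) (l : List A) :
    partComp G F (l : Multiset A) = ∑ P : Finpartition (Finset.univ : Finset (Fin l.length)),
      G (P.parts.val.map fun b => F (b.val.map l.get)) := rfl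

/-- Composition over partitions, as an additive function of the outer argument. -/
@[simps] def partCompHom (F : Multiset A → B) (m : Multiset A) : (Multiset B → C) →+ C where
  toFun G := partComp G F m
  map_zero' := by
    induction m using Quotient.inductionOn with
    | h l => exact (partComp_coe (0 : Multiset B → C) F l).trans Finset.sum_const_zero
  map_add' G G' := by
    induction m using Quotient.inductionOn with
    | h l => exact (partComp_coe (G + G') F l).trans Finset.sum_add_distrib

theorem map_partComp {C' : Type*} [AddCommMonoid C'] (φ : C →+ C') (G : Multiset B → C)
    (F : Multiset A → B) (m : Multiset A) :
    φ (partComp G F m) = partComp (fun M => φ (G M)) F m := by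
  induction m using Quotient.inductionOn with
  | h l => exact (congrArg φ (partComp_coe G F l)).trans (map_sum φ _ _)

theorem partComp_antiSum_left {ι : Type*} (m' : Multiset ι)
    (G : Multiset ι → Multiset ι → Multiset B → C) (F : Multiset A → B) (m : Multiset A) :
    partComp (fun M => antiSum m' fun p q => G p q M) F m
      = antiSum m' fun p q => partComp (G p q) F m := by
  rw [← partCompHom_apply F m]
  have : (fun M => antiSum m' fun p q => G p q M) = antiSum m' G := by
    funext M
    exact (map_antiSum (Pi.evalAddMonoidHom (fun _ => C) M) m' G).symm
  rw [this, map_antiSum]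
  rfl

theorem partComp_add_left (G G' : Multiset B → C) (F : Multiset A → B) (m : Multiset A) :
    partComp (fun M => G M + G' M) F m = partComp G F m + partComp G' F m :=
  map_add (partCompHom F m) G G'

theorem partComp_zero_left (F : Multiset A → B) (m : Multiset A) :
    partComp (fun _ => (0 : C)) F m = 0 :=
  map_zero (partCompHom F m)

theorem partComp_map_left (h : B → D) (G : Multiset D → C) (F : Multiset A → B) (m : Multiset A) :
    partComp (fun M => G (M.map h)) F m = partComp G (fun p => h (F p)) m := by
  induction m using Quotient.inductionOn with
  | h l =>
    refine (partComp_coe _ F l).trans (Finset.sum_congr rfl fun P _ => ?_)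
    rw [Multiset.map_map]
    rfl

theorem lt_cons_of_add_eq {a : A} {m p q : Multiset A} (h : p + q = m) : q < a ::ₘ m :=
  lt_of_le_of_lt (h ▸ Multiset.le_add_left q p) (Multiset.lt_cons_self m a)

theorem partComp_map_right (e : E → A) (G : Multiset B → C) (F : Multiset A → B)
    (m : Multiset E) : partComp G (fun p => F (p.map e)) m = partComp G F (m.map e) := by
  induction m using Multiset.strongInductionOn generalizing G with
  | ih m ih =>
    induction m using Multiset.induction_on with
    | empty => simp [partComp_zero]
    | cons a m _ =>
      rw [Multiset.map_cons, partComp_cons, partComp_cons, antiSum_map]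
      refine antiSum_congr fun p q h => ?_
      rw [ih q (lt_cons_of_add_eq h), Multiset.map_cons]

theorem partComp_congr_right (G : Multiset B → C) {F F' : Multiset A → B}
    (h : ∀ p, p ≠ 0 → F p = F' p) (m : Multiset A) : partComp G F m = partComp G F' m := by
  induction m using Multiset.strongInductionOn generalizing G with
  | ih m ih =>
    induction m using Multiset.induction_on with
    | empty => simp [partComp_zero]
    | cons a m _ =>
      rw [partComp_cons, partComp_cons]
      refine antiSum_congr fun p q hpq => ?_
      rw [ih q (lt_cons_of_add_eq hpq), h _ Multiset.cons_ne_zero]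

theorem partComp_congr_left {G G' : Multiset B → C} (F : Multiset A → B)
    (h : ∀ p, p ≠ 0 → G p = G' p) {m : Multiset A} (hm : m ≠ 0) :
    partComp G F m = partComp G' F m := by
  obtain ⟨a, ha⟩ := Multiset.exists_mem_of_ne_zero hm
  obtain ⟨m, rfl⟩ := Multiset.exists_cons_of_mem ha
  rw [partComp_cons, partComp_cons]
  exact antiSum_congr fun p q _ => congrArg (fun G => partComp G F q)
    (funext fun M => h _ Multiset.cons_ne_zero)

theorem MultiAdditive.partComp [AddCommMonoid A] [AddCommMonoid B] {G : Multiset B → C}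
    {F : Multiset A → B} (hG : MultiAdditive G) (hF : MultiAdditive F) :
    MultiAdditive (partComp G F) where
  add := partComp_cons_add G F hG.add hF.add
  zero := partComp_cons_zero G F hG.zero hF.zero

/-- The product rule for the composition over partitions: a distribution of the blocks of a
partition of `m` into two parts amounts to a distribution of `m` into two parts and a partition of
each. -/
theorem partComp_antiSum (Ψ : Multiset B → Multiset B → C) (V : Multiset A → B) (m : Multiset A) :
    partComp (fun M => antiSum M Ψ) V m
      = antiSum m fun p q => partComp (fun P => partComp (Ψ P) V q) V p := by
  induction m using Multiset.strongInductionOn generalizing Ψ with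
  | ih m ih =>
    induction m using Multiset.induction_on with
    | empty => simp [partComp_zero, antiSum_zero]
    | cons a m _ =>
      have h1 : ∀ p q, p + q = m → _ := fun p q h => ih q (lt_cons_of_add_eq h)
      -- the block that contains `a` is an argument of either the second or the first factor
      simp only [partComp_cons, antiSum_cons, partComp_antiSum_left, partComp_add_left]
      rw [antiSum_left_comm, antiSum_assoc m fun p₁ p₂ q =>
        partComp (fun P => partComp (Ψ (V (a ::ₘ p₁) ::ₘ P)) V q) V p₂, ← antiSum_add]
      refine antiSum_congr fun p q h => ?_
      rw [h1 p q h, h1 p q h]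

end PartComp

/-! ### Leibniz' rule -/

section Leibniz

variable {A B C D E : Type*} [AddCommMonoid C]

/-- Adjunction of one factor in Leibniz' rule: a part `p` of the arguments goes to the factor `k`,
and the rest is treated by `W`. -/
def leibnizStep (k : Multiset D → B) (W : (Multiset B → C) → Multiset D → C) :
    (Multiset B → C) → Multiset D → C :=
  fun G m => antiSum m fun p q => W (fun M => G (k p ::ₘ M)) q

instance : LeftCommutative (leibnizStep : (Multiset D → B) → _ → (Multiset B → C) → _) where
  left_comm k k' W := by
    funext G m
    refine (antiSum_left_comm m _).trans ?_
    refine antiSum_congr fun p q _ => antiSum_congr fun p' q' _ => ?_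
    congr 1
    funext M
    exact congrArg G (Multiset.cons_swap _ _ _)

/-- The iterated derivative, in the directions `m`, of the expression `G (k_1, …, k_r)` at a moving
point, where `κ = {k_1, …, k_r}`: the directions are distributed among the factors and one
remaining part, and `G` receives one more argument `K b` for each block `b` of a partition of the
remaining part. Here `k_i p` and `K p` stand for the derivatives of the `i`-th factor and of the
point in the directions `p`; the value `k_i 0` is the factor itself, and `K 0` is not used. -/
def leibniz (G : Multiset B → C) (κ : Multiset (Multiset D → B)) (K : Multiset D → B)
    (m : Multiset D) : C :=
  κ.foldr leibnizStep (fun G m => partComp G K m) G m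

theorem leibniz_nil (G : Multiset B → C) (K : Multiset D → B) (m : Multiset D) :
    leibniz G 0 K m = partComp G K m := by
  simp [leibniz]

theorem leibniz_cons (G : Multiset B → C) (k : Multiset D → B) (κ : Multiset (Multiset D → B))
    (K : Multiset D → B) (m : Multiset D) :
    leibniz G (k ::ₘ κ) K m = antiSum m fun p q => leibniz (fun M => G (k p ::ₘ M)) κ K q := by
  simp only [leibniz, Multiset.foldr_cons]
  rfl

theorem leibniz_zero (G : Multiset B → C) (κ : Multiset (Multiset D → B)) (K : Multiset D → B) :
    leibniz G κ K 0 = G (κ.map fun k => k 0) := by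
  induction κ using Multiset.induction_on generalizing G with
  | empty => rw [leibniz_nil, partComp_zero, Multiset.map_zero]
  | cons k κ ih => rw [leibniz_cons, antiSum_zero, ih, Multiset.map_cons]

/-- Leibniz' rule, as an additive function of the outer argument. -/
@[simps] def leibnizHom (κ : Multiset (Multiset D → B)) (K : Multiset D → B) (m : Multiset D) :
    (Multiset B → C) →+ C where
  toFun G := leibniz G κ K m
  map_zero' := by
    induction κ using Multiset.induction_on generalizing m with
    | empty => rw [leibniz_nil]; exact partComp_zero_left K m
    | cons k κ ih =>
      rw [leibniz_cons]
      exact (antiSum_congr fun p q _ => ih q).trans (antiSum_const_zero m)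
  map_add' G G' := by
    induction κ using Multiset.induction_on generalizing G G' m with
    | empty => simp only [leibniz_nil]; exact partComp_add_left G G' K m
    | cons k κ ih =>
      simp only [leibniz_cons]
      rw [← antiSum_add]
      exact antiSum_congr fun p q _ => ih q (fun M => G (k p ::ₘ M)) (fun M => G' (k p ::ₘ M))

theorem leibniz_add_left (G G' : Multiset B → C) (κ : Multiset (Multiset D → B))
    (K : Multiset D → B) (m : Multiset D) :
    leibniz (fun M => G M + G' M) κ K m = leibniz G κ K m + leibniz G' κ K m :=
  map_add (leibnizHom κ K m) G G'

theorem leibniz_zero_left (κ : Multiset (Multiset D → B))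
    (K : Multiset D → B) (m : Multiset D) : leibniz (fun _ => (0 : C)) κ K m = 0 :=
  map_zero (leibnizHom κ K m)

theorem leibniz_antiSum_left {ι : Type*} (m' : Multiset ι)
    (G : Multiset ι → Multiset ι → Multiset B → C) (κ : Multiset (Multiset D → B))
    (K : Multiset D → B) (m : Multiset D) :
    leibniz (fun M => antiSum m' fun p q => G p q M) κ K m
      = antiSum m' fun p q => leibniz (G p q) κ K m := by
  rw [← leibnizHom_apply]
  have : (fun M => antiSum m' fun p q => G p q M) = antiSum m' G := by
    funext M
    exact (map_antiSum (Pi.evalAddMonoidHom (fun _ => C) M) m' G).symm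
  rw [this, map_antiSum]
  rfl

theorem map_leibniz {C' : Type*} [AddCommMonoid C'] (φ : C →+ C') (G : Multiset B → C)
    (κ : Multiset (Multiset D → B)) (K : Multiset D → B) (m : Multiset D) :
    φ (leibniz G κ K m) = leibniz (fun M => φ (G M)) κ K m := by
  induction κ using Multiset.induction_on generalizing G m with
  | empty => rw [leibniz_nil, leibniz_nil, map_partComp]
  | cons k κ ih =>
    rw [leibniz_cons, leibniz_cons, map_antiSum]
    exact antiSum_congr fun p q _ => ih _ _

theorem leibniz_map_left (h : A → B) (G : Multiset B → C) (κ : Multiset (Multiset D → A))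
    (K : Multiset D → A) (m : Multiset D) :
    leibniz (fun M => G (M.map h)) κ K m
      = leibniz G (κ.map fun k p => h (k p)) (fun p => h (K p)) m := by
  induction κ using Multiset.induction_on generalizing G m with
  | empty => rw [Multiset.map_zero, leibniz_nil, leibniz_nil, partComp_map_left]
  | cons k κ ih =>
    rw [Multiset.map_cons, leibniz_cons, leibniz_cons]
    refine antiSum_congr fun p q _ => ?_
    rw [← ih]
    simp only [Multiset.map_cons]

theorem leibniz_map_right (e : E → D) (G : Multiset B → C) (κ : Multiset (Multiset D → B))
    (K : Multiset D → B) (m : Multiset E) :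
    leibniz G (κ.map fun k p => k (p.map e)) (fun p => K (p.map e)) m
      = leibniz G κ K (m.map e) := by
  induction κ using Multiset.induction_on generalizing G m with
  | empty => rw [Multiset.map_zero, leibniz_nil, leibniz_nil, ← partComp_map_right]
  | cons k κ ih =>
    rw [Multiset.map_cons, leibniz_cons, leibniz_cons, antiSum_map]
    exact antiSum_congr fun p q _ => ih _ _

theorem leibniz_congr_right (G : Multiset B → C) (κ : Multiset (Multiset D → B))
    {K K' : Multiset D → B} (h : ∀ p, p ≠ 0 → K p = K' p) (m : Multiset D) :
    leibniz G κ K m = leibniz G κ K' m := by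
  induction κ using Multiset.induction_on generalizing G m with
  | empty => rw [leibniz_nil, leibniz_nil, partComp_congr_right G h]
  | cons k κ ih =>
    rw [leibniz_cons, leibniz_cons]
    exact antiSum_congr fun p q _ => ih _ _

theorem leibniz_congr_left {G G' : Multiset B → C} (κ : Multiset (Multiset D → B))
    (K : Multiset D → B) {m : Multiset D} (h : ∀ p, p ≠ 0 → G p = G' p) (hm : κ ≠ 0 ∨ m ≠ 0) :
    leibniz G κ K m = leibniz G' κ K m := by
  induction κ using Multiset.induction_on with
  | empty =>
    rw [leibniz_nil, leibniz_nil, partComp_congr_left K h (hm.resolve_left (not_not.2 rfl))]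
  | cons k κ ih =>
    rw [leibniz_cons, leibniz_cons]
    exact antiSum_congr fun p q _ => congrArg (fun G => leibniz G κ K q)
      (funext fun M => h _ Multiset.cons_ne_zero)

theorem leibniz_cons_add [AddCommMonoid B] {G : Multiset B → C} (hG : MultiAdditive G)
    (k k' : Multiset D → B) (κ : Multiset (Multiset D → B)) (K : Multiset D → B)
    (m : Multiset D) : leibniz G ((k + k') ::ₘ κ) K m
      = leibniz G (k ::ₘ κ) K m + leibniz G (k' ::ₘ κ) K m := by
  simp only [leibniz_cons, Pi.add_apply, hG.add, leibniz_add_left, antiSum_add]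

theorem leibniz_cons_zero [AddCommMonoid B] {G : Multiset B → C} (hG : MultiAdditive G)
    (κ : Multiset (Multiset D → B)) (K : Multiset D → B)
    (m : Multiset D) : leibniz G (0 ::ₘ κ) K m = 0 := by
  simp only [leibniz_cons, Pi.zero_apply, hG.zero, leibniz_zero_left, antiSum_const_zero]

theorem MultiAdditive.leibniz [AddCommMonoid B] [AddCommMonoid D] {G : Multiset B → C}
    (hG : MultiAdditive G) {κ : Multiset (Multiset D → B)} {K : Multiset D → B}
    (hκ : ∀ k ∈ κ, MultiAdditive k) (hK : MultiAdditive K) : MultiAdditive (leibniz G κ K) := by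
  induction κ using Multiset.induction_on generalizing G with
  | empty =>
    have : FaaDiBruno.leibniz G 0 K = FaaDiBruno.partComp G K := funext fun m => leibniz_nil G K m
    rw [this]
    exact hG.partComp hK
  | cons k κ ih =>
    have hk := hκ k (Multiset.mem_cons_self k κ)
    have ih' := fun b => ih (hG.cons b) fun k' hk' => hκ k' (Multiset.mem_cons_of_mem hk')
    constructor
    · intro a b m
      simp only [leibniz_cons, antiSum_cons, (ih' _).add, hk.add, hG.add, leibniz_add_left,
        antiSum_add]
      abel
    · intro m
      simp only [leibniz_cons, antiSum_cons, (ih' _).zero, hk.zero, hG.zero, leibniz_zero_left,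
        antiSum_const_zero, add_zero]

/-- The product rule for `leibniz`: the factors and the directions are both distributed. -/
theorem leibniz_antiSum (Ψ : Multiset B → Multiset B → C) (κ : Multiset (Multiset D → B))
    (K : Multiset D → B) (m : Multiset D) :
    leibniz (fun M => antiSum M Ψ) κ K m
      = antiSum κ fun κ₁ κ₂ => antiSum m fun p q =>
          leibniz (fun P => leibniz (Ψ P) κ₂ K q) κ₁ K p := by
  induction κ using Multiset.induction_on generalizing Ψ m with
  | empty => simp only [leibniz_nil, antiSum_zero, partComp_antiSum]
  | cons k κ ih =>
    rw [antiSum_cons, antiSum_swap κ m, antiSum_swap κ m]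
    simp only [leibniz_cons, antiSum_cons, leibniz_antiSum_left, leibniz_add_left, ih,
      antiSum_add]
    refine congrArg₂ _ ?_ ?_
    · simp only [antiSum_swap κ]
      exact antiSum_left_comm m _
    · simp only [antiSum_swap κ]
      exact (antiSum_assoc m _).symm

end Leibniz

/-! ### The chain rule -/

section LeibnizComp

variable {A B C D E : Type*} [AddCommMonoid B] [AddCommMonoid C]

/-- Leibniz' rule for a composite over partitions: each block of a partition of the factors is
differentiated by Leibniz' rule. -/
theorem leibniz_partComp {G : Multiset B → C} (hG : MultiAdditive G) (F : Multiset A → B)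
    (κ : Multiset (Multiset D → A)) (K : Multiset D → A) (m : Multiset D) :
    leibniz (partComp G F) κ K m
      = partComp (fun κ' => leibniz G κ' (partComp F K) m) (fun κ' => leibniz F κ' K) κ := by
  induction κ using Multiset.strongInductionOn generalizing G m with
  | ih κ ih =>
    induction κ using Multiset.induction_on with
    | empty => rw [leibniz_nil, partComp_zero, leibniz_nil, partComp_assoc G F K hG.add hG.zero]
    | cons k κ _ =>
      rw [leibniz_cons, partComp_cons]
      simp only [partComp_cons, leibniz_antiSum, leibniz_cons, partComp_antiSum_left]
      rw [antiSum_swap m κ]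
      refine antiSum_congr fun κ₁ κ₂ hκ => ?_
      rw [← antiSum_assoc m fun p₁ p₂ q => leibniz (fun P => leibniz (fun M =>
        partComp (fun N => G (F (k p₁ ::ₘ P) ::ₘ N)) F M) κ₂ K q) κ₁ K p₂]
      refine antiSum_congr fun p q _ => ?_
      -- both sides are the value at `leibniz F (k ::ₘ κ₁) K p` of one additive map
      let Θ : B →+ C := (partCompHom (fun κ' => leibniz F κ' K) κ₂).comp
        ((AddMonoidHom.pi fun κ' => leibnizHom κ' (partComp F K) q).comp hG.argHom)
      have hΘ : ∀ b, Θ b = partComp (fun κ' => leibniz (fun M => G (b ::ₘ M)) κ' (partComp F K) q)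
        (fun κ' => leibniz F κ' K) κ₂ := fun b => rfl
      refine Eq.trans ?_ (hΘ _)
      rw [map_antiSum]
      refine antiSum_congr fun p₁ p₂ _ => ?_
      rw [map_leibniz]
      congr 1
      funext P
      rw [hΘ, ← ih κ₂ (lt_cons_of_add_eq hκ) (hG.cons _)]

/-- The chain rule for iterated derivatives. The directions `μ` are themselves functions of further
directions `m`, in which the whole expression is differentiated. The induction on the factors rests
on the product rule; the case of no factors is `leibniz_partComp`. -/
theorem leibniz_leibniz {G : Multiset B → C} (hG : MultiAdditive G)
    (κ : Multiset (Multiset A → B)) (K : Multiset A → B) (μ : Multiset (Multiset D → A))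
    (Y : Multiset D → A) (m : Multiset D) :
    leibniz (leibniz G κ K) μ Y m
      = leibniz (fun ν => leibniz G ν (partComp K Y) m) (κ.map fun k μ' => leibniz k μ' Y)
          (fun μ' => leibniz K μ' Y) μ := by
  induction κ using Multiset.induction_on generalizing G μ m with
  | empty =>
    rw [Multiset.map_zero, leibniz_nil, ← leibniz_partComp hG]
    congr 1
  | cons k κ ih =>
    have h1 : leibniz G (k ::ₘ κ) K
        = fun M => antiSum M fun P Q => leibniz (fun N => G (k P ::ₘ N)) κ K Q :=
      funext fun M => leibniz_cons G k κ K M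
    rw [Multiset.map_cons, leibniz_cons, h1, leibniz_antiSum]
    refine antiSum_congr fun μ₁ μ₂ _ => ?_
    simp only [leibniz_cons, leibniz_antiSum_left]
    refine antiSum_congr fun p q _ => ?_
    -- both sides are the value at `leibniz k μ₁ Y p` of one additive map
    let Θ : B →+ C := (leibnizHom (κ.map fun k μ' => leibniz k μ' Y)
        (fun μ' => leibniz K μ' Y) μ₂).comp
      ((AddMonoidHom.pi fun ν => leibnizHom ν (partComp K Y) q).comp hG.argHom)
    have hΘ : ∀ b, Θ b = leibniz (fun ν => leibniz (fun M => G (b ::ₘ M)) ν (partComp K Y) q)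
        (κ.map fun k μ' => leibniz k μ' Y) (fun μ' => leibniz K μ' Y) μ₂ := fun b => rfl
    refine Eq.trans ?_ (hΘ _)
    rw [map_leibniz]
    congr 1
    funext P
    rw [hΘ, ← ih (hG.cons _)]

/-- Leibniz' rule is compatible with substitution: the chain rule `leibniz_leibniz` without outer
directions. -/
theorem partComp_leibniz {G : Multiset B → C} (hG : MultiAdditive G)
    (κ : Multiset (Multiset A → B)) (K : Multiset A → B) (Y : Multiset D → A) (m : Multiset D) :
    partComp (leibniz G κ K) Y m
      = leibniz G (κ.map fun k => partComp k Y) (partComp K Y) m := by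
  have h := leibniz_leibniz hG κ K 0 Y m
  rw [leibniz_nil, leibniz_zero, Multiset.map_map] at h
  rw [h]
  congr 1

end LeibnizComp

/-! ### Functions concentrated in low degree -/

section Linear

variable {B C D : Type*} [AddCommMonoid C]

/-- If `G` vanishes on more than `n` arguments, the factors must be at most `n`. -/
theorem leibniz_eq_zero_of_card {G : Multiset B → C} {n : ℕ}
    (hG : ∀ M, n < Multiset.card M → G M = 0) {κ : Multiset (Multiset D → B)}
    (hκ : n < Multiset.card κ) (K : Multiset D → B) (m : Multiset D) : leibniz G κ K m = 0 := by
  induction κ using Multiset.induction_on generalizing G n m with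
  | empty => simp at hκ
  | cons k κ ih =>
    rw [leibniz_cons, ← antiSum_const_zero m]
    refine antiSum_congr fun p q _ => ?_
    rcases Nat.eq_zero_or_pos n with rfl | hn
    · have : (fun M => G (k p ::ₘ M)) = fun _ => 0 := funext fun M => hG _ (by simp)
      rw [this, leibniz_zero_left]
    · refine ih (n := n - 1) (fun M hM => hG _ ?_) ?_ q
      · rw [Multiset.card_cons]
        omega
      · rw [Multiset.card_cons] at hκ
        omega

/-- The derivative of a single linear factor. -/
theorem leibniz_singleton_of_linear {G : Multiset B → C}
    (hG : ∀ M, 1 < Multiset.card M → G M = 0) (k : Multiset D → B)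
    (K : Multiset D → B) (m : Multiset D) : leibniz G {k} K m = G {k m} := by
  rw [← Multiset.cons_zero, leibniz_cons]
  have h : ∀ p q, q ≠ 0 → leibniz (fun M => G (k p ::ₘ M)) 0 K q = 0 := by
    intro p q hq
    rw [leibniz_nil, partComp_congr_left (G' := fun _ => 0) K _ hq, partComp_zero_left]
    intro M hM
    refine hG _ ?_
    rw [Multiset.card_cons]
    have := Multiset.card_pos.2 hM
    omega
  rw [antiSum_eq_left h, leibniz_zero]
  rfl

end Linear

/-! ### Morphisms given by their values on multisets -/

section OfEval

variable {C : Type u} [Category.{v} C] [CartesianMonoidalCategory C]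

theorem FaaHom.multiAdditive_eval {P Q : FaaObj C} (f : P ⟶ Q) {T : C} (x : T ⟶ P.pt) :
    MultiAdditive (FaaHom.eval f x) :=
  ⟨FaaHom.eval_add f x, FaaHom.eval_zero f x⟩

theorem exists_map_update_eq_cons {A ι : Type*} [Fintype ι] [DecidableEq ι] (a : ι → A) (i : ι) :
    ∃ m : Multiset A, ∀ z, Finset.univ.val.map (Function.update a i z) = z ::ₘ m := by
  refine ⟨(Finset.univ.erase i).val.map a, fun z => ?_⟩
  have h1 : (Finset.univ : Finset ι).val = i ::ₘ (Finset.univ.erase i).val := by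
    rw [Finset.erase_val, Multiset.cons_erase (Finset.mem_univ i)]
  rw [h1, Multiset.map_cons, Function.update_self]
  congr 1
  refine Multiset.map_congr rfl fun k hk => Function.update_of_ne ?_ _ _
  rintro rfl
  exact absurd hk (Finset.notMem_erase k _)

theorem powLift_comp_of_natural {P Q : FaaObj C}
    (E : ∀ {T : C}, (T ⟶ P.pt) → Multiset (T ⟶ P.vec.X) → (T ⟶ Q.vec.X))
    (hnat : ∀ {S T : C} (s : S ⟶ T) (x : T ⟶ P.pt) (m : Multiset (T ⟶ P.vec.X)),
      s ≫ E x m = E (s ≫ x) (m.map (s ≫ ·)))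
    {T : C} (n : ℕ) (a : Fin n → (T ⟶ P.vec.X)) (x : T ⟶ P.pt) :
    powLift n a x ≫ E (powBase P.vec.X P.pt n) (Finset.univ.val.map (powProj P.vec.X P.pt n))
      = E x (Finset.univ.val.map a) := by
  rw [hnat, powLift_base, Multiset.map_map]
  congr 1
  refine Multiset.map_congr rfl fun i _ => ?_
  exact powLift_proj n a x i

variable {P Q : FaaObj C} (h : P.pt ⟶ Q.pt)
    (E : ∀ {T : C}, (T ⟶ P.pt) → Multiset (T ⟶ P.vec.X) → (T ⟶ Q.vec.X))
    (hE : ∀ {T : C} (x : T ⟶ P.pt), MultiAdditive (E x))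
    (hnat : ∀ {S T : C} (s : S ⟶ T) (x : T ⟶ P.pt) (m : Multiset (T ⟶ P.vec.X)),
      s ≫ E x m = E (s ≫ x) (m.map (s ≫ ·)))

/-- The morphism of `Faà(C)` given by a natural family of multiadditive functions on multisets of
generalized elements. The values of `E` on the empty multiset are not used. -/
def FaaHom.ofEval : P ⟶ Q :=
  { star := h
    der := fun n => E (powBase P.vec.X P.pt (n + 1))
      (Finset.univ.val.map (powProj P.vec.X P.pt (n + 1)))
    symm := by
      intro n T a x σ
      rw [powLift_comp_of_natural E hnat, powLift_comp_of_natural E hnat, ← Multiset.map_map]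
      congr 2
      have := congrArg Finset.val (Finset.map_univ_equiv σ)
      rwa [Finset.map_val] at this
    add := by
      intro n T a x i b c
      obtain ⟨m, hm⟩ := exists_map_update_eq_cons a i
      rw [powLift_comp_of_natural E hnat, powLift_comp_of_natural E hnat,
        powLift_comp_of_natural E hnat, hm, hm, hm, (hE x).add]
    zero := by
      intro n T a x i
      obtain ⟨m, hm⟩ := exists_map_update_eq_cons a i
      rw [powLift_comp_of_natural E hnat, hm, (hE x).zero] }

theorem FaaHom.eval_ofEval {T : C} (x : T ⟶ P.pt) {m : Multiset (T ⟶ P.vec.X)} (hm : m ≠ 0) :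
    FaaHom.eval (FaaHom.ofEval h E hE hnat) x m = E x m := by
  rcases FaaHom.exists_fn_of_multiset m with rfl | ⟨n, a, rfl⟩
  · exact absurd rfl hm
  · rw [FaaHom.eval_ofFn]
    exact powLift_comp_of_natural E hnat (n + 1) a x

end OfEval

/-! ### Generalized elements of `((A, +, 0), A)` -/

section Full

variable {C : Type u} [Category.{v} C] [CartesianMonoidalCategory C]

/-- The value of `u = (u_*, u_1, u_2, …) : T ⟶ ((A, +, 0), A)` on a possibly empty multiset of
directions: since `u_*` and all the `u_n` have the same codomain `A`, the map `u_*` can be treated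
as the value on no directions. -/
def full {T : FaaObj C} {A : CMon C} (u : T ⟶ (linMon A).X) {S : C} (t : S ⟶ T.pt)
    (m : Multiset (S ⟶ T.vec.X)) : S ⟶ A.X :=
  if Multiset.card m = 0 then t ≫ FaaHom.star (P := T) (Q := linObj A) u
    else FaaHom.eval (P := T) (Q := linObj A) u t m

variable {T T' : FaaObj C} {A : CMon C} (u w : T ⟶ (linMon A).X) {S S' : C} (t : S ⟶ T.pt)

theorem full_nil : full u t 0 = t ≫ FaaHom.star (P := T) (Q := linObj A) u := rfl

theorem full_of_ne {m : Multiset (S ⟶ T.vec.X)} (hm : m ≠ 0) :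
    full u t m = FaaHom.eval (P := T) (Q := linObj A) u t m :=
  if_neg fun h => hm (Multiset.card_eq_zero.1 h)

variable {u w} in
theorem full_ext (h : ∀ {S : C} (t : S ⟶ T.pt) (m : Multiset (S ⟶ T.vec.X)),
    full u t m = full w t m) : u = w := by
  refine FaaObj.hom_ext (P := T) (Q := linObj A) ?_ fun S t m => ?_
  · have := h (𝟙 _) 0
    rw [full_nil, full_nil] at this
    exact (Category.id_comp _).symm.trans (this.trans (Category.id_comp _))
  · by_cases hm : m = 0
    · subst hm
      rfl
    · exact (full_of_ne u t hm).symm.trans ((h t m).trans (full_of_ne w t hm))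

theorem comp_full (s : S' ⟶ S) (m : Multiset (S ⟶ T.vec.X)) :
    s ≫ full u t m = full u (s ≫ t) (m.map (s ≫ ·)) := by
  by_cases hm : m = 0
  · subst hm
    exact (Category.assoc _ _ _).symm
  · rw [full_of_ne u t hm, full_of_ne u _ (by simpa using hm)]
    exact FaaHom.comp_eval (P := T) (Q := linObj A) u s t m

theorem full_comp (w : T' ⟶ T) (t : S ⟶ T'.pt) (m : Multiset (S ⟶ T'.vec.X)) :
    full (w ≫ u) t m = partComp (full u (t ≫ FaaHom.star w)) (FaaHom.eval w t) m := by
  by_cases hm : m = 0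
  · subst hm
    rw [partComp_zero]
    exact (Category.assoc _ _ _).symm
  · rw [full_of_ne _ _ hm, partComp_congr_left _ (fun p hp => full_of_ne u _ hp) hm]
    exact FaaHom.eval_comp (R := linObj A) w u t m

theorem full_add (m : Multiset (S ⟶ T.vec.X)) : full (u + w) t m = full u t m + full w t m := by
  by_cases hm : m = 0
  · subst hm
    rw [full_nil, full_nil, full_nil]
    exact (congrArg (t ≫ ·) (star_lift_linAdd A u w)).trans (CMon.comp_add _ _ _)
  · rw [full_of_ne _ _ hm, full_of_ne _ _ hm, full_of_ne _ _ hm]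
    exact eval_lift_linAdd A u w t m

theorem full_zero (m : Multiset (S ⟶ T.vec.X)) : full (0 : T ⟶ (linMon A).X) t m = 0 := by
  by_cases hm : m = 0
  · subst hm
    rw [full_nil]
    exact (congrArg (t ≫ ·) (star_linZero A T)).trans (CMon.comp_zero _)
  · rw [full_of_ne _ _ hm]
    exact eval_linZero A t m

/-- Evaluation at `t` and `m`, as an additive map. -/
@[simps] def fullHom (A : CMon C) (t : S ⟶ T.pt) (m : Multiset (S ⟶ T.vec.X)) :
    (T ⟶ (linMon A).X) →+ (S ⟶ A.X) where
  toFun u := full u t m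
  map_zero' := full_zero t m
  map_add' u w := full_add u w t m

theorem multiAdditive_full : MultiAdditive (full u t) where
  add a b m := by
    rw [full_of_ne _ _ Multiset.cons_ne_zero, full_of_ne _ _ Multiset.cons_ne_zero,
      full_of_ne _ _ Multiset.cons_ne_zero]
    exact FaaHom.eval_add (P := T) (Q := linObj A) u t a b m
  zero m := by
    rw [full_of_ne _ _ Multiset.cons_ne_zero]
    exact FaaHom.eval_zero (P := T) (Q := linObj A) u t m

end Full

/-! ### The comultiplication on morphisms -/

section Derivative

variable {C : Type u} [Category.{v} C] [CartesianMonoidalCategory C]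
variable {P Q : FaaObj C}

/-- Composition with a morphism, as an additive map on generalized elements. -/
@[simps] def compHom (A : CMon C) {S T : C} (s : S ⟶ T) : (T ⟶ A.X) →+ (S ⟶ A.X) where
  toFun f := s ≫ f
  map_zero' := CMon.comp_zero s
  map_add' := CMon.comp_add s

/-- Precomposition of an expression in Leibniz' rule. -/
theorem comp_leibniz_eval (f : P ⟶ Q) {S S' : C} (s : S' ⟶ S) {D : Type*} (x : S ⟶ P.pt)
    (κ : Multiset (Multiset D → (S ⟶ P.vec.X))) (K : Multiset D → (S ⟶ P.vec.X))
    (m : Multiset D) :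
    s ≫ leibniz (FaaHom.eval f x) κ K m
      = leibniz (FaaHom.eval f (s ≫ x)) (κ.map fun k p => s ≫ k p) (fun p => s ≫ K p) m := by
  rw [← leibniz_map_left (s ≫ ·)]
  refine (map_leibniz (compHom Q.vec s) _ κ K m).trans ?_
  congr 1
  funext M
  exact FaaHom.comp_eval f s x M

variable {T T' : FaaObj C}

theorem multiAdditive_leibniz_full (f : P ⟶ Q) (z : T ⟶ P) (us : Multiset (T ⟶ (linMon P.vec).X))
    {S : C} (t : S ⟶ T.pt) : MultiAdditive (leibniz (FaaHom.eval f (t ≫ FaaHom.star z))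
      (us.map fun u => full u t) (FaaHom.eval z t)) :=
  (FaaHom.multiAdditive_eval f _).leibniz
    (by
      intro k hk
      obtain ⟨u, -, rfl⟩ := Multiset.mem_map.1 hk
      exact multiAdditive_full u t)
    (FaaHom.multiAdditive_eval z t)

theorem comp_leibniz_full (f : P ⟶ Q) (z : T ⟶ P) (us : Multiset (T ⟶ (linMon P.vec).X))
    {S S' : C} (s : S' ⟶ S) (t : S ⟶ T.pt) (m : Multiset (S ⟶ T.vec.X)) :
    s ≫ leibniz (FaaHom.eval f (t ≫ FaaHom.star z)) (us.map fun u => full u t)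
        (FaaHom.eval z t) m
      = leibniz (FaaHom.eval f ((s ≫ t) ≫ FaaHom.star z)) (us.map fun u => full u (s ≫ t))
        (FaaHom.eval z (s ≫ t)) (m.map (s ≫ ·)) := by
  rw [comp_leibniz_eval, ← leibniz_map_right, Multiset.map_map, Multiset.map_map, Category.assoc]
  congr 1
  · refine Multiset.map_congr rfl fun u _ => funext fun p => ?_
    exact comp_full u t s p
  · funext p
    exact FaaHom.comp_eval z s t p

/-- For `f = (f_*, f_1, f_2, …) : ((A, +, 0), X) ⟶ ((B, +, 0), Y)`, a generalized element `z` of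
`((A, +, 0), X)` and generalized elements `u_1, …, u_r` of `((A, +, 0), A)` in `Faà(C)`, the
generalized element `f_r(u_1, …, u_r, z)` of `((B, +, 0), B)`, whose higher components are given by
the rules of differentiation. -/
def derEval (f : P ⟶ Q) (z : T ⟶ P) (us : Multiset (T ⟶ (linMon P.vec).X)) :
    T ⟶ (linMon Q.vec).X :=
  FaaHom.ofEval (P := T) (Q := linObj Q.vec)
    (FaaHom.eval f (FaaHom.star z) (us.map fun u => FaaHom.star (P := T) (Q := linObj P.vec) u))
    (fun {_} t m => leibniz (FaaHom.eval f (t ≫ FaaHom.star z)) (us.map fun u => full u t)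
      (FaaHom.eval z t) m)
    (fun t => multiAdditive_leibniz_full f z us t) (fun s t m => comp_leibniz_full f z us s t m)

theorem full_derEval (f : P ⟶ Q) (z : T ⟶ P) (us : Multiset (T ⟶ (linMon P.vec).X)) {S : C}
    (t : S ⟶ T.pt) (m : Multiset (S ⟶ T.vec.X)) :
    full (derEval f z us) t m = leibniz (FaaHom.eval f (t ≫ FaaHom.star z))
      (us.map fun u => full u t) (FaaHom.eval z t) m := by
  by_cases hm : m = 0
  · subst hm
    rw [leibniz_zero, Multiset.map_map]
    refine (FaaHom.comp_eval f t _ _).trans ?_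
    exact congrArg (FaaHom.eval f _) (Multiset.map_map _ _ _)
  · rw [full_of_ne _ _ hm]
    exact FaaHom.eval_ofEval (P := T) (Q := linObj Q.vec) _ _
      (multiAdditive_leibniz_full f z us) (comp_leibniz_full f z us) t hm

theorem comp_derEval (f : P ⟶ Q) (w : T' ⟶ T) (z : T ⟶ P)
    (us : Multiset (T ⟶ (linMon P.vec).X)) :
    w ≫ derEval f z us = derEval f (w ≫ z) (us.map (w ≫ ·)) := by
  refine full_ext fun {S} t m => ?_
  rw [full_comp, full_derEval, Multiset.map_map]
  have h1 : full (derEval f z us) (t ≫ FaaHom.star w)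
      = leibniz (FaaHom.eval f ((t ≫ FaaHom.star w) ≫ FaaHom.star z))
        (us.map fun u => full u (t ≫ FaaHom.star w)) (FaaHom.eval z (t ≫ FaaHom.star w)) :=
    funext fun m => full_derEval f z us _ m
  rw [h1, partComp_leibniz (FaaHom.multiAdditive_eval f _), Multiset.map_map, FaaObj.comp_star,
    Category.assoc]
  congr 1
  · refine Multiset.map_congr rfl fun u _ => funext fun p => ?_
    exact (full_comp u w t p).symm
  · exact funext fun p => (FaaHom.eval_comp w z t p).symm

theorem multiAdditive_derEval (f : P ⟶ Q) (z : T ⟶ P) : MultiAdditive (derEval f z) where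
  add a b m := by
    refine full_ext fun {S} t n => ?_
    rw [full_add, full_derEval, full_derEval, full_derEval, Multiset.map_cons, Multiset.map_cons,
      Multiset.map_cons, ← leibniz_cons_add (FaaHom.multiAdditive_eval f _)]
    congr 2
    exact funext fun p => full_add a b t p
  zero m := by
    refine full_ext fun {S} t n => ?_
    rw [full_zero, full_derEval, Multiset.map_cons,
      ← leibniz_cons_zero (FaaHom.multiAdditive_eval f (t ≫ FaaHom.star z))]
    congr 2
    exact funext fun p => full_zero t p

/-- The value of the comultiplication at the morphism `f`: its component `_*` is `f`, and its
higher components are the derivatives `derEval f`. -/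
def comultMap (f : P ⟶ Q) : comultObj P ⟶ comultObj Q :=
  FaaHom.ofEval (P := comultObj P) (Q := comultObj Q) f (fun {_} z us => derEval f z us)
    (fun z => multiAdditive_derEval f z) (fun w z us => comp_derEval f w z us)

/-- The value of a morphism between objects in the image of the comultiplication, as a generalized
element of `((B, +, 0), B)`. -/
def comultEval (g : comultObj P ⟶ comultObj Q) (z : T ⟶ P)
    (us : Multiset (T ⟶ (linMon P.vec).X)) : T ⟶ (linMon Q.vec).X :=
  FaaHom.eval (P := comultObj P) (Q := comultObj Q) g z us

theorem comultObj_hom_ext {g g' : comultObj P ⟶ comultObj Q}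
    (hs : FaaHom.star g = FaaHom.star g')
    (h : ∀ {T : FaaObj C} (z : T ⟶ P) (us : Multiset (T ⟶ (linMon P.vec).X)), us ≠ 0 →
      comultEval g z us = comultEval g' z us) : g = g' := by
  refine FaaObj.hom_ext (P := comultObj P) (Q := comultObj Q) hs fun T z us => ?_
  by_cases hus : us = 0
  · subst hus
    rfl
  · exact h z us hus

theorem comultEval_comultMap (f : P ⟶ Q) (z : T ⟶ P) {us : Multiset (T ⟶ (linMon P.vec).X)}
    (hus : us ≠ 0) : comultEval (comultMap f) z us = derEval f z us :=
  FaaHom.eval_ofEval (P := comultObj P) (Q := comultObj Q) _ _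
    (multiAdditive_derEval f) (comp_derEval f) z hus

end Derivative

/-! ### The comultiplication as a functor -/

section ComultFunctor

variable {C : Type u} [Category.{v} C] [CartesianMonoidalCategory C]
variable {P Q R : FaaObj C}

/-- Functoriality of the comultiplication: `leibniz_partComp` on generalized elements. -/
theorem comultMap_comp (f : P ⟶ Q) (g : Q ⟶ R) :
    comultMap (f ≫ g) = comultMap f ≫ comultMap g := by
  refine comultObj_hom_ext rfl fun {T} z us hus => ?_
  rw [comultEval_comultMap _ z hus]
  refine full_ext fun {S} t m => ?_
  have h0 : comultEval (comultMap f ≫ comultMap g) z us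
      = partComp (comultEval (comultMap g) (z ≫ f)) (comultEval (comultMap f) z) us :=
    FaaHom.eval_comp (comultMap f) (comultMap g) z us
  have h1 : full (partComp (comultEval (comultMap g) (z ≫ f)) (comultEval (comultMap f) z) us) t m
      = partComp (fun M => full (comultEval (comultMap g) (z ≫ f) M) t m)
        (comultEval (comultMap f) z) us := map_partComp (fullHom R.vec t m) _ _ _
  have h2 : ∀ M, M ≠ 0 → full (comultEval (comultMap g) (z ≫ f) M) t m
      = leibniz (FaaHom.eval g (t ≫ FaaHom.star (z ≫ f)))
        (M.map fun u => full u t) (FaaHom.eval (z ≫ f) t) m := by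
    intro M hM
    rw [comultEval_comultMap g _ hM, full_derEval]
  have h3 : (fun us => full (derEval f z us) t) = fun us => leibniz
      (FaaHom.eval f (t ≫ FaaHom.star z)) (us.map fun u => full u t) (FaaHom.eval z t) :=
    funext fun us => funext fun m => full_derEval f z us t m
  have h4 : FaaHom.eval (z ≫ f) t
      = partComp (FaaHom.eval f (t ≫ FaaHom.star z)) (FaaHom.eval z t) :=
    funext fun m => FaaHom.eval_comp z f t m
  have h5 : FaaHom.eval (f ≫ g) (t ≫ FaaHom.star z)
      = partComp (FaaHom.eval g ((t ≫ FaaHom.star z) ≫ FaaHom.star f))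
        (FaaHom.eval f (t ≫ FaaHom.star z)) :=
    funext fun m => FaaHom.eval_comp f g _ m
  rw [h0, h1, partComp_congr_left _ h2 hus,
    partComp_congr_right _ (fun M hM => comultEval_comultMap f z hM),
    partComp_map_left (fun u : T ⟶ (linMon Q.vec).X => full u t)
      (fun κ => leibniz (FaaHom.eval g (t ≫ FaaHom.star (z ≫ f))) κ (FaaHom.eval (z ≫ f) t) m),
    h3, partComp_map_right (fun u : T ⟶ (linMon P.vec).X => full u t) _ (fun κ =>
    leibniz (FaaHom.eval f (t ≫ FaaHom.star z)) κ (FaaHom.eval z t)), full_derEval, h4, h5,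
    leibniz_partComp (FaaHom.multiAdditive_eval g _), Category.assoc, FaaObj.comp_star]

theorem full_comp_lin {A B : CMon C} {k : A.X ⟶ B.X} (hk : CMon.IsAdditive k) {T : FaaObj C}
    (u : T ⟶ (linMon A).X) {S : C} (t : S ⟶ T.pt) (m : Multiset (S ⟶ T.vec.X)) :
    full (A := B) (u ≫ FaaObj.lin (P := linObj A) (Q := linObj B) k k hk) t m = full u t m ≫ k := by
  by_cases hm : m = 0
  · subst hm
    exact (Category.assoc _ _ _).symm
  · rw [full_of_ne _ _ hm, full_of_ne _ _ hm]
    exact FaaObj.eval_comp_lin (Q := linObj A) (R := linObj B) u k k hk t m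

/-- An additive map `A ⟶ B` induces an additive map `((A, +, 0), A) ⟶ ((B, +, 0), B)`. -/
theorem isAdditive_lin {A B : CMon C} {k : A.X ⟶ B.X} (hk : CMon.IsAdditive k) :
    CMon.IsAdditive (A := linMon A) (B := linMon B)
      (FaaObj.lin (P := linObj A) (Q := linObj B) k k hk) := by
  refine ⟨fun {T} f g => full_ext fun {S} t m => ?_, fun T => full_ext fun {S} t m => ?_⟩
  · rw [full_add]
    refine (full_comp_lin hk (f + g) t m).trans ?_
    rw [full_add, hk.map_add]
    exact (congrArg₂ (fun a b : S ⟶ B.X => a + b) (full_comp_lin hk f t m)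
      (full_comp_lin hk g t m)).symm
  · rw [full_zero]
    refine (full_comp_lin hk 0 t m).trans ?_
    rw [full_zero, hk.map_zero]

/-- The comultiplication sends a linear map to a linear map. -/
theorem comultMap_lin (h : P.pt ⟶ Q.pt) (k : P.vec.X ⟶ Q.vec.X)
    (hk : CMon.IsAdditive (A := P.vec) (B := Q.vec) k) :
    comultMap (FaaObj.lin (P := P) (Q := Q) h k hk)
      = FaaObj.lin (P := comultObj P) (Q := comultObj Q) (FaaObj.lin (P := P) (Q := Q) h k hk)
        (FaaObj.lin (P := linObj P.vec) (Q := linObj Q.vec) k k hk) (isAdditive_lin hk) := by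
  refine comultObj_hom_ext rfl fun {T} z us hus => ?_
  rw [comultEval_comultMap _ z hus]
  refine full_ext fun {S} t m => ?_
  rw [full_derEval]
  by_cases hc : Multiset.card us = 1
  · obtain ⟨u, rfl⟩ := Multiset.card_eq_one.1 hc
    refine Eq.trans ?_ (congrArg (fun w : T ⟶ (linMon Q.vec).X => full w t m)
      (FaaHom.lin_eval_singleton (P := comultObj P) (Q := comultObj Q) _ _ _ z u)).symm
    refine Eq.trans ?_ (full_comp_lin hk u t m).symm
    rw [Multiset.map_singleton, leibniz_singleton_of_linear]
    · exact FaaHom.lin_eval_singleton h k hk _ _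
    · intro M hM
      exact FaaHom.lin_eval_of_card h k hk _ M (by omega)
  · refine Eq.trans ?_ (congrArg (fun w : T ⟶ (linMon Q.vec).X => full w t m)
      (FaaHom.lin_eval_of_card (P := comultObj P) (Q := comultObj Q) _ _ _ z us hc)).symm
    refine Eq.trans ?_ (full_zero (T := T) (A := Q.vec) t m).symm
    refine leibniz_eq_zero_of_card (n := 1) (fun M hM => ?_) ?_ _ _
    · exact FaaHom.lin_eval_of_card h k hk _ M (by omega)
    · rw [Multiset.card_map]
      have := Multiset.card_pos.2 hus
      omega

/-- Both monoids have the underlying object `((A × B, +, 0), A × B)`, and the projections from it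
are additive for both structures. -/
theorem linMon_prod (A B : CMon C) : linMon (A.prod B) = (linMon A).prod (linMon B) := by
  have h1 := isAdditive_lin (CMon.isAdditive_fst A B)
  have h2 := isAdditive_lin (CMon.isAdditive_snd A B)
  refine CMon.eq_of_isAdditive (A := linMon (A.prod B)) (B := (linMon A).prod (linMon B)) rfl
    ⟨fun {T} f g => ?_, fun T => ?_⟩
  · refine (Category.comp_id _).trans (Eq.trans ?_ (congrArg₂
      (fun a b : T ⟶ ((linMon A).prod (linMon B)).X => a + b)
      (Category.comp_id f).symm (Category.comp_id g).symm))
    refine CMon.prod_hom_ext (A := linMon A) (B := linMon B) ?_ ?_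
    · exact (h1.map_add f g).trans
        ((CMon.isAdditive_fst (linMon A) (linMon B)).map_add f g).symm
    · exact (h2.map_add f g).trans
        ((CMon.isAdditive_snd (linMon A) (linMon B)).map_add f g).symm
  · refine (Category.comp_id _).trans ?_
    refine CMon.prod_hom_ext (A := linMon A) (B := linMon B) ?_ ?_
    · exact (h1.map_zero T).trans
        ((CMon.isAdditive_fst (linMon A) (linMon B)).map_zero T).symm
    · exact (h2.map_zero T).trans
        ((CMon.isAdditive_snd (linMon A) (linMon B)).map_zero T).symm

theorem linMon_unit : linMon (CMon.unit C) = CMon.unit (FaaObj C) :=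
  CMon.eq_of_isAdditive (A := linMon (CMon.unit C)) (B := CMon.unit (FaaObj C)) rfl
    ⟨fun _ _ => toUnit_unique _ _, fun _ => toUnit_unique _ _⟩

theorem comultObj_prod (P Q : FaaObj C) : comultObj (P ⊗ Q) = comultObj P ⊗ comultObj Q :=
  FaaObj.ext_vec (linMon_prod P.vec Q.vec) rfl

theorem comultMap_fst (P Q : FaaObj C) :
    comultMap (fst P Q) = eqToHom (comultObj_prod P Q) ≫ fst (comultObj P) (comultObj Q) := by
  refine (comultMap_lin (P := P ⊗ Q) (Q := P) (fst P.pt Q.pt) (CMon.prodFst P.vec Q.vec)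
    (CMon.isAdditive_fst _ _)).trans ?_
  have e := FaaObj.eqToHom_eq (P := comultObj (P ⊗ Q)) (Q := (comultObj P).prod (comultObj Q))
    (comultObj_prod P Q) rfl rfl
  refine Eq.trans ?_ (congrArg (· ≫ FaaObj.prodFst (comultObj P) (comultObj Q)) e).symm
  refine Eq.trans ?_ (FaaObj.lin_comp_lin _ _ _ _ _ _ ?_).symm
  · refine FaaObj.lin_congr ?_ ?_ _ _
    · exact (Category.id_comp _).symm
    · exact (Category.id_comp _).symm
  · refine Eq.mpr (congrArg _ (Category.id_comp _)) ?_
    exact isAdditive_lin (CMon.isAdditive_fst P.vec Q.vec)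

theorem comultMap_snd (P Q : FaaObj C) :
    comultMap (snd P Q) = eqToHom (comultObj_prod P Q) ≫ snd (comultObj P) (comultObj Q) := by
  refine (comultMap_lin (P := P ⊗ Q) (Q := Q) (snd P.pt Q.pt) (CMon.prodSnd P.vec Q.vec)
    (CMon.isAdditive_snd _ _)).trans ?_
  have e := FaaObj.eqToHom_eq (P := comultObj (P ⊗ Q)) (Q := (comultObj P).prod (comultObj Q))
    (comultObj_prod P Q) rfl rfl
  refine Eq.trans ?_ (congrArg (· ≫ FaaObj.prodSnd (comultObj P) (comultObj Q)) e).symm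
  refine Eq.trans ?_ (FaaObj.lin_comp_lin _ _ _ _ _ _ ?_).symm
  · refine FaaObj.lin_congr ?_ ?_ _ _
    · exact (Category.id_comp _).symm
    · exact (Category.id_comp _).symm
  · refine Eq.mpr (congrArg _ (Category.id_comp _)) ?_
    exact isAdditive_lin (CMon.isAdditive_snd P.vec Q.vec)

variable (C) in
/-- The comultiplication `Faà(C) ⥤ Faà(Faà(C))`. -/
def comultFunctor : CartFunctor (FaaObj C) (FaaObj (FaaObj C)) where
  functor :=
    { obj := comultObj
      map := comultMap
      map_id := fun P => comultMap_lin (P := P) (Q := P) (𝟙 _) (𝟙 _) (CMon.isAdditive_id _)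
      map_comp := comultMap_comp }
  obj_unit := FaaObj.ext_vec linMon_unit rfl
  obj_prod := comultObj_prod
  map_fst := comultMap_fst
  map_snd := comultMap_snd

end ComultFunctor

/-! ### Partial injections -/

section PartialInjections

variable {B C D ι : Type*} [DecidableEq ι]

/-- The partial map `φ` is injective, with values in `J`. -/
def IsPartialInjection (J : Finset ι) {r : ℕ} (φ : Fin r → Option ι) : Prop :=
  (∀ i i' j, φ i = some j → φ i' = some j → i = i') ∧ ∀ i j, φ i = some j → j ∈ J

theorem isPartialInjection_cons (J : Finset ι) {r : ℕ} (o : Option ι) (φ : Fin r → Option ι) :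
    IsPartialInjection J (Fin.cons o φ : Fin (r + 1) → Option ι)
      ↔ o ∈ Finset.insertNone J ∧ IsPartialInjection (J \ o.toFinset) φ := by
  simp only [IsPartialInjection, Fin.forall_fin_succ, Fin.cons_zero, Fin.cons_succ,
    Finset.mem_insertNone, Finset.mem_sdiff, Option.mem_toFinset, Option.mem_def]
  have h0 : ∀ i : Fin r, (0 : Fin (r + 1)) ≠ i.succ := fun i => (Fin.succ_ne_zero i).symm
  have h1 : ∀ i : Fin r, i.succ ≠ (0 : Fin (r + 1)) := fun i => Fin.succ_ne_zero i
  simp only [Fin.succ_inj, h0, h1]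
  grind

theorem univ_val_map_succ {X : Type*} {r : ℕ} (k : Fin (r + 1) → X) :
    Finset.univ.val.map k = k 0 ::ₘ Finset.univ.val.map fun i : Fin r => k i.succ := by
  rw [Fin.univ_val_map, Fin.univ_val_map, List.ofFn_succ]
  rfl

open Classical in
/-- Leibniz' rule when the factors have degree at most one and `K` is linear: each factor receives
at most one of the directions, and the remaining directions form blocks with one element. -/
theorem leibniz_eq_sum_partialInjection [Fintype ι] [AddCommMonoid B] [AddCommMonoid C]
    {G : Multiset B → C} (hG : MultiAdditive G) {r : ℕ} {k : Fin r → Multiset D → B}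
    {K : Multiset D → B} (hk : ∀ i m, 1 < Multiset.card m → k i m = 0)
    (hK : ∀ m, Multiset.card m ≠ 1 → K m = 0) (d : ι → D) (J : Finset ι) :
    leibniz G (Finset.univ.val.map k) K (J.val.map d)
      = ∑ φ : Fin r → Option ι with IsPartialInjection J φ,
        G ((Finset.univ.val.map fun i => (φ i).elim (k i 0) fun j => k i {d j})
          + (J.filter fun j => ∀ i, φ i ≠ some j).val.map fun j => K {d j}) := by
  induction r generalizing G J with
  | zero =>
    rw [Finset.filter_true_of_mem (fun φ _ => ⟨fun i => i.elim0, fun i => i.elim0⟩),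
      Fintype.sum_unique, Finset.filter_true_of_mem (fun j _ i => i.elim0)]
    rw [Finset.univ_eq_empty, Finset.empty_val, Multiset.map_zero, Multiset.map_zero, leibniz_nil,
      partComp_linear_right G K (fun a => K {a}) hG.zero hK (fun _ => rfl), Multiset.map_map,
      zero_add]
    rfl
  | succ r ih =>
    rw [univ_val_map_succ, leibniz_cons, ← sum_powerset_eq_antiSum, Finset.sum_filter,
      ← (Fin.consEquiv fun _ : Fin (r + 1) => Option ι).sum_comp, Fintype.sum_prod_type]
    -- the summands where `o` is the value of the partial injection at the first factor
    have h1 : ∀ o : Option ι, (∑ φ : Fin r → Option ι,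
        if IsPartialInjection J (Fin.cons o φ : Fin (r + 1) → Option ι) then
          G ((Finset.univ.val.map fun i => ((Fin.cons o φ : Fin (r + 1) → Option ι) i).elim (k i 0)
              fun j => k i {d j})
            + (J.filter fun j => ∀ i, (Fin.cons o φ : Fin (r + 1) → Option ι) i ≠ some j).val.map
              fun j => K {d j}) else 0)
        = if o ∈ Finset.insertNone J then leibniz (fun M => G (k 0 (o.toFinset.val.map d) ::ₘ M))
            (Finset.univ.val.map fun i : Fin r => k i.succ) K ((J \ o.toFinset).val.map d)
          else 0 := by
      intro o
      split_ifs with ho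
      · rw [ih (hG.cons _) (fun i => hk i.succ), Finset.sum_filter]
        refine Finset.sum_congr rfl fun φ _ => ?_
        refine if_congr ((isPartialInjection_cons J o φ).trans (and_iff_right ho)) ?_ rfl
        rw [univ_val_map_succ, Multiset.cons_add]
        refine congrArg G (congrArg₂ _ ?_ (congrArg₂ _ rfl ?_))
        · cases o with
          | none => rfl
          | some j => simp
        · refine congrArg (fun s : Finset ι => s.val.map fun j => K {d j}) ?_
          ext j
          simp only [Finset.mem_filter, Fin.forall_fin_succ, Fin.cons_zero, Fin.cons_succ,
            Finset.mem_sdiff, Option.mem_toFinset, Option.mem_def]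
          tauto
      · refine Finset.sum_eq_zero fun φ _ => if_neg fun h => ?_
        exact ho ((isPartialInjection_cons J o φ).1 h).1
    refine Eq.trans ?_ (Finset.sum_congr rfl fun o _ => (h1 o).symm)
    rw [← Finset.sum_filter, Finset.filter_mem_eq_inter, Finset.univ_inter]
    symm
    -- the first factor receives no direction or one direction, otherwise the summand vanishes
    refine Finset.sum_of_injOn (fun o => o.toFinset) ?_ ?_ ?_ fun _ _ => rfl
    · intro o _ o' _ h
      cases o <;> cases o' <;> simp_all
    · intro o ho
      rw [Finset.mem_coe, Finset.mem_insertNone] at ho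
      rw [Finset.mem_coe, Finset.mem_powerset]
      intro j hj
      exact ho j (Option.mem_toFinset.1 hj)
    · intro t ht hto
      have hcard : 1 < t.card := by
        by_contra hc
        rcases Nat.le_one_iff_eq_zero_or_eq_one.1 (not_lt.1 hc) with h | h
        · exact hto ⟨none, by simp, by simp [Finset.card_eq_zero.1 h]⟩
        · obtain ⟨j, rfl⟩ := Finset.card_eq_one.1 h
          refine hto ⟨some j, ?_, by simp⟩
          simpa using ht
      have h0 : k 0 (t.val.map d) = 0 := hk 0 _ (by rwa [Multiset.card_map])
      have h2 : (fun M => G (k 0 (t.val.map d) ::ₘ M)) = fun _ => 0 := by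
        funext M
        rw [h0, hG.zero]
      rw [h2, leibniz_zero_left]

end PartialInjections

/-! ### The explicit formula for the comultiplication -/

section IterDer

variable {C : Type u} [Category.{v} C] [CartesianMonoidalCategory C]

theorem eval_snd_comp {A W P : FaaObj C} (g : W ⟶ P) {T : C} (b : T ⟶ (A ⊗ W).pt)
    (m : Multiset (T ⟶ (A ⊗ W).vec.X)) :
    FaaHom.eval (snd A W ≫ g) b m = FaaHom.eval g (b ≫ snd A.pt W.pt)
      (Multiset.map (fun a : T ⟶ (A.vec.prod W.vec).X => a ≫ CMon.prodSnd A.vec W.vec) m) :=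
  FaaObj.eval_lin_comp (P := A.prod W) (Q := W) _ _ (CMon.isAdditive_snd A.vec W.vec) g b m

/-- The projections of a power are linear. -/
theorem eval_powBase_of_card (A P : FaaObj C) (r : ℕ) {T : C} (b : T ⟶ (powObj A r P).pt)
    (m : Multiset (T ⟶ (powObj A r P).vec.X)) (hm : Multiset.card m ≠ 1) :
    FaaHom.eval (powBase A P r) b m = 0 := by
  induction r with
  | zero => exact FaaHom.lin_eval_of_card (P := P) (Q := P) _ _ (CMon.isAdditive_id _) b m hm
  | succ r ih =>
    refine (eval_snd_comp (powBase A P r) b m).trans (ih _ _ ?_)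
    exact fun h => hm ((Multiset.card_map _ _).symm.trans h)

theorem eval_powProj_of_card (A P : FaaObj C) (r : ℕ) (i : Fin r) {T : C}
    (b : T ⟶ (powObj A r P).pt) (m : Multiset (T ⟶ (powObj A r P).vec.X))
    (hm : Multiset.card m ≠ 1) : FaaHom.eval (powProj A P r i) b m = 0 := by
  induction r with
  | zero => exact i.elim0
  | succ r ih =>
    refine Fin.cases ?_ (fun j => ?_) i
    · exact FaaHom.lin_eval_of_card (P := A.prod (powObj A r P)) (Q := A) _ _
        (CMon.isAdditive_fst _ _) b m hm
    · refine (eval_snd_comp (powProj A P r j) b m).trans (ih j _ _ ?_)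
      exact fun h => hm ((Multiset.card_map _ _).symm.trans h)

variable {P Q : FaaObj C}

/-- The sum over partial injections is an instance of Leibniz' rule. -/
theorem iterDer_eq_leibniz (f : P ⟶ Q) (r s : ℕ) {T : C} (b : T ⟶ (powLin P r).pt)
    (d : Fin s → (T ⟶ (powLin P r).vec.X)) :
    iterDer f r s b d = leibniz (FaaHom.eval f (b ≫ FaaHom.star (powBase (linObj P.vec) P r)))
      (Finset.univ.val.map fun i => full (T := powLin P r) (A := P.vec)
        (powProj (linObj P.vec) P r i) b)
      (FaaHom.eval (powBase (linObj P.vec) P r) b) (Finset.univ.val.map d) := by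
  classical
  refine Eq.trans ?_ (leibniz_eq_sum_partialInjection (FaaHom.multiAdditive_eval f _)
    (fun i m hm => ?_) (fun m hm => eval_powBase_of_card _ _ _ _ _ hm) d Finset.univ).symm
  · unfold iterDer
    refine Finset.sum_congr ?_ fun φ _ => congrArg₂ _ rfl (congrArg₂ _ ?_ ?_)
    · ext φ
      simp [IsPartialInjection]
    · refine Multiset.map_congr rfl fun i _ => ?_
      cases φ i <;> rfl
    · refine congrArg (fun s : Finset (Fin s) => s.val.map _) ?_
      ext j
      simp
  · refine (full_of_ne (T := powLin P r) (A := P.vec) _ b (by rintro rfl; simp at hm)).trans ?_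
    exact eval_powProj_of_card _ _ _ _ _ _ hm.ne'

theorem isComultMap_comultMap (f : P ⟶ Q) : IsComultMap f (comultMap f) where
  star := rfl
  der_star r := congrArg (FaaHom.eval f (FaaHom.star (powBase (linObj P.vec) P (r + 1))))
    (Multiset.map_map (fun u : powLin P (r + 1) ⟶ linObj P.vec => FaaHom.star u)
      (powProj (linObj P.vec) P (r + 1)) Finset.univ.val)
  der_der r s := by
    rw [iterDer_eq_leibniz]
    have := Multiset.map_map (fun u => full (T := powLin P (r + 1)) (A := P.vec) u
        (powBase (powLin P (r + 1)).vec.X (powLin P (r + 1)).pt (s + 1)))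
      (powProj (linObj P.vec) P (r + 1)) Finset.univ.val
    exact congrArg (fun κ => leibniz _ κ _ _) this

end IterDer

/-! ### Naturality of the comultiplication -/

section Naturality

variable {C : Type*} [Category* C] [CartesianMonoidalCategory C]
variable {D : Type*} [Category* D] [CartesianMonoidalCategory D]

namespace CartFunctor

variable (F : CartFunctor C D)

/-- The map `f ↦ t ≫ F f`, as an additive map. -/
@[simps] def eltHom (A : CMon C) {T : D} {S : C} (t : T ⟶ F.functor.obj S) :
    (S ⟶ A.X) →+ (T ⟶ (F.mapCMon A).X) where
  toFun f := F.elt t f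
  map_zero' := F.elt_zero t
  map_add' := F.elt_add t

/-- The image under `Faà(F)` of a generalized element of `((A, +, 0), A)`. -/
def mapLin {T : FaaObj C} {A : CMon C} (u : T ⟶ (linMon A).X) :
    F.mapObj T ⟶ (linMon (F.mapCMon A)).X :=
  F.mapFaaHom (P := T) (Q := linObj A) u

theorem full_mapLin {T : FaaObj C} {A : CMon C} (u : T ⟶ (linMon A).X) {S' : D} {S : C}
    (t : S' ⟶ F.functor.obj S) (s : S ⟶ T.pt) (m : Multiset (S ⟶ T.vec.X)) :
    full (F.mapLin u) (t ≫ F.functor.map s) (m.map (F.elt t)) = F.elt t (full u s m) := by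
  by_cases hm : m = 0
  · subst hm
    refine (Category.assoc _ _ _).trans (congrArg (t ≫ ·) ?_)
    exact (F.functor.map_comp _ _).symm
  · rw [full_of_ne _ _ (by simpa using hm), full_of_ne _ _ hm]
    exact F.eval_map (P := T) (Q := linObj A) u t s m

/-- Equality can be tested on generalized elements in the image of `F`, since every tuple of
generalized elements factors through such a tuple. -/
theorem full_map_ext {T : FaaObj C} {A : CMon D} {u w : F.mapObj T ⟶ (linMon A).X}
    (h : ∀ {S' : D} {S : C} (t : S' ⟶ F.functor.obj S) (s : S ⟶ T.pt)
      (m : Multiset (S ⟶ T.vec.X)), full u (t ≫ F.functor.map s) (m.map (F.elt (A := T.vec) t))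
        = full w (t ≫ F.functor.map s) (m.map (F.elt (A := T.vec) t))) : u = w := by
  refine full_ext fun {S'} s m => ?_
  obtain ⟨S, t, s', m', rfl, rfl⟩ := F.exists_multiset (A := T.vec) (X := T.pt) s m
  exact h t s' m'

theorem mapLin_add {T : FaaObj C} {A : CMon C} (u w : T ⟶ (linMon A).X) :
    F.mapLin (u + w) = F.mapLin u + F.mapLin w := by
  refine F.full_map_ext fun t s m => ?_
  rw [full_add, full_mapLin, full_mapLin, full_mapLin, full_add, elt_add]

theorem mapLin_zero (T : FaaObj C) (A : CMon C) :
    F.mapLin (0 : T ⟶ (linMon A).X) = 0 := by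
  refine F.full_map_ext fun t s m => ?_
  rw [full_zero, full_mapLin, full_zero, elt_zero]

/-- The identity is additive between the two monoid structures on `((F A, F +, F 0), F A)`. -/
theorem isAdditive_linMon (A : CMon C) :
    CMon.IsAdditive (A := F.faa.mapCMon (linMon A)) (B := linMon (F.mapCMon A))
      (𝟙 (linObj (F.mapCMon A))) := by
  refine ⟨fun {T} f g => ?_, fun T => ?_⟩
  · refine (Category.comp_id _).trans ?_
    obtain ⟨S, t, f', g', rfl, rfl⟩ := F.faa.exists_pair (A := linMon A) f g
    refine (F.faa.elt_add (A := linMon A) t f' g').symm.trans ?_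
    refine (congrArg (t ≫ ·) (F.mapLin_add f' g')).trans ((CMon.comp_add _ _ _).trans ?_)
    exact congrArg₂ (fun a b : T ⟶ (linMon (F.mapCMon A)).X => a + b)
      (Category.comp_id _).symm (Category.comp_id _).symm
  · refine (Category.comp_id _).trans ?_
    have t : T ⟶ F.faa.functor.obj (𝟙_ (FaaObj C)) := toUnit T ≫ eqToHom F.faa.obj_unit.symm
    refine (F.faa.elt_zero (A := linMon A) t).symm.trans ?_
    exact (congrArg (t ≫ ·) (F.mapLin_zero _ A)).trans (CMon.comp_zero _)

theorem mapCMon_linMon (A : CMon C) : F.faa.mapCMon (linMon A) = linMon (F.mapCMon A) :=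
  CMon.eq_of_isAdditive (A := F.faa.mapCMon (linMon A)) (B := linMon (F.mapCMon A)) rfl
    (F.isAdditive_linMon A)

theorem mapObj_comultObj (P : FaaObj C) :
    F.faa.mapObj (comultObj P) = comultObj (F.mapObj P) :=
  FaaObj.ext_vec (F.mapCMon_linMon P.vec) rfl

variable {P Q : FaaObj C}

theorem derEval_map (f : P ⟶ Q) {T : FaaObj C} (z : T ⟶ P)
    (us : Multiset (T ⟶ (linMon P.vec).X)) :
    derEval (F.mapFaaHom f) (F.mapFaaHom z) (us.map F.mapLin) = F.mapLin (derEval f z us) := by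
  refine F.full_map_ext fun {S' S} t s m => ?_
  rw [full_mapLin, full_derEval, full_derEval, ← leibniz_map_right, Multiset.map_map,
    Multiset.map_map]
  refine Eq.trans ?_ (map_leibniz (F.eltHom Q.vec t) _ _ _ m).symm
  have h1 : (fun M => F.eltHom Q.vec t (FaaHom.eval f (s ≫ FaaHom.star z) M))
      = fun M => FaaHom.eval (F.mapFaaHom f) (t ≫ F.functor.map (s ≫ FaaHom.star z))
        (M.map (F.elt t)) := funext fun M => (F.eval_map f t _ M).symm
  rw [h1, leibniz_map_left, Multiset.map_map]
  have h2 : (t ≫ F.functor.map s) ≫ FaaHom.star (F.mapFaaHom z)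
      = t ≫ F.functor.map (s ≫ FaaHom.star z) :=
    (Category.assoc _ _ _).trans (congrArg (t ≫ ·) (F.functor.map_comp _ _).symm)
  rw [h2]
  congr 1
  · refine Multiset.map_congr rfl fun u _ => funext fun p => ?_
    exact F.full_mapLin u t s p
  · exact funext fun p => F.eval_map z t s p

theorem comp_mapLin_comultEval (f : P ⟶ Q) {T : FaaObj D} {S : FaaObj C} (t : T ⟶ F.mapObj S)
    (x : S ⟶ P) (m : Multiset (S ⟶ (linMon P.vec).X)) :
    t ≫ F.mapLin (comultEval (comultMap f) x m)
      = comultEval (comultMap (F.mapFaaHom f)) (t ≫ F.mapFaaHom x)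
        ((m.map F.mapLin).map (t ≫ ·)) := by
  by_cases hm : m = 0
  · subst hm
    exact (congrArg (t ≫ ·) (F.mapLin_zero S Q.vec)).trans (CMon.comp_zero t)
  · have hm' : (m.map F.mapLin).map (t ≫ ·) ≠ 0 := fun h =>
      hm (Multiset.map_eq_zero.1 (Multiset.map_eq_zero.1 h))
    rw [comultEval_comultMap f x hm, comultEval_comultMap (F.mapFaaHom f) _ hm', ← comp_derEval,
      derEval_map]

/-- Naturality of the comultiplication on morphisms. -/
theorem faa_map_comultMap (f : P ⟶ Q) :
    F.faa.mapFaaHom (comultMap f) = eqToHom (F.mapObj_comultObj P) ≫ comultMap (F.mapFaaHom f)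
      ≫ eqToHom (F.mapObj_comultObj Q).symm := by
  refine FaaObj.eq_cast (F.mapObj_comultObj P) (F.mapObj_comultObj Q) _ _ rfl rfl rfl rfl ?_
    fun T x m => ?_
  · exact ((Category.id_comp _).trans (Category.comp_id _)).symm
  obtain ⟨S, t, x', m', rfl, rfl⟩ := F.faa.exists_multiset (A := linMon P.vec) (X := P) x m
  refine (F.faa.eval_map (comultMap f) t x' m').trans ?_
  refine Eq.trans ?_ (Category.comp_id _).symm
  have e1 : (t ≫ F.faa.functor.map x') ≫ eqToHom rfl = t ≫ F.mapFaaHom x' := Category.comp_id _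
  have e2 : (m'.map (F.faa.elt (A := linMon P.vec) t)).map (fun z => z ≫ eqToHom rfl)
      = (m'.map F.mapLin).map (t ≫ ·) :=
    (Multiset.map_congr rfl fun z _ => Category.comp_id z).trans
      ((Multiset.map_id _).trans (Multiset.map_map _ _ _).symm)
  exact (F.comp_mapLin_comultEval f t x' m').trans
    (congrArg₂ (comultEval (comultMap (F.mapFaaHom f))) e1 e2).symm

end CartFunctor
end Naturality

/-! ### Coassociativity -/

section Coassociativity

variable {C : Type u} [Category.{v} C] [CartesianMonoidalCategory C]

/-- The image under the comultiplication of a generalized element of `((A, +, 0), A)`. -/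
def comultLin {T : FaaObj C} {A : CMon C} (u : T ⟶ (linMon A).X) :
    comultObj T ⟶ (linMon (linMon A)).X :=
  comultMap (P := T) (Q := linObj A) u

/-- The value of the image of `u` under the comultiplication, on the directions `us` at `t`. -/
def comultFull {T S : FaaObj C} {A : CMon C} (u : T ⟶ (linMon A).X) (t : S ⟶ T)
    (us : Multiset (S ⟶ (linMon T.vec).X)) : S ⟶ (linMon A).X :=
  full (T := comultObj T) (A := linMon A) (comultLin u) t us

/-- Evaluation in two stages, at `t` and then at `s`, is Leibniz' rule; without directions `us` it
is Faà di Bruno's formula for `t ≫ u`. -/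
theorem full_comultFull {T S : FaaObj C} {A : CMon C} (u : T ⟶ (linMon A).X) (t : S ⟶ T)
    (us : Multiset (S ⟶ (linMon T.vec).X)) {R : C} (s : R ⟶ S.pt)
    (m : Multiset (R ⟶ S.vec.X)) :
    full (comultFull u t us) s m
      = leibniz (full u (s ≫ FaaHom.star t)) (us.map fun w => full w s) (FaaHom.eval t s) m := by
  by_cases hus : us = 0
  · subst hus
    rw [Multiset.map_zero, leibniz_nil]
    exact full_comp u t s m
  · have h1 : comultFull u t us = derEval (P := T) (Q := linObj A) u t us :=
      (full_of_ne (comultLin u) t hus).trans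
        (comultEval_comultMap (P := T) (Q := linObj A) u t hus)
    rw [h1]
    refine (full_derEval (P := T) (Q := linObj A) u t us s m).trans ?_
    refine leibniz_congr_left _ _ (fun p hp => (full_of_ne u _ hp).symm) (Or.inl ?_)
    simpa using hus

theorem full_full_ext {T : FaaObj (FaaObj C)} {A : CMon C} {u w : T ⟶ (linMon (linMon A)).X}
    (h : ∀ {S : FaaObj C} (t : S ⟶ T.pt) (us : Multiset (S ⟶ T.vec.X)) {R : C} (s : R ⟶ S.pt)
      (m : Multiset (R ⟶ S.vec.X)), full (full u t us) s m = full (full w t us) s m) : u = w :=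
  full_ext fun t us => full_ext fun s m => h t us s m

theorem comultLin_add {T : FaaObj C} {A : CMon C} (u w : T ⟶ (linMon A).X) :
    comultLin (u + w) = comultLin u + comultLin w := by
  refine full_full_ext fun {S} t us {R} s m => ?_
  rw [full_add, full_add]
  refine (full_comultFull (u + w) t us s m).trans ?_
  refine Eq.trans ?_ (congrArg₂ (fun a b : R ⟶ A.X => a + b) (full_comultFull u t us s m)
    (full_comultFull w t us s m)).symm
  refine Eq.trans ?_ (leibniz_add_left _ _ _ _ m)
  congr 1
  exact funext fun p => full_add u w _ p

theorem comultLin_zero (T : FaaObj C) (A : CMon C) :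
    comultLin (0 : T ⟶ (linMon A).X) = 0 := by
  refine full_full_ext fun {S} t us {R} s m => ?_
  rw [full_zero, full_zero]
  refine (full_comultFull (0 : T ⟶ (linMon A).X) t us s m).trans ?_
  refine Eq.trans ?_ (leibniz_zero_left (us.map fun w => full w s) (FaaHom.eval t s) m)
  congr 1
  exact funext fun p => full_zero _ p

/-- The identity is additive between the two monoid structures on the object
`(linMon A, ((A, +, 0), A))` of `Faà(Faà(C))`. -/
theorem isAdditive_comultFunctor (A : CMon C) :
    CMon.IsAdditive (A := (comultFunctor C).mapCMon (linMon A)) (B := linMon (linMon A))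
      (𝟙 (linObj (linMon A))) := by
  refine ⟨fun {T} f g => ?_, fun T => ?_⟩
  · refine (Category.comp_id _).trans ?_
    obtain ⟨S, t, f', g', rfl, rfl⟩ := (comultFunctor C).exists_pair (A := linMon A) f g
    refine ((comultFunctor C).elt_add (A := linMon A) t f' g').symm.trans ?_
    refine (congrArg (t ≫ ·) (comultLin_add f' g')).trans ((CMon.comp_add _ _ _).trans ?_)
    exact congrArg₂ (fun a b : T ⟶ (linMon (linMon A)).X => a + b)
      (Category.comp_id _).symm (Category.comp_id _).symm
  · refine (Category.comp_id _).trans ?_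
    have t : T ⟶ (comultFunctor C).functor.obj (𝟙_ (FaaObj C)) :=
      toUnit T ≫ eqToHom (comultFunctor C).obj_unit.symm
    refine ((comultFunctor C).elt_zero (A := linMon A) t).symm.trans ?_
    exact (congrArg (t ≫ ·) (comultLin_zero _ A)).trans (CMon.comp_zero _)

theorem comultFunctor_mapObj (P : FaaObj C) :
    (comultFunctor C).mapObj (comultObj P) = comultObj (comultObj P) :=
  FaaObj.ext_vec (CMon.eq_of_isAdditive (A := (comultFunctor C).mapCMon (linMon P.vec))
    (B := linMon (linMon P.vec)) rfl (isAdditive_comultFunctor P.vec)) rfl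

variable {P Q : FaaObj C}

/-- Coassociativity on generalized elements: an instance of the chain rule `leibniz_leibniz`. -/
theorem derEval_comult (f : P ⟶ Q) {T : FaaObj C} (z : T ⟶ P)
    {us : Multiset (T ⟶ (linMon P.vec).X)} (hus : us ≠ 0) :
    derEval (comultMap f) (comultMap z) (us.map comultLin) = comultLin (derEval f z us) := by
  refine full_full_ext fun {S} (t : S ⟶ T) (ms : Multiset (S ⟶ (linMon T.vec).X)) {R} s m => ?_
  have hw : full (derEval f z us) (s ≫ FaaHom.star t)
      = leibniz (FaaHom.eval f ((s ≫ FaaHom.star t) ≫ FaaHom.star z))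
        (us.map fun u => full u (s ≫ FaaHom.star t)) (FaaHom.eval z (s ≫ FaaHom.star t)) :=
    funext fun p => full_derEval f z us _ p
  refine Eq.trans ?_ (full_comultFull (derEval f z us) t ms s m).symm
  rw [hw, leibniz_leibniz (FaaHom.multiAdditive_eval f _), Multiset.map_map]
  have h1 : full (derEval (comultMap f) (comultMap z) (us.map comultLin)) t ms
      = leibniz (comultEval (comultMap f) (t ≫ z)) (us.map fun u => comultFull u t)
        (comultEval (comultMap z) t) ms :=
    (full_derEval (comultMap f) (comultMap z) (us.map comultLin) t ms).trans
      (congrArg (fun κ => leibniz (comultEval (comultMap f) (t ≫ z)) κ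
        (comultEval (comultMap z) t) ms) (Multiset.map_map _ _ _))
  refine (congrArg (fun w : S ⟶ (linMon Q.vec).X => full w s m) h1).trans ?_
  refine (map_leibniz (fullHom Q.vec s m) _ _ _ ms).trans ?_
  have h2 : ∀ ν, ν ≠ 0 → full (comultEval (comultMap f) (t ≫ z) ν) s m
      = leibniz (FaaHom.eval f (s ≫ FaaHom.star (t ≫ z))) (ν.map fun u => full u s)
        (FaaHom.eval (t ≫ z) s) m := by
    intro ν hν
    rw [comultEval_comultMap f _ hν, full_derEval]
  refine (leibniz_congr_left _ _ h2 (Or.inl fun h => hus (Multiset.map_eq_zero.1 h))).trans ?_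
  rw [leibniz_congr_right _ _ (fun ν hν => comultEval_comultMap z t hν),
    leibniz_map_left (fun u : S ⟶ (linMon P.vec).X => full u s) (fun κ => leibniz
      (FaaHom.eval f (s ≫ FaaHom.star (t ≫ z))) κ (FaaHom.eval (t ≫ z) s) m),
    ← leibniz_map_right (fun w : S ⟶ (linMon T.vec).X => full w s), Multiset.map_map,
    Multiset.map_map, FaaObj.comp_star, ← Category.assoc]
  have h3 : FaaHom.eval (t ≫ z) s
      = partComp (FaaHom.eval z (s ≫ FaaHom.star t)) (FaaHom.eval t s) :=
    funext fun p => FaaHom.eval_comp t z s p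
  rw [h3]
  congr 1
  · refine Multiset.map_congr rfl fun u _ => funext fun p => ?_
    exact funext fun q => full_comultFull u t p s q
  · exact funext fun p => funext fun q => full_derEval z t p s q

theorem comp_comultLin_comultEval (f : P ⟶ Q) {T : FaaObj (FaaObj C)} {S : FaaObj C}
    (t : T ⟶ comultObj S) (x : S ⟶ P) (m : Multiset (S ⟶ (linMon P.vec).X)) :
    t ≫ comultLin (comultEval (comultMap f) x m)
      = comultEval (comultMap (comultMap f)) (t ≫ comultMap x)
        ((m.map comultLin).map (t ≫ ·)) := by
  by_cases hm : m = 0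
  · subst hm
    exact (congrArg (t ≫ ·) (comultLin_zero S Q.vec)).trans (CMon.comp_zero t)
  · have hm' : (m.map comultLin).map (t ≫ ·) ≠ 0 := fun h =>
      hm (Multiset.map_eq_zero.1 (Multiset.map_eq_zero.1 h))
    rw [comultEval_comultMap f x hm]
    refine (congrArg (t ≫ ·) (derEval_comult f x hm).symm).trans ?_
    exact (comp_derEval (comultMap f) t (comultMap x) (m.map comultLin)).trans
      (comultEval_comultMap (comultMap f) _ hm').symm

theorem comultFunctor_map_comultMap (f : P ⟶ Q) :
    (comultFunctor C).mapFaaHom (comultMap f) = eqToHom (comultFunctor_mapObj P)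
      ≫ comultMap (comultMap f) ≫ eqToHom (comultFunctor_mapObj Q).symm := by
  refine FaaObj.eq_cast (comultFunctor_mapObj P) (comultFunctor_mapObj Q) _ _ rfl rfl rfl rfl ?_
    fun T x m => ?_
  · exact ((Category.id_comp _).trans (Category.comp_id _)).symm
  obtain ⟨S, t, x', m', rfl, rfl⟩ :=
    (comultFunctor C).exists_multiset (A := linMon P.vec) (X := P) x m
  refine ((comultFunctor C).eval_map (comultMap f) t x' m').trans ?_
  refine Eq.trans ?_ (Category.comp_id _).symm
  have e1 : (t ≫ (comultFunctor C).functor.map x') ≫ eqToHom rfl = t ≫ comultMap x' :=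
    Category.comp_id _
  have e2 : (m'.map ((comultFunctor C).elt (A := linMon P.vec) t)).map (fun z => z ≫ eqToHom rfl)
      = (m'.map comultLin).map (t ≫ ·) :=
    (Multiset.map_congr rfl fun z _ => Category.comp_id z).trans
      ((Multiset.map_id _).trans (Multiset.map_map _ _ _).symm)
  exact (comp_comultLin_comultEval f t x' m').trans
    (congrArg₂ (comultEval (comultMap (comultMap f))) e1 e2).symm

end Coassociativity

/-! ### The comonad -/

section Comonad

/-- The counit, as a natural transformation. -/
def faaCounitNat : Faa.{v, u} ⟶ 𝟭 CartCat.{v, u} where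
  app := faaCounit
  naturality _ _ _ := CartFunctor.ext rfl

/-- The comultiplication, as a natural transformation. -/
def faaComultNat : Faa.{v, u} ⟶ Faa.{v, u} ⋙ Faa.{v, u} where
  app X := comultFunctor X.carrier
  naturality _ _ F := (CartFunctor.ext (CategoryTheory.Functor.ext
    (CartFunctor.mapObj_comultObj F) fun _ _ f => CartFunctor.faa_map_comultMap F f)).symm

/-- The components `_*` of the monoid structure of `linMon A` are those of `A`. -/
theorem faaCounit_mapCMon_linMon (X : CartCat.{v, u}) (A : CMon X.carrier) :
    (faaCounit X).mapCMon (linMon A) = A := by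
  have key : ∀ {T : X.carrier} {S : FaaObj X.carrier} (t : T ⟶ S.pt) (u : S ⟶ (linMon A).X),
      CartFunctor.elt (faaCounit X) (A := linMon A) t u = full u t 0 := fun _ _ => rfl
  refine CMon.eq_of_isAdditive (A := (faaCounit X).mapCMon (linMon A)) (B := A) rfl
    ⟨fun {T} f g => ?_, fun T => ?_⟩
  · refine (Category.comp_id _).trans ?_
    obtain ⟨S, t, f', g', rfl, rfl⟩ := CartFunctor.exists_pair (faaCounit X) (A := linMon A) f g
    refine (CartFunctor.elt_add (faaCounit X) (A := linMon A) t f' g').symm.trans ?_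
    refine (full_add f' g' t 0).trans ?_
    exact congrArg₂ (fun a b : T ⟶ A.X => a + b)
      (Category.comp_id _).symm (Category.comp_id _).symm
  · refine (Category.comp_id _).trans ?_
    have t : T ⟶ (faaCounit X).functor.obj (𝟙_ (FaaObj X.carrier)) := toUnit T
    refine (CartFunctor.elt_zero (faaCounit X) (A := linMon A) t).symm.trans ?_
    exact full_zero _ 0

theorem faaCounit_mapObj (X : CartCat.{v, u}) (P : FaaObj X.carrier) :
    (faaCounit X).mapObj (comultObj P) = P :=
  FaaObj.ext_vec (faaCounit_mapCMon_linMon X P.vec) rfl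

/-- Since `(δ(f)_r)_* = f_r`, the counit recovers `f` from its comultiplication. -/
theorem star_comultEval {C : Type u} [Category.{v} C] [CartesianMonoidalCategory C]
    {P Q S : FaaObj C} (f : P ⟶ Q) (x : S ⟶ P) (m : Multiset (S ⟶ (linMon P.vec).X)) {T : C}
    (t : T ⟶ S.pt) : full (comultEval (comultMap f) x m) t 0
      = FaaHom.eval f (t ≫ FaaHom.star x) (m.map fun u => full u t 0) := by
  by_cases hm : m = 0
  · subst hm
    exact full_zero t 0
  · rw [comultEval_comultMap f x hm, full_derEval, leibniz_zero, Multiset.map_map]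
    rfl

theorem faaCounit_map_comultMap (X : CartCat.{v, u}) {P Q : FaaObj X.carrier} (f : P ⟶ Q) :
    (faaCounit X).mapFaaHom (comultMap f) = eqToHom (faaCounit_mapObj X P) ≫ f
      ≫ eqToHom (faaCounit_mapObj X Q).symm := by
  refine FaaObj.eq_cast (faaCounit_mapObj X P) (faaCounit_mapObj X Q) _ _ rfl rfl rfl rfl ?_
    fun T x m => ?_
  · exact ((Category.id_comp _).trans (Category.comp_id _)).symm
  obtain ⟨S, t, x', m', rfl, rfl⟩ :=
    CartFunctor.exists_multiset (faaCounit X) (A := linMon P.vec) (X := P) x m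
  refine (CartFunctor.eval_map (faaCounit X) (comultMap f) t x' m').trans ?_
  refine (star_comultEval f x' m' t).trans (Eq.trans ?_ (Category.comp_id _).symm)
  have e1 : (t ≫ (faaCounit X).functor.map x') ≫ eqToHom rfl = t ≫ FaaHom.star x' :=
    Category.comp_id _
  have e2 : (m'.map (CartFunctor.elt (faaCounit X) (A := linMon P.vec) t)).map
      (fun z => z ≫ eqToHom rfl) = m'.map fun u => full u t 0 :=
    (Multiset.map_congr rfl fun z _ => Category.comp_id z).trans (Multiset.map_id _)
  exact (congrArg₂ (FaaHom.eval f) e1 e2).symm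

/-- The comonad `Faà`. -/
def faaComonad : Comonad CartCat.{v, u} where
  toFunctor := Faa
  ε := faaCounitNat
  δ := faaComultNat
  coassoc X := by
    apply CartFunctor.ext
    refine CategoryTheory.Functor.ext comultFunctor_mapObj fun P Q f => ?_
    exact comultFunctor_map_comultMap f
  left_counit X := CartFunctor.ext rfl
  right_counit X := by
    apply CartFunctor.ext
    refine CategoryTheory.Functor.ext (faaCounit_mapObj X) fun P Q f => ?_
    exact faaCounit_map_comultMap X f

theorem isComult_comultFunctor (X : CartCat.{v, u}) :
    IsComult (X := X) (comultFunctor X.carrier) where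
  obj _ := rfl
  map f := by
    have : eqToHom rfl ≫ comultMap f ≫ eqToHom rfl = comultMap f :=
      (Category.id_comp _).trans (Category.comp_id _)
    exact this.symm ▸ isComultMap_comultMap f

end Comonad

end FaaDiBruno

theorem mainTheorem2 :
    ∃ (G : Comonad FaaDiBruno.CartCat.{v, u})
      (ε : FaaDiBruno.Faa.{v, u} ⟶ 𝟭 FaaDiBruno.CartCat.{v, u})
      (δ : FaaDiBruno.Faa.{v, u} ⟶ FaaDiBruno.Faa.{v, u} ⋙ FaaDiBruno.Faa.{v, u}),
      G.toFunctor = FaaDiBruno.Faa.{v, u} ∧ HEq G.ε ε ∧ HEq G.δ δ ∧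
        (∀ X, ε.app X = FaaDiBruno.faaCounit X) ∧
        (∀ X, FaaDiBruno.IsComult (δ.app X)) :=
  ⟨FaaDiBruno.faaComonad, FaaDiBruno.faaCounitNat, FaaDiBruno.faaComultNat, rfl, HEq.rfl, HEq.rfl,
    fun _ => rfl, FaaDiBruno.isComult_comultFunctor⟩
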